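/- Let $m\ge 1$ be a fixed integer. An instance consists of $n\ge 1$ jobs $1,\dots,n$ with integer processing times $p_j\ge 1$, integer weights $w_j\ge 0$ and integer due dates $d_j\ge 0$, as far as the objective uses them; put $p_{\max}=\max_j p_j$ and $P=\sum_j p_j$. A schedule on $m$ identical parallel machines assigns to each job $j$ a machine and a start time $S_j\ge 0$ such that jobs on the same machine do not overlap; preemption is not allowed. The completion time of $j$ is $C_j=S_j+p_j$. Write $L_{\max}=\max_j (C_j-d_j)$, and let $U_j=1$ if $C_j>d_j$ and $U_j=0$ otherwise. Assume that the input lists the jobs in priority order, that is, $w_1/p_1\ge\dots\ge w_n/p_n$ for the objective $\sum_j w_jC_j$, and $d_1\le\dots\le d_n$ for the objectives $L_{\max}$ and $\sum_j w_jU_j$. The computational model is a random access machine with unit-cost arithmetic on words of $O(\log N)$ bits, where $N$ is the length of the input plus the largest number in it. For every fixed $m$, the problems $Pm||\sum w_jC_j$ and $Pm||L_{\max}$ (find a schedule that minimizes $\sum_j w_jC_j$, respectively $L_{\max}$, and its objective value) can each be solved in $O(p_{\max}^{2m-2}\cdot n)$ time, and the problem $Pm||\sum w_jU_j$ (find a schedule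 that minimizes $\sum_j w_jU_j$, and its objective value) can be solved in $O(p_{\max}^{2m-2}\cdot P\cdot n)$ time, where $p_{\max}^{2m-2}\cdot P\cdot n\le p_{\max}^{2m-1}\cdot n^2$. The constants in the $O(\cdot)$ depend only on $m$. -/

import Mathlib

/-! ### A random access machine with unit-cost operations on words of logarithmic length -/

namespace RAM

/-- A machine state: registers, and a memory that is addressed by words.
All numbers in it are integers; the semantics below bounds their size. -/
structure State where
  reg : ℕ → ℤ
  mem : ℤ → ℤ

/-- The arithmetic operations (`div` and `mod` are integer division with remainder). -/
inductive Op where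
  | add
  | sub
  | mul
  | div
  | mod

def Op.apply : Op → ℤ → ℤ → ℤ
  | .add, x, y => x + y
  | .sub, x, y => x - y
  | .mul, x, y => x * y
  | .div, x, y => x / y
  | .mod, x, y => x % y

/-- Expressions: literals, registers, the memory cell at a computed address, arithmetic. -/
inductive Expr where
  | const (z : ℤ)
  | reg (r : ℕ)
  | load (a : Expr)
  | bin (o : Op) (a b : Expr)

/-- The value of an expression in a state. -/
def Expr.eval (s : State) : Expr → ℤ
  | .const z => z
  | .reg r => s.reg r
  | .load a => s.mem (a.eval s)
  | .bin o a b => o.apply (a.eval s) (b.eval s)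

/-- The number of unit-cost operations spent on evaluating an expression. -/
def Expr.cost : Expr → ℕ
  | .const _ => 1
  | .reg _ => 1
  | .load a => 1 + a.cost
  | .bin _ a b => 1 + a.cost + b.cost

/-- No overflow: every value that occurs in the evaluation (addresses included) is a word,
that is, an integer of absolute value at most `B`. -/
def Expr.Fits (B : ℕ) (s : State) : Expr → Prop
  | .const z => z.natAbs ≤ B
  | .reg r => (s.reg r).natAbs ≤ B
  | .load a => a.Fits B s ∧ (s.mem (a.eval s)).natAbs ≤ B
  | .bin o a b => a.Fits B s ∧ b.Fits B s ∧ (o.apply (a.eval s) (b.eval s)).natAbs ≤ B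

/-- Programs. `assign r e` writes `e` to register `r`; `store a e` writes `e` to the memory cell
with address `a`; `branch a b p q` runs `p` if `a ≤ b` and `q` otherwise; `loop a b p` repeats
`p` as long as `a ≤ b`. -/
inductive Program where
  | skip
  | assign (r : ℕ) (e : Expr)
  | store (a e : Expr)
  | seq (p q : Program)
  | branch (a b : Expr) (p q : Program)
  | loop (a b : Expr) (p : Program)

/-- `Exec B p s t s'`: on words of absolute value at most `B`, the program `p`, started in the
state `s`, halts after exactly `t` steps in the state `s'`, without any overflow on the way. -/
inductive Exec (B : ℕ) : Program → State → ℕ → State → Prop where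
  | skip (s : State) : Exec B .skip s 1 s
  | assign (s : State) (r : ℕ) (e : Expr) (he : e.Fits B s) :
      Exec B (.assign r e) s (1 + e.cost)
        { s with reg := Function.update s.reg r (e.eval s) }
  | store (s : State) (a e : Expr) (ha : a.Fits B s) (he : e.Fits B s) :
      Exec B (.store a e) s (1 + a.cost + e.cost)
        { s with mem := Function.update s.mem (a.eval s) (e.eval s) }
  | seq (p q : Program) (s s₁ s₂ : State) (t₁ t₂ : ℕ)
      (hp : Exec B p s t₁ s₁) (hq : Exec B q s₁ t₂ s₂) :
      Exec B (.seq p q) s (t₁ + t₂) s₂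
  | branch_true (a b : Expr) (p q : Program) (s s₁ : State) (t : ℕ)
      (ha : a.Fits B s) (hb : b.Fits B s) (h : a.eval s ≤ b.eval s) (hp : Exec B p s t s₁) :
      Exec B (.branch a b p q) s (1 + a.cost + b.cost + t) s₁
  | branch_false (a b : Expr) (p q : Program) (s s₁ : State) (t : ℕ)
      (ha : a.Fits B s) (hb : b.Fits B s) (h : b.eval s < a.eval s) (hq : Exec B q s t s₁) :
      Exec B (.branch a b p q) s (1 + a.cost + b.cost + t) s₁
  | loop_true (a b : Expr) (p : Program) (s s₁ s₂ : State) (t₁ t₂ : ℕ)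
      (ha : a.Fits B s) (hb : b.Fits B s) (h : a.eval s ≤ b.eval s)
      (hp : Exec B p s t₁ s₁) (hl : Exec B (.loop a b p) s₁ t₂ s₂) :
      Exec B (.loop a b p) s (1 + a.cost + b.cost + t₁ + t₂) s₂
  | loop_false (a b : Expr) (p : Program) (s : State)
      (ha : a.Fits B s) (hb : b.Fits B s) (h : b.eval s < a.eval s) :
      Exec B (.loop a b p) s (1 + a.cost + b.cost) s

/-- The initial state: the input is in the cells `0, 1, 2, …`; all else is zero. -/
def initial (input : List ℤ) : State where
  reg := fun _ => 0
  mem := fun a => if 0 ≤ a then input.getD a.toNat 0 else 0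

/-- The word bound `N ^ k`, where `N` is the length of the input plus the largest absolute value
of a number in it; so a word has about `k * log₂ N` bits. -/
def wordBound (k : ℕ) (input : List ℤ) : ℕ :=
  (input.length + (input.map Int.natAbs).foldr max 0) ^ k

end RAM

/-! ### Scheduling on identical parallel machines -/

namespace Scheduling

/-- A non-empty list of jobs with processing times `p j ≥ 1`, weights `w j`, due dates `d j`. -/
structure Jobs where
  n : ℕ
  n_pos : 0 < n
  p : Fin n → ℕ
  w : Fin n → ℕ
  d : Fin n → ℕ
  p_pos : ∀ j, 0 < p j

/-- The maximum processing time. -/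
def Jobs.pmax (J : Jobs) : ℕ := Finset.univ.sup J.p

/-- The total processing time. -/
def Jobs.P (J : Jobs) : ℕ := ∑ j, J.p j

/-- The jobs are listed in non-increasing order of efficiency `w j / p j`. -/
def Jobs.EfficiencyOrdered (J : Jobs) : Prop :=
  ∀ i j : Fin J.n, i ≤ j → (J.w j : ℚ) / J.p j ≤ (J.w i : ℚ) / J.p i

/-- The jobs are listed in non-decreasing order of due date. -/
def Jobs.DueDateOrdered (J : Jobs) : Prop :=
  ∀ i j : Fin J.n, i ≤ j → J.d i ≤ J.d j

/-- A non-preemptive schedule on `m` identical machines: each job gets a machine and a start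
time, and no two jobs on the same machine overlap. -/
structure Schedule (m : ℕ) (J : Jobs) where
  machine : Fin J.n → Fin m
  start : Fin J.n → ℝ
  start_nonneg : ∀ j, 0 ≤ start j
  disjoint : ∀ i j, i ≠ j → machine i = machine j →
    start i + J.p i ≤ start j ∨ start j + J.p j ≤ start i

/-- The completion time of a job. -/
noncomputable def Schedule.completion {m : ℕ} {J : Jobs} (σ : Schedule m J) (j : Fin J.n) : ℝ :=
  σ.start j + J.p j

/-- The total weighted completion time. -/
noncomputable def sumWC {m : ℕ} (J : Jobs) (σ : Schedule m J) : ℝ :=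
  ∑ j, (J.w j : ℝ) * σ.completion j

/-- The maximum lateness. -/
noncomputable def lMax {m : ℕ} (J : Jobs) (σ : Schedule m J) : ℝ :=
  Finset.univ.sup' (Finset.univ_nonempty_iff.mpr ⟨⟨0, J.n_pos⟩⟩)
    (fun j => σ.completion j - J.d j)

/-- The weighted number of tardy jobs. -/
noncomputable def sumWU {m : ℕ} (J : Jobs) (σ : Schedule m J) : ℝ :=
  ∑ j, if (J.d j : ℝ) < σ.completion j then (J.w j : ℝ) else 0

/-- The input `n, p, w`. -/
def Jobs.inputPW (J : Jobs) : List ℤ :=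
  (J.n : ℤ) :: (List.ofFn (fun j => (J.p j : ℤ)) ++ List.ofFn (fun j => (J.w j : ℤ)))

/-- The input `n, p, d`. -/
def Jobs.inputPD (J : Jobs) : List ℤ :=
  (J.n : ℤ) :: (List.ofFn (fun j => (J.p j : ℤ)) ++ List.ofFn (fun j => (J.d j : ℤ)))

/-- The input `n, p, w, d`. -/
def Jobs.inputPWD (J : Jobs) : List ℤ :=
  (J.n : ℤ) :: (List.ofFn (fun j => (J.p j : ℤ)) ++ List.ofFn (fun j => (J.w j : ℤ)) ++
    List.ofFn (fun j => (J.d j : ℤ)))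

/-- The memory holds an optimal schedule `σ` and its objective value: the value is in cell `0`,
the machine of job `j` in cell `1 + j` and its start time in cell `1 + n + j`
(jobs and machines are numbered from `0`). -/
def IsOptimalOutput {m : ℕ} (J : Jobs) (f : Schedule m J → ℝ) (mem : ℤ → ℤ) : Prop :=
  ∃ σ : Schedule m J,
    (∀ τ : Schedule m J, f σ ≤ f τ) ∧
    (mem 0 : ℝ) = f σ ∧
    ∀ j : Fin J.n,
      mem (1 + (j : ℤ)) = ((σ.machine j : ℕ) : ℤ) ∧
      (mem (1 + (J.n : ℤ) + (j : ℤ)) : ℝ) = σ.start j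

/-- Minimizing `f` over the schedules on `m` machines, for jobs that are listed in the given
order, takes time `O(T)`: one program, on words of logarithmic length, finds on every such
input an optimal schedule and its value in at most `c * T` steps. -/
def SolvableInTime (m : ℕ) (input : Jobs → List ℤ) (Ordered : Jobs → Prop)
    (f : (J : Jobs) → Schedule m J → ℝ) (T : Jobs → ℕ) : Prop :=
  ∃ (prog : RAM.Program) (c k : ℕ), ∀ J : Jobs, Ordered J →
    ∃ (t : ℕ) (s : RAM.State),
      RAM.Exec (RAM.wordBound k (input J)) prog (RAM.initial (input J)) t s ∧
      t ≤ c * T J ∧ IsOptimalOutput J (f J) s.mem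

end Scheduling

/-! Fix the priority order (Smith's order for `sumWC`, earliest due date for the other two). Some
optimal schedule runs the jobs of each machine in this order without idle time; for `sumWU` this
concerns the on-time jobs, and the late ones are postponed to the end. So only an assignment of jobs
to machines is sought, and a dynamic program over prefixes of the list, with the vector of machine
loads as state, finds one. The running time rests on the fact that few load vectors matter: with `N`
a bound on the processing times, some optimal assignment keeps any two loads within `4 * N ^ 2` of
each other after every prefix (`exists_balanced`).

Balancing works by exchange. Suppose that machine `i` is ahead of machine `k` by more than `4 * N ^
2` after `v` jobs. Since the last earlier prefix with gap below `2 * N ^ 2`, machine `i` has gained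
at least `2 * N ^ 2`. If the gap falls below `2 * N ^ 2` again after `v`, then `k` gains at least
that much in the meantime. A pigeonhole argument (`exists_equal_blocks`) yields a block of jobs on
`i` before `v` and one on `k` after `v` with the same total length, positive and at most `2 * N ^
2`; they are swapped. If the gap stays large, a block of `i` is moved to `k` for good. While load is
displaced, its amount is at most the gap, so after no prefix does the sum of squared loads or the
maximum load increase, and the squares strictly decrease at `v`. Hence the process ends.

The relation `Dominates` keeps what the objectives need. For due dates it is the maximum load: in
due date order, the jobs of a prefix that count share a common deadline. For `sumWC` it is the
squares: `w j * C j` is `w j / p j` times a quantity that is, up to a term independent of the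
assignment, half the increment of the sum of squares, and the ratios are non-increasing, so
summation by parts applies (`Dominates.sumWC_le`).

A state is thus given by the `m - 1` load differences to machine `0`, each from a window of `8 *
pmax ^ 2 + 1` values. The load of machine `0` follows from the length of the prefix, except for
`sumWU`, where late jobs are not counted in the loads; there it is stored as well, at the price of a
factor `P + 1`. For fixed `m` a table entry takes constant time.

The algorithm is an explicit program. Time and word size of loop-free parts are bounded
syntactically by `size` and `weight` (`exec_of_loopFree`), loops are treated by invariants
(`Runs.loop`), and `solvableInTime_of_problem` combines the run of the program with the lower and
upper bounds for each objective. -/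

namespace RAM

/-! ### Running time and word size of structured programs -/

instance : Add Expr := ⟨.bin .add⟩
instance : Sub Expr := ⟨.bin .sub⟩
instance : Mul Expr := ⟨.bin .mul⟩
instance : Div Expr := ⟨.bin .div⟩
instance : Mod Expr := ⟨.bin .mod⟩

namespace Expr

@[simp] theorem eval_const (s : State) (z : ℤ) : (const z).eval s = z := rfl
@[simp] theorem eval_reg (s : State) (r : ℕ) : (reg r).eval s = s.reg r := rfl
@[simp] theorem eval_load (s : State) (a : Expr) : (load a).eval s = s.mem (a.eval s) := rfl
@[simp] theorem eval_add (s : State) (a b : Expr) : (a + b).eval s = a.eval s + b.eval s := rfl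
@[simp] theorem eval_sub (s : State) (a b : Expr) : (a - b).eval s = a.eval s - b.eval s := rfl
@[simp] theorem eval_mul (s : State) (a b : Expr) : (a * b).eval s = a.eval s * b.eval s := rfl
@[simp] theorem eval_div (s : State) (a b : Expr) : (a / b).eval s = a.eval s / b.eval s := rfl
@[simp] theorem eval_mod (s : State) (a b : Expr) : (a % b).eval s = a.eval s % b.eval s := rfl

/-- An exponent that bounds the growth of values in the evaluation of an expression. -/
def weight : Expr → ℕ
  | const z => z.natAbs + 1
  | reg _ => 1
  | load a => 1 + a.weight
  | bin _ a b => 1 + a.weight + b.weight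

theorem one_le_weight (e : Expr) : 1 ≤ e.weight := by
  cases e <;> simp only [weight] <;> omega

end Expr

/-- All registers and all memory cells have absolute value at most `X`. -/
def State.Bounded (X : ℕ) (s : State) : Prop :=
  (∀ r, (s.reg r).natAbs ≤ X) ∧ ∀ a, (s.mem a).natAbs ≤ X

theorem State.Bounded.mono {X Y : ℕ} {s : State} (h : s.Bounded X) (hXY : X ≤ Y) : s.Bounded Y :=
  ⟨fun r => (h.1 r).trans hXY, fun a => (h.2 a).trans hXY⟩

/-- The summand `1` in the exponent pays for the factor `2` in sums and differences. A quotient is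
no larger than the dividend; a remainder is smaller than the divisor, or equal to the dividend if
the divisor is zero. -/
theorem Op.natAbs_apply_le (o : Op) (x y : ℤ) {X a b : ℕ} (hX : 2 ≤ X)
    (ha : x.natAbs ≤ X ^ a) (hb : y.natAbs ≤ X ^ b) :
    (o.apply x y).natAbs ≤ X ^ (1 + a + b) := by
  have hX1 : 1 ≤ X := by omega
  have ha' : X ^ a ≤ X ^ (a + b) := Nat.pow_le_pow_right hX1 (by omega)
  have hb' : X ^ b ≤ X ^ (a + b) := Nat.pow_le_pow_right hX1 (by omega)
  have hs : 2 * X ^ (a + b) ≤ X ^ (1 + a + b) := by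
    rw [show 1 + a + b = (a + b) + 1 by omega, pow_succ']
    exact Nat.mul_le_mul_right _ hX
  cases o with
  | add =>
    have := Int.natAbs_add_le x y
    simp only [apply]
    omega
  | sub =>
    have := Int.natAbs_sub_le x y
    simp only [apply]
    omega
  | mul =>
    have h : x.natAbs * y.natAbs ≤ X ^ a * X ^ b := Nat.mul_le_mul ha hb
    rw [← pow_add] at h
    simp only [apply, Int.natAbs_mul]
    omega
  | div =>
    have := Int.natAbs_ediv_le_natAbs x y
    simp only [apply]
    omega
  | mod =>
    simp only [apply]
    rcases eq_or_ne y 0 with rfl | hy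
    · simp only [Int.emod_zero]
      omega
    · have h1 := Int.emod_nonneg x hy
      have h2 := Int.emod_lt_abs x hy
      have h3 : ((y.natAbs : ℕ) : ℤ) = |y| := Int.natCast_natAbs y
      omega

theorem Expr.natAbs_eval_le (e : Expr) {X : ℕ} {s : State} (hX : 2 ≤ X) (h : s.Bounded X) :
    (e.eval s).natAbs ≤ X ^ e.weight := by
  induction e with
  | const z =>
    -- A literal is below a power of `2`, hence of `X`, with an exponent that depends on the program
    -- only.
    refine (Nat.le_succ _).trans ((Nat.lt_two_pow_self (n := z.natAbs + 1)).le.trans ?_)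
    exact Nat.pow_le_pow_left hX _
  | reg r => simpa [weight] using h.1 r
  | load a ih =>
    exact (h.2 _).trans (Nat.le_self_pow (by simp [weight]) X)
  | bin o a b iha ihb => exact Op.natAbs_apply_le o _ _ hX iha ihb

theorem Expr.fits_of_bounded (e : Expr) {X B : ℕ} {s : State} (hX : 2 ≤ X) (h : s.Bounded X)
    (hB : X ^ e.weight ≤ B) : e.Fits B s := by
  have hX1 : 1 ≤ X := by omega
  have hv := (e.natAbs_eval_le hX h).trans hB
  induction e with
  | const z => exact hv
  | reg r => exact hv
  | load a ih =>
    have ha : X ^ a.weight ≤ B :=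
      (Nat.pow_le_pow_right hX1 (Nat.le_add_left a.weight 1)).trans hB
    exact ⟨ih ha ((a.natAbs_eval_le hX h).trans ha), hv⟩
  | bin o a b iha ihb =>
    have ha : X ^ a.weight ≤ B := (Nat.pow_le_pow_right hX1
      (show a.weight ≤ 1 + a.weight + b.weight by omega)).trans hB
    have hb : X ^ b.weight ≤ B := (Nat.pow_le_pow_right hX1
      (show b.weight ≤ 1 + a.weight + b.weight by omega)).trans hB
    exact ⟨iha ha ((a.natAbs_eval_le hX h).trans ha),
      ihb hb ((b.natAbs_eval_le hX h).trans hb), hv⟩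

namespace Program

/-- Sequential composition of a list of programs. -/
def block : List Program → Program
  | [] => skip
  | p :: ps => seq p (block ps)

/-- The program contains no loop. -/
def LoopFree : Program → Prop
  | skip => True
  | assign _ _ => True
  | store _ _ => True
  | seq p q => p.LoopFree ∧ q.LoopFree
  | branch _ _ p q => p.LoopFree ∧ q.LoopFree
  | loop _ _ _ => False

/-- The program contains neither loops nor stores, and assigns only to registers in `A`. -/
def AssignsOnly (A : Set ℕ) : Program → Prop
  | skip => True
  | assign r _ => r ∈ A
  | store _ _ => False
  | seq p q => p.AssignsOnly A ∧ q.AssignsOnly A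
  | branch _ _ p q => p.AssignsOnly A ∧ q.AssignsOnly A
  | loop _ _ _ => False

/-- The final state of a loop-free program. -/
def run : Program → State → State
  | skip, s => s
  | assign r e, s => { s with reg := Function.update s.reg r (e.eval s) }
  | store a e, s => { s with mem := Function.update s.mem (a.eval s) (e.eval s) }
  | seq p q, s => q.run (p.run s)
  | branch a b p q, s => if a.eval s ≤ b.eval s then p.run s else q.run s
  | loop _ _ _, s => s

/-- A bound on the running time of a loop-free program. -/
def size : Program → ℕ
  | skip => 1
  | assign _ e => 1 + e.cost
  | store a e => 1 + a.cost + e.cost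
  | seq p q => p.size + q.size
  | branch a b p q => 1 + a.cost + b.cost + p.size + q.size
  | loop a b p => 1 + a.cost + b.cost + p.size

/-- An exponent that bounds the growth of values in a run without passing through a loop. -/
def weight : Program → ℕ
  | skip => 1
  | assign _ e => e.weight
  | store a e => a.weight + e.weight
  | seq p q => p.weight * q.weight
  | branch a b p q => a.weight + b.weight + p.weight + q.weight
  | loop a b p => a.weight + b.weight + p.weight

@[simp] theorem run_skip (s : State) : skip.run s = s := rfl
@[simp] theorem run_seq (p q : Program) (s : State) : (seq p q).run s = q.run (p.run s) := rfl
@[simp] theorem run_block_nil (s : State) : (block []).run s = s := rfl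
@[simp] theorem run_block_cons (p : Program) (ps : List Program) (s : State) :
    (block (p :: ps)).run s = (block ps).run (p.run s) := rfl
@[simp] theorem run_assign_mem (r : ℕ) (e : Expr) (s : State) :
    ((assign r e).run s).mem = s.mem := rfl
@[simp] theorem run_assign_reg (r : ℕ) (e : Expr) (s : State) (r' : ℕ) :
    ((assign r e).run s).reg r' = if r' = r then e.eval s else s.reg r' := by
  simp [run, Function.update_apply]
@[simp] theorem run_store_reg (a e : Expr) (s : State) :
    ((store a e).run s).reg = s.reg := rfl
@[simp] theorem run_store_mem (a e : Expr) (s : State) (x : ℤ) :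
    ((store a e).run s).mem x = if x = a.eval s then e.eval s else s.mem x := by
  simp [run, Function.update_apply]
theorem run_branch (a b : Expr) (p q : Program) (s : State) :
    (branch a b p q).run s = if a.eval s ≤ b.eval s then p.run s else q.run s := rfl

theorem one_le_weight (p : Program) : 1 ≤ p.weight := by
  induction p with
  | skip => exact le_rfl
  | assign r e => exact e.one_le_weight
  | store a e => exact a.one_le_weight.trans (Nat.le_add_right _ _)
  | seq p q hp hq => exact Nat.mul_le_mul hp hq
  | branch a b p q hp hq =>
    simp only [weight]
    omega
  | loop a b p hp =>
    simp only [weight]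
    omega

theorem AssignsOnly.mono {A B : Set ℕ} (hAB : A ⊆ B) {p : Program} (h : p.AssignsOnly A) :
    p.AssignsOnly B := by
  induction p with
  | skip => trivial
  | assign r e => exact hAB h
  | store a e => exact h
  | seq p q hp hq => exact ⟨hp h.1, hq h.2⟩
  | branch a b p q hp hq => exact ⟨hp h.1, hq h.2⟩
  | loop a b p hp => exact h

theorem AssignsOnly.loopFree {A : Set ℕ} {p : Program} (h : p.AssignsOnly A) : p.LoopFree := by
  induction p with
  | skip => trivial
  | assign r e => trivial
  | store a e => trivial
  | seq p q hp hq => exact ⟨hp h.1, hq h.2⟩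
  | branch a b p q hp hq => exact ⟨hp h.1, hq h.2⟩
  | loop a b p hp => exact h

theorem AssignsOnly.run_mem {A : Set ℕ} {p : Program} (h : p.AssignsOnly A) (s : State) :
    (p.run s).mem = s.mem := by
  induction p generalizing s with
  | skip => rfl
  | assign r e => rfl
  | store a e => exact h.elim
  | seq p q hp hq => rw [run_seq, hq h.2, hp h.1]
  | branch a b p q hp hq =>
    rw [run_branch]
    split_ifs
    · exact hp h.1 s
    · exact hq h.2 s
  | loop a b p hp => exact h.elim

theorem AssignsOnly.run_reg {A : Set ℕ} {p : Program} (h : p.AssignsOnly A) (s : State) {r : ℕ}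
    (hr : r ∉ A) : (p.run s).reg r = s.reg r := by
  induction p generalizing s with
  | skip => rfl
  | assign r' e =>
    have : r ≠ r' := fun h' => hr (h' ▸ h)
    simp [this]
  | store a e => exact h.elim
  | seq p q hp hq => rw [run_seq, hq h.2, hp h.1]
  | branch a b p q hp hq =>
    rw [run_branch]
    split_ifs
    · exact hp h.1 s
    · exact hq h.2 s
  | loop a b p hp => exact h.elim

theorem weight_le_seq_left (p q : Program) : p.weight ≤ (seq p q).weight :=
  Nat.le_mul_of_pos_right _ q.one_le_weight

theorem weight_le_seq_right (p q : Program) : q.weight ≤ (seq p q).weight :=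
  Nat.le_mul_of_pos_left _ p.one_le_weight

theorem weight_le_loop (a b : Expr) (p : Program) : p.weight ≤ (loop a b p).weight :=
  Nat.le_add_left _ _

/-- Each instruction takes numbers bounded by `X` to numbers bounded by a fixed power of `X`, so
sequencing multiplies exponents. The induction generalizes `X` because the second half of a sequence
starts from the bound `X ^ p.weight`. -/
theorem exec_of_loopFree {p : Program} (hp : p.LoopFree) {X B : ℕ} (hX : 2 ≤ X) {s : State}
    (hs : s.Bounded X) (hB : X ^ p.weight ≤ B) :
    (p.run s).Bounded (X ^ p.weight) ∧ ∃ t ≤ p.size, Exec B p s t (p.run s) := by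
  have hX1 : 1 ≤ X := by omega
  induction p generalizing X s with
  | skip => exact ⟨by simpa [weight] using hs, 1, le_rfl, Exec.skip s⟩
  | assign r e =>
    refine ⟨⟨fun r' => ?_, fun a => ?_⟩, _, le_rfl, Exec.assign s r e (e.fits_of_bounded hX hs hB)⟩
    · rw [run_assign_reg]
      split_ifs
      · exact e.natAbs_eval_le hX hs
      · exact (hs.1 r').trans (Nat.le_self_pow (by have := e.one_le_weight; simp only [weight]; omega) X)
    · exact (hs.2 a).trans (Nat.le_self_pow (by have := e.one_le_weight; simp only [weight]; omega) X)
  | store a e =>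
    have h1 := e.one_le_weight
    have h2 := a.one_le_weight
    have ha : X ^ a.weight ≤ X ^ (a.weight + e.weight) := Nat.pow_le_pow_right hX1 (by omega)
    have he : X ^ e.weight ≤ X ^ (a.weight + e.weight) := Nat.pow_le_pow_right hX1 (by omega)
    refine ⟨⟨fun r' => ?_, fun x => ?_⟩, _, le_rfl, Exec.store s a e
      (a.fits_of_bounded hX hs (ha.trans hB)) (e.fits_of_bounded hX hs (he.trans hB))⟩
    · exact (hs.1 r').trans (Nat.le_self_pow (by simp only [weight]; omega) X)
    · rw [run_store_mem]
      split_ifs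
      · exact (e.natAbs_eval_le hX hs).trans he
      · exact (hs.2 x).trans (Nat.le_self_pow (by simp only [weight]; omega) X)
  | seq p q ihp ihq =>
    have h1 := p.one_le_weight
    have h2 := q.one_le_weight
    have hle : X ^ p.weight ≤ X ^ (p.weight * q.weight) :=
      Nat.pow_le_pow_right hX1 (Nat.le_mul_of_pos_right _ h2)
    obtain ⟨hb1, t1, ht1, he1⟩ := ihp hp.1 hX hs (hle.trans hB) hX1
    have hX' : 2 ≤ X ^ p.weight := hX.trans (Nat.le_self_pow (by omega) X)
    obtain ⟨hb2, t2, ht2, he2⟩ := ihq hp.2 hX' hb1 (by rw [← pow_mul]; exact hB) (by omega)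
    refine ⟨?_, t1 + t2, Nat.add_le_add ht1 ht2, Exec.seq p q s _ _ t1 t2 he1 he2⟩
    rw [← pow_mul] at hb2
    exact hb2
  | branch a b p q ihp ihq =>
    have hle : ∀ w, w ≤ (branch a b p q).weight → X ^ w ≤ X ^ (branch a b p q).weight :=
      fun w hw => Nat.pow_le_pow_right hX1 hw
    have hla := hle a.weight (by simp only [weight]; omega)
    have hlb := hle b.weight (by simp only [weight]; omega)
    have hlp := hle p.weight (by simp only [weight]; omega)
    have hlq := hle q.weight (by simp only [weight]; omega)
    have fa := a.fits_of_bounded hX hs (hla.trans hB)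
    have fb := b.fits_of_bounded hX hs (hlb.trans hB)
    obtain ⟨hb1, t1, ht1, he1⟩ := ihp hp.1 hX hs (hlp.trans hB) hX1
    obtain ⟨hb2, t2, ht2, he2⟩ := ihq hp.2 hX hs (hlq.trans hB) hX1
    rw [run_branch]
    split_ifs with h
    · exact ⟨hb1.mono hlp, _, by simp only [size]; omega,
        Exec.branch_true a b p q s _ t1 fa fb h he1⟩
    · exact ⟨hb2.mono hlq, _, by simp only [size]; omega,
        Exec.branch_false a b p q s _ t2 fa fb (not_le.mp h) he2⟩
  | loop a b p ih => exact hp.elim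

end Program

/-- On words bounded by `B`, the program `p`, started in `s`, halts within `T` steps
in a state that satisfies `Q`. -/
def Runs (B : ℕ) (p : Program) (s : State) (T : ℕ) (Q : State → Prop) : Prop :=
  ∃ t s', Exec B p s t s' ∧ t ≤ T ∧ Q s'

theorem Runs.of_loopFree {p : Program} (hp : p.LoopFree) {X B : ℕ} (hX : 2 ≤ X) {s : State}
    (hs : s.Bounded X) (hB : X ^ p.weight ≤ B) {Q : State → Prop} (hQ : Q (p.run s)) :
    Runs B p s p.size Q := by
  obtain ⟨_, t, ht, he⟩ := Program.exec_of_loopFree hp hX hs hB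
  exact ⟨t, _, he, ht, hQ⟩

theorem Runs.seq {p q : Program} {B T₁ T₂ : ℕ} {s : State} {Q R : State → Prop}
    (hp : Runs B p s T₁ Q) (hq : ∀ s', Q s' → Runs B q s' T₂ R) :
    Runs B (.seq p q) s (T₁ + T₂) R := by
  obtain ⟨t₁, s₁, e₁, h₁, hQ⟩ := hp
  obtain ⟨t₂, s₂, e₂, h₂, hR⟩ := hq s₁ hQ
  exact ⟨_, _, Exec.seq p q s s₁ s₂ t₁ t₂ e₁ e₂, Nat.add_le_add h₁ h₂, hR⟩

/-- The loop rule: `I i` is the invariant after `i` out of `K` rounds. -/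
theorem Runs.loop {a b : Expr} {p : Program} {B X K T : ℕ} (I : ℕ → State → Prop)
    (hX : 2 ≤ X) (hB : X ^ (Program.loop a b p).weight ≤ B)
    (hI : ∀ i s, I i s → s.Bounded X)
    (hstep : ∀ i s, i < K → I i s → a.eval s ≤ b.eval s ∧ Runs B p s T (I (i + 1)))
    (hend : ∀ s, I K s → b.eval s < a.eval s) {s : State} (h0 : I 0 s) :
    Runs B (.loop a b p) s (K * (1 + a.cost + b.cost + T) + (1 + a.cost + b.cost)) (I K) := by
  have hX1 : 1 ≤ X := by omega
  have ha : X ^ a.weight ≤ B :=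
    (Nat.pow_le_pow_right hX1 (by simp only [Program.weight]; omega)).trans hB
  have hb : X ^ b.weight ≤ B :=
    (Nat.pow_le_pow_right hX1 (by simp only [Program.weight]; omega)).trans hB
  -- Induction on the number `r` of remaining rounds. The invariant restores the same bound `X` in
  -- every round, so the exponent does not grow with the number of rounds.
  have key : ∀ r i s, i + r = K → I i s →
      Runs B (.loop a b p) s (r * (1 + a.cost + b.cost + T) + (1 + a.cost + b.cost)) (I K) := by
    intro r
    induction r with
    | zero =>
      intro i s hi hs
      obtain rfl : i = K := by omega
      exact ⟨_, s, Exec.loop_false a b p s (a.fits_of_bounded hX (hI _ _ hs) ha)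
        (b.fits_of_bounded hX (hI _ _ hs) hb) (hend s hs), by omega, hs⟩
    | succ r ih =>
      intro i s hi hs
      obtain ⟨hle, t₁, s₁, e₁, h₁, hI₁⟩ := hstep i s (by omega) hs
      obtain ⟨t₂, s₂, e₂, h₂, hI₂⟩ := ih (i + 1) s₁ (by omega) hI₁
      refine ⟨_, s₂, Exec.loop_true a b p s s₁ s₂ t₁ t₂ (a.fits_of_bounded hX (hI _ _ hs) ha)
        (b.fits_of_bounded hX (hI _ _ hs) hb) hle e₁ e₂, ?_, hI₂⟩
      rw [Nat.succ_mul]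
      omega
  exact key K 0 s (by omega) h0

theorem Runs.mono {p : Program} {B T T' : ℕ} {s : State} {Q R : State → Prop}
    (h : Runs B p s T Q) (hT : T ≤ T') (hQ : ∀ s', Q s' → R s') : Runs B p s T' R := by
  obtain ⟨t, s', e, ht, hq⟩ := h
  exact ⟨t, s', e, ht.trans hT, hQ s' hq⟩

end RAM

/-! ### Balancing machine loads by exchanging blocks of jobs -/

namespace Scheduling

/-- The load of machine `i` after the first `j` jobs, if job `t` is put on machine `a t`. -/
def load (p : ℕ → ℤ) (a : ℕ → ℕ) (i j : ℕ) : ℤ :=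
  ∑ t ∈ Finset.range j, if a t = i then p t else 0

@[simp] theorem load_zero (p : ℕ → ℤ) (a : ℕ → ℕ) (i : ℕ) : load p a i 0 = 0 := by simp [load]

theorem load_succ (p : ℕ → ℤ) (a : ℕ → ℕ) (i j : ℕ) :
    load p a i (j + 1) = load p a i j + if a j = i then p j else 0 := by
  simp [load, Finset.sum_range_succ]

theorem load_mono {p : ℕ → ℤ} (hp : ∀ t, 0 ≤ p t) (a : ℕ → ℕ) (i : ℕ) :
    Monotone (load p a i) := by
  refine monotone_nat_of_le_succ fun j => ?_
  rw [load_succ]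
  have := hp j
  split_ifs <;> omega

theorem load_nonneg {p : ℕ → ℤ} (hp : ∀ t, 0 ≤ p t) (a : ℕ → ℕ) (i j : ℕ) :
    0 ≤ load p a i j := by
  simpa using load_mono hp a i (Nat.zero_le j)

theorem load_succ_le {p : ℕ → ℤ} {N : ℤ} (hp : ∀ t, 0 ≤ p t) (hpN : ∀ t, p t ≤ N)
    (a : ℕ → ℕ) (i j : ℕ) : load p a i (j + 1) ≤ load p a i j + N := by
  rw [load_succ]
  have := hp j
  have := hpN j
  split_ifs <;> omega

/-- A sequence with steps at most `N` meets every interval of length `N` in its range. -/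
theorem exists_hit {A : ℕ → ℤ} {N : ℤ} (hN : 1 ≤ N) (hA : ∀ t, A (t + 1) ≤ A t + N) {u v : ℕ}
    (huv : u ≤ v) {c : ℤ} (hu : A u ≤ c) (hv : c ≤ A v) :
    ∃ t, u ≤ t ∧ t ≤ v ∧ c ≤ A t ∧ A t < c + N := by
  induction v, huv using Nat.le_induction with
  | base => exact ⟨u, le_rfl, le_rfl, hv, by omega⟩
  | succ v huv ih =>
    by_cases h : c ≤ A v
    · obtain ⟨t, h1, h2, h3⟩ := ih h
      exact ⟨t, h1, by omega, h3⟩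
    · have := hA v
      exact ⟨v + 1, by omega, le_rfl, hv, by omega⟩

/-- Two non-decreasing sequences with steps at most `N` that grow by at least `2 * N ^ 2`
contain blocks with the same positive growth, which is at most `2 * N ^ 2`. -/
theorem exists_equal_blocks {A B : ℕ → ℤ} {N : ℤ} (hN : 1 ≤ N) (mA : Monotone A) (mB : Monotone B)
    (hA : ∀ t, A (t + 1) ≤ A t + N) (hB : ∀ t, B (t + 1) ≤ B t + N) {u v v' w : ℕ}
    (huv : u ≤ v) (hvw : v' ≤ w) (gA : A u + 2 * N ^ 2 ≤ A v) (gB : B v' + 2 * N ^ 2 ≤ B w) :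
    ∃ x x' y y', u ≤ x ∧ x ≤ x' ∧ x' ≤ v ∧ v' ≤ y ∧ y ≤ y' ∧ y' ≤ w ∧
      A x' - A x = B y' - B y ∧ 0 < A x' - A x ∧ A x' - A x ≤ 2 * N ^ 2 := by
  obtain ⟨M, rfl⟩ : ∃ M : ℕ, N = M := ⟨N.toNat, by omega⟩
  -- Both ranges are cut into `2 * M` windows of length `M`; steps are at most `M`, so each sequence
  -- has a member in each of its windows.
  have hit : ∀ l ∈ Finset.range (2 * M), ∃ x y, (u ≤ x ∧ x ≤ v ∧ A u + l * M ≤ A x ∧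
      A x < A u + l * M + M) ∧ (v' ≤ y ∧ y ≤ w ∧ B v' + l * M ≤ B y ∧
      B y < B v' + l * M + M) := by
    intro l hl
    have hl' : (l : ℤ) + 1 ≤ 2 * M := by
      have := Finset.mem_range.mp hl
      omega
    have h0 : (0 : ℤ) ≤ l * M := by positivity
    have h1 : (l : ℤ) * M ≤ 2 * M ^ 2 := by nlinarith
    obtain ⟨x, hx⟩ := exists_hit hN hA huv (c := A u + l * M) (by omega) (by omega)
    obtain ⟨y, hy⟩ := exists_hit hN hB hvw (c := B v' + l * M) (by omega) (by omega)
    exact ⟨x, y, hx, hy⟩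
  choose! x y hx hy using hit
  -- The offsets within the two windows lie in `[0, M)`, so their difference takes at most `2 * M -
  -- 1` values, fewer than there are windows. Two windows with the same difference give equal growth
  -- of both sequences.
  have maps : ∀ l ∈ Finset.range (2 * M), (A (x l) - A u) - (B (y l) - B v') ∈
      Finset.Ioo (-(M : ℤ)) M := by
    intro l hl
    have h1 := hx l hl
    have h2 := hy l hl
    rw [Finset.mem_Ioo]
    constructor <;> omega
  have key : ∃ l ∈ Finset.range (2 * M), ∃ l' ∈ Finset.range (2 * M), l < l' ∧
      (A (x l) - A u) - (B (y l) - B v') = (A (x l') - A u) - (B (y l') - B v') := by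
    obtain ⟨l, hl, l', hl', hne, h⟩ := Finset.exists_ne_map_eq_of_card_lt_of_maps_to
      (by rw [Int.card_Ioo, Finset.card_range]; omega) maps
    rcases lt_or_gt_of_ne hne with h' | h'
    · exact ⟨l, hl, l', hl', h', h⟩
    · exact ⟨l', hl', l, hl, h', h.symm⟩
  obtain ⟨l, hl, l', hl', hlt, h⟩ := key
  obtain ⟨x1, x2, x3, x4⟩ := hx l hl
  obtain ⟨x1', x2', x3', x4'⟩ := hx l' hl'
  obtain ⟨y1, y2, y3, y4⟩ := hy l hl
  obtain ⟨y1', y2', y3', y4'⟩ := hy l' hl'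
  have hll : (l : ℤ) + 1 ≤ l' := by omega
  have hl2 : (l' : ℤ) + 1 ≤ 2 * M := by
    have := Finset.mem_range.mp hl'
    omega
  have hmul : (l : ℤ) * M + M ≤ l' * M := by nlinarith
  have hmul2 : (l' : ℤ) * M + M ≤ 2 * M ^ 2 := by nlinarith
  have hl0 : (0 : ℤ) ≤ l * M := by positivity
  have hAlt : A (x l) < A (x l') := by omega
  have hBlt : B (y l) < B (y l') := by omega
  exact ⟨x l, x l', y l, y l', x1, (mA.reflect_lt hAlt).le, x2', y1, (mB.reflect_lt hBlt).le, y2',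
    by omega, by omega, by omega⟩

/-- The assignment `a'` is at least as balanced as `a` after any number of jobs. -/
structure Dominates (p : ℕ → ℤ) (m n : ℕ) (a a' : ℕ → ℕ) : Prop where
  sq_le : ∀ j ≤ n, ∑ i ∈ Finset.range m, load p a' i j ^ 2 ≤ ∑ i ∈ Finset.range m, load p a i j ^ 2
  le_of_le : ∀ j ≤ n, ∀ X, (∀ i < m, load p a i j ≤ X) → ∀ i < m, load p a' i j ≤ X
  -- Values from `m` on encode jobs that are left out (the late ones); exchanges do not touch them.
  eq_of_ge : ∀ t, m ≤ a t → a' t = a t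
  lt_of_lt : ∀ t, a t < m → a' t < m

theorem Dominates.refl (p : ℕ → ℤ) (m n : ℕ) (a : ℕ → ℕ) : Dominates p m n a a :=
  ⟨fun _ _ => le_rfl, fun _ _ _ h => h, fun _ _ => rfl, fun _ h => h⟩

theorem Dominates.trans {p : ℕ → ℤ} {m n : ℕ} {a b c : ℕ → ℕ} (h : Dominates p m n a b)
    (h' : Dominates p m n b c) : Dominates p m n a c where
  sq_le j hj := (h'.sq_le j hj).trans (h.sq_le j hj)
  le_of_le j hj X hX := h'.le_of_le j hj X (h.le_of_le j hj X hX)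
  eq_of_ge t ht := by
    have := h.eq_of_ge t ht
    rw [h'.eq_of_ge t (by omega), this]
  lt_of_lt t ht := h'.lt_of_lt t (h.lt_of_lt t ht)

/-- The transfer of a non-negative `δ` from `i` to `k` does not increase the sum of squares as long
as `δ` is at most the gap `L i - L k`. -/
theorem sum_sq_transfer {m i k : ℕ} (hi : i < m) (hk : k < m) (hik : i ≠ k) {L L' : ℕ → ℤ} {δ : ℤ}
    (h1 : L' i = L i - δ) (h2 : L' k = L k + δ) (h3 : ∀ l, l ≠ i → l ≠ k → L' l = L l) :
    ∑ l ∈ Finset.range m, L' l ^ 2 =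
      ∑ l ∈ Finset.range m, L l ^ 2 - 2 * (δ * (L i - L k - δ)) := by
  have := Finset.sum_eq_add_of_mem (s := Finset.range m) (f := fun l => L' l ^ 2 - L l ^ 2) i k
    (Finset.mem_range.mpr hi) (Finset.mem_range.mpr hk) hik (fun l _ hl => by
      simp [h3 l hl.1 hl.2])
  rw [Finset.sum_sub_distrib, h1, h2] at this
  linarith

/-- Exchange the block of jobs `x, …, x' - 1` on machine `i` with the block `y, …, y' - 1`
on machine `k`. -/
def exchange (a : ℕ → ℕ) (i k x x' y y' : ℕ) (t : ℕ) : ℕ :=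
  if (x ≤ t ∧ t < x') ∧ a t = i then k else if (y ≤ t ∧ t < y') ∧ a t = k then i else a t

/-- The load that `exchange` moves from machine `i` to machine `k` up to position `j`. -/
def moved (p : ℕ → ℤ) (a : ℕ → ℕ) (i k x x' y y' j : ℕ) : ℤ :=
  (load p a i (max x (min j x')) - load p a i x) - (load p a k (max y (min j y')) - load p a k y)

/-- The expression `max x (min j x')` clamps `j` to the block, so that the load there, minus the
load at `x`, is the part of the block on machine `i` before position `j`. -/
theorem load_block_succ (p : ℕ → ℤ) (a : ℕ → ℕ) (i x x' j : ℕ) (hx : x ≤ x') :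
    load p a i (max x (min (j + 1) x')) = load p a i (max x (min j x')) +
      if (x ≤ j ∧ j < x') ∧ a j = i then p j else 0 := by
  by_cases h : x ≤ j ∧ j < x'
  · rw [show max x (min (j + 1) x') = j + 1 by omega, show max x (min j x') = j by omega, load_succ]
    simp [h]
  · rw [show max x (min (j + 1) x') = max x (min j x') by omega]
    simp [h]

theorem load_exchange (p : ℕ → ℤ) (a : ℕ → ℕ) {i k x x' y y' : ℕ} (hik : i ≠ k) (hx : x ≤ x')
    (hy : y ≤ y') (j : ℕ) :
    load p (exchange a i k x x' y y') i j = load p a i j - moved p a i k x x' y y' j ∧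
    load p (exchange a i k x x' y y') k j = load p a k j + moved p a i k x x' y y' j ∧
    ∀ l, l ≠ i → l ≠ k → load p (exchange a i k x x' y y') l j = load p a l j := by
  induction j with
  | zero => simp [moved]
  | succ j ih =>
    obtain ⟨h1, h2, h3⟩ := ih
    have hm : moved p a i k x x' y y' (j + 1) = moved p a i k x x' y y' j +
        (if (x ≤ j ∧ j < x') ∧ a j = i then p j else 0) -
        (if (y ≤ j ∧ j < y') ∧ a j = k then p j else 0) := by
      simp only [moved, load_block_succ p a i x x' j hx, load_block_succ p a k y y' j hy]
      ring
    refine ⟨?_, ?_, fun l hl hl' => ?_⟩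
    · rw [load_succ, load_succ, hm, h1, exchange]
      by_cases ha : a j = i
      · by_cases hb : x ≤ j ∧ j < x' <;> simp [ha, hb, hik, hik.symm] <;> ring
      · by_cases hc : a j = k <;> by_cases hb : y ≤ j ∧ j < y' <;>
          simp [ha, hc, hb, hik.symm] <;> ring
    · rw [load_succ, load_succ, hm, h2, exchange]
      by_cases ha : a j = i
      · by_cases hb : x ≤ j ∧ j < x' <;> simp [ha, hb, hik] <;> ring
      · by_cases hc : a j = k <;> by_cases hb : y ≤ j ∧ j < y' <;>
          simp [ha, hc, hb, hik, hik.symm] <;> ring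
    · rw [load_succ, load_succ, h3 l hl hl', exchange]
      by_cases ha : a j = i
      · by_cases hb : x ≤ j ∧ j < x' <;> simp [ha, hb, hl.symm, hl'.symm, hik]
      · by_cases hc : a j = k <;> by_cases hb : y ≤ j ∧ j < y' <;>
          simp [ha, hc, hb, hl.symm, hl'.symm, hik.symm]

/-- The block on `k` comes after the block on `i` and is no longer, so the net amount moved lies
between `0` and the length of the first block at every prefix. The gap must be at least this length
only where load can be displaced: after `y'`, a swap of blocks of equal length has restored all
loads, which is why `hdiff` may assume there that the blocks differ. At `v`, between the blocks, the
full length is displaced and is smaller than the gap, so the squares strictly decrease. -/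
theorem dominates_exchange {p : ℕ → ℤ} (hp : ∀ t, 0 ≤ p t) {m n : ℕ} {a : ℕ → ℕ}
    {i k x x' y y' : ℕ} (hi : i < m) (hk : k < m) (hik : i ≠ k) (hx : x ≤ x') (hxy : x' ≤ y)
    (hy : y ≤ y') (hle : load p a k y' - load p a k y ≤ load p a i x' - load p a i x)
    (hdiff : ∀ j ≤ n, x < j →
      (y' ≤ j → load p a k y' - load p a k y < load p a i x' - load p a i x) →
      load p a i x' - load p a i x ≤ load p a i j - load p a k j) {v : ℕ}
    (hxv : x' ≤ v) (hvy : v ≤ y) (hpos : 0 < load p a i x' - load p a i x)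
    (hvd : load p a i x' - load p a i x < load p a i v - load p a k v) :
    Dominates p m n a (exchange a i k x x' y y') ∧
      ∑ l ∈ Finset.range m, load p (exchange a i k x x' y y') l v ^ 2 <
        ∑ l ∈ Finset.range m, load p a l v ^ 2 := by
  have hmoved : ∀ j ≤ n, 0 ≤ moved p a i k x x' y y' j ∧ (moved p a i k x x' y y' j = 0 ∨
      moved p a i k x x' y y' j ≤ load p a i j - load p a k j) := by
    intro j hj
    have mi : Monotone (load p a i) := load_mono hp a i
    have mk : Monotone (load p a k) := load_mono hp a k
    have hi1 := mi (show x ≤ max x (min j x') by omega)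
    have hi2 := mi (show max x (min j x') ≤ x' by omega)
    have hk1 := mk (show y ≤ max y (min j y') by omega)
    have hk2 := mk (show max y (min j y') ≤ y' by omega)
    rcases Nat.lt_or_ge x j with hxj | hxj
    · rcases Nat.lt_or_ge y j with hyj | hyj
      · rcases Nat.lt_or_ge j y' with hyj' | hyj'
        · have := hdiff j hj hxj (by omega)
          have e : max x (min j x') = x' := by omega
          simp only [moved, e] at *
          omega
        · have e : max x (min j x') = x' := by omega
          have e' : max y (min j y') = y' := by omega
          have := hdiff j hj hxj
          simp only [moved, e, e'] at *
          by_cases hlt : load p a k y' - load p a k y < load p a i x' - load p a i x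
          · have := this (fun _ => hlt)
            omega
          · omega
      · have e' : max y (min j y') = y := by omega
        have := hdiff j hj hxj
        simp only [moved, e'] at *
        by_cases hlt : y' ≤ j
        · have : y' = y := by omega
          subst this
          have := hdiff j hj hxj (fun _ => by omega)
          omega
        · have := hdiff j hj hxj (fun h => absurd h hlt)
          omega
    · have e : max x (min j x') = x := by omega
      have e' : max y (min j y') = y := by omega
      simp [moved, e, e']
  constructor
  · constructor
    · intro j hj
      obtain ⟨h1, h2, h3⟩ := load_exchange p a hik hx hy j
      obtain ⟨m1, m2⟩ := hmoved j hj
      rw [sum_sq_transfer hi hk hik h1 h2 h3]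
      rcases m2 with m2 | m2
      · simp [m2]
      · have := mul_nonneg m1 (sub_nonneg.mpr m2)
        omega
    · intro j hj X hX l hl
      obtain ⟨h1, h2, h3⟩ := load_exchange p a hik hx hy j
      obtain ⟨m1, m2⟩ := hmoved j hj
      have := hX i hi
      have := hX k hk
      have := hX l hl
      by_cases hli : l = i
      · subst hli
        omega
      · by_cases hlk : l = k
        · subst hlk
          omega
        · rw [h3 l hli hlk]
          omega
    · intro t ht
      have h1 : a t ≠ i := by omega
      have h2 : a t ≠ k := by omega
      simp [exchange, h1, h2]
    · intro t ht
      simp only [exchange]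
      split_ifs <;> assumption
  · obtain ⟨h1, h2, h3⟩ := load_exchange p a hik hx hy v
    rw [sum_sq_transfer hi hk hik h1 h2 h3]
    have e : moved p a i k x x' y y' v = load p a i x' - load p a i x := by
      have e : max x (min v x') = x' := by omega
      have e' : max y (min v y') = y := by omega
      simp [moved, e, e']
    rw [e]
    have := mul_pos hpos (sub_pos.mpr hvd)
    omega

theorem exists_last_not {Q : ℕ → Prop} (h0 : ¬ Q 0) (v : ℕ) :
    ∃ u ≤ v, ¬ Q u ∧ ∀ t, u < t → t ≤ v → Q t := by
  induction v with
  | zero => exact ⟨0, le_rfl, h0, fun t h1 h2 => by omega⟩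
  | succ v ih =>
    by_cases h : Q (v + 1)
    · obtain ⟨u, h1, h2, h3⟩ := ih
      refine ⟨u, by omega, h2, fun t ht ht' => ?_⟩
      rcases Nat.lt_or_ge v t with h4 | h4
      · rwa [show t = v + 1 by omega]
      · exact h3 t ht h4
    · exact ⟨v + 1, le_rfl, h, fun t h1 h2 => by omega⟩

/-- An assignment with loads that differ by more than `4 * N ^ 2` can be improved. -/
theorem exists_improvement {p : ℕ → ℤ} {N : ℤ} (hN : 1 ≤ N) (hp : ∀ t, 0 ≤ p t)
    (hpN : ∀ t, p t ≤ N) {m n : ℕ} {a : ℕ → ℕ} {i k v : ℕ} (hi : i < m) (hk : k < m) (hv : v ≤ n)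
    (hvd : 4 * N ^ 2 < load p a i v - load p a k v) :
    ∃ a', Dominates p m n a a' ∧ ∃ v ≤ n, ∑ l ∈ Finset.range m, load p a' l v ^ 2 <
        ∑ l ∈ Finset.range m, load p a l v ^ 2 := by
  have hik : i ≠ k := by
    rintro rfl
    nlinarith
  have hN2 : 1 ≤ N ^ 2 := by nlinarith
  have mi : Monotone (load p a i) := load_mono hp a i
  have mk : Monotone (load p a k) := load_mono hp a k
  -- At prefix `0` the gap is `0`, so there is a last prefix `u ≤ v` with gap below `2 * N ^ 2`.
  -- From there to `v` the gap, and hence the load of `i`, grows by at least `2 * N ^ 2`.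
  obtain ⟨u, huv, hu, hu'⟩ := exists_last_not
    (Q := fun t => 2 * N ^ 2 ≤ load p a i t - load p a k t) (by simp; omega) v
  simp only [not_le] at hu
  have gA : load p a i u + 2 * N ^ 2 ≤ load p a i v := by
    have := mk huv
    omega
  -- If the gap closes to below `2 * N ^ 2` after `v`, let `w` be the first such prefix: machine `k`
  -- has caught up by `2 * N ^ 2` and equal blocks can be swapped. Otherwise the gap stays large up
  -- to `n`, and a block may leave machine `i` for good.
  by_cases hw : ∃ w, v ≤ w ∧ w ≤ n ∧ load p a i w - load p a k w < 2 * N ^ 2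
  · classical
    have hw1 := Nat.find_spec hw
    have hw2 : ∀ t, v ≤ t → t < Nat.find hw → t ≤ n → 2 * N ^ 2 ≤ load p a i t - load p a k t := by
      intro t h1 h2 h3
      have := Nat.find_min hw h2
      by_contra hcon
      exact this ⟨h1, h3, by omega⟩
    set w := Nat.find hw
    have gB : load p a k v + 2 * N ^ 2 ≤ load p a k w := by
      have := mi hw1.1
      omega
    obtain ⟨x, x', y, y', hux, hxx, hxv, hvy, hyy, hyw, heq, hpos, hle⟩ :=
      exists_equal_blocks hN mi mk (load_succ_le hp hpN a i) (load_succ_le hp hpN a k) huv hw1.1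
        gA gB
    obtain ⟨h1, h2⟩ := dominates_exchange hp (n := n) hi hk hik hxx (hxv.trans hvy) hyy heq.ge
      (fun j hj hxj hj' => by
        have hjy : j < y' := by
          by_contra hcon
          have := hj' (by omega)
          omega
        refine hle.trans ?_
        rcases Nat.lt_or_ge j v with h | h
        · exact hu' j (by omega) h.le
        · exact hw2 j h (by omega) hj) hxv hvy hpos (by omega)
    exact ⟨_, h1, v, hv, h2⟩
  · push Not at hw
    -- Only one block is needed here, with length in `(0, 2 * N ^ 2]`; the pigeonhole lemma is
    -- applied to twice the same sequence. The second block of the exchange is empty, at `v`.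
    obtain ⟨x, x', y, y', hux, hxx, hxv, -, -, -, -, hpos, hle⟩ :=
      exists_equal_blocks hN mi mi (load_succ_le hp hpN a i) (load_succ_le hp hpN a i) huv huv
        gA gA
    obtain ⟨h1, h2⟩ := dominates_exchange hp (n := n) (y := v) hi hk hik hxx hxv le_rfl
      (by omega) (fun j hj hxj hj' => by
        refine hle.trans ?_
        rcases Nat.lt_or_ge j v with h | h
        · exact hu' j (by omega) h.le
        · exact hw j h hj) hxv le_rfl hpos (by omega)
    exact ⟨_, h1, v, hv, h2⟩

/-- Every assignment is dominated by one in which the loads of any two machines differ by at most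
`4 * N ^ 2` after any number of jobs. -/
theorem exists_balanced {p : ℕ → ℤ} {N : ℤ} (hN : 1 ≤ N) (hp : ∀ t, 0 ≤ p t)
    (hpN : ∀ t, p t ≤ N) (m n : ℕ) (a : ℕ → ℕ) :
    ∃ a', Dominates p m n a a' ∧
      ∀ j ≤ n, ∀ i < m, ∀ k < m, load p a' i j - load p a' k j ≤ 4 * N ^ 2 := by
  -- The potential, the squared loads summed over machines and prefixes, is a natural number that
  -- drops with every improvement.
  let Φ : (ℕ → ℕ) → ℕ := fun b =>
    (∑ j ∈ Finset.range (n + 1), ∑ l ∈ Finset.range m, load p b l j ^ 2).toNat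
  have hΦ : ∀ b, ((Φ b : ℕ) : ℤ) =
      ∑ j ∈ Finset.range (n + 1), ∑ l ∈ Finset.range m, load p b l j ^ 2 := fun b =>
    Int.toNat_of_nonneg (Finset.sum_nonneg fun _ _ => Finset.sum_nonneg fun _ _ => sq_nonneg _)
  induction hr : Φ a using Nat.strong_induction_on generalizing a with
  | _ r ih =>
    by_cases hbal : ∀ j ≤ n, ∀ i < m, ∀ k < m, load p a i j - load p a k j ≤ 4 * N ^ 2
    · exact ⟨a, Dominates.refl p m n a, hbal⟩
    · push Not at hbal
      obtain ⟨v, hv, i, hi, k, hk, hlt⟩ := hbal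
      obtain ⟨b, hdom, v', hv', hlt'⟩ := exists_improvement hN hp hpN hi hk hv hlt
      have hlt : Φ b < Φ a := by
        have : ((Φ b : ℕ) : ℤ) < Φ a := by
          rw [hΦ, hΦ]
          exact Finset.sum_lt_sum
            (fun j hj => hdom.sq_le j (by have := Finset.mem_range.mp hj; omega))
            ⟨v', Finset.mem_range.mpr (by omega), hlt'⟩
        exact_mod_cast this
      obtain ⟨c, hc, hc'⟩ := ih (Φ b) (hr ▸ hlt) b rfl
      exact ⟨c, hdom.trans hc, hc'⟩

end Scheduling

/-! ### From schedules to assignments, and the total weighted completion time -/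

namespace Scheduling

/-- The extension by zero of the data of the jobs to all natural numbers. -/
def extend {n : ℕ} (f : Fin n → ℕ) (t : ℕ) : ℤ := if h : t < n then (f ⟨t, h⟩ : ℤ) else 0

theorem extend_of_lt {n : ℕ} (f : Fin n → ℕ) {t : ℕ} (h : t < n) : extend f t = (f ⟨t, h⟩ : ℤ) := by
  simp [extend, h]

@[simp] theorem extend_fin {n : ℕ} (f : Fin n → ℕ) (x : Fin n) : extend f x = (f x : ℤ) := by
  simp [extend]

theorem extend_nonneg {n : ℕ} (f : Fin n → ℕ) (t : ℕ) : 0 ≤ extend f t := by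
  unfold extend
  split_ifs <;> omega

theorem load_eq_sum_filter {n : ℕ} (f : Fin n → ℕ) (a : ℕ → ℕ) (i : ℕ) {j : ℕ} (hj : j ≤ n) :
    (load (extend f) a i j : ℝ) =
      ∑ x ∈ Finset.univ.filter (fun x : Fin n => (x : ℕ) < j ∧ a x = i), (f x : ℝ) := by
  have h : load (extend f) a i j =
      ∑ t ∈ Finset.range n, if t < j ∧ a t = i then extend f t else 0 := by
    rw [load, ← Finset.sum_filter, ← Finset.sum_filter]
    congr 1
    ext t
    simp only [Finset.mem_filter, Finset.mem_range]
    omega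
  rw [h, Finset.sum_range, Finset.sum_filter]
  push_cast
  refine Finset.sum_congr rfl fun x _ => ?_
  split_ifs <;> simp

/-- Jobs on one machine that are all completed by time `X` have total length at most `X`. -/
theorem Schedule.sum_le_of_completion_le {m : ℕ} {J : Jobs} (τ : Schedule m J)
    (S : Finset (Fin J.n)) (i : Fin m) (hS : ∀ x ∈ S, τ.machine x = i) {X : ℝ} (hX : 0 ≤ X)
    (hC : ∀ x ∈ S, τ.completion x ≤ X) : ∑ x ∈ S, (J.p x : ℝ) ≤ X := by
  -- The inserted job completes last, so all others are completed when it starts; the induction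
  -- hypothesis is used with its start time as bound.
  induction S using Finset.induction_on_max_value τ.completion generalizing X with
  | empty => simpa using hX
  | insert a s ha hmax ih =>
    rw [Finset.sum_insert ha]
    have h1 := ih (fun x hx => hS x (Finset.mem_insert_of_mem hx)) (τ.start_nonneg a)
      (fun x hx => by
        have hne : x ≠ a := fun h => ha (h ▸ hx)
        rcases τ.disjoint x a hne ((hS x (Finset.mem_insert_of_mem hx)).trans
          (hS a (Finset.mem_insert_self a s)).symm) with h | h
        · exact h
        · have h2 := hmax x hx
          have h3 : (0 : ℝ) < J.p x := by exact_mod_cast J.p_pos x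
          simp only [completion] at h2
          linarith)
    have h2 := hC a (Finset.mem_insert_self a s)
    simp only [completion] at h2
    linarith

/-- The assignment of the jobs in the set `E` to machines in a schedule; the other jobs are
assigned to `m`. -/
def Schedule.assignment {m : ℕ} {J : Jobs} (τ : Schedule m J) (E : Fin J.n → Prop)
    [DecidablePred E] (t : ℕ) : ℕ :=
  if h : t < J.n then if E ⟨t, h⟩ then τ.machine ⟨t, h⟩ else m else m

section assignment

variable {m : ℕ} {J : Jobs} (τ : Schedule m J) (E : Fin J.n → Prop) [DecidablePred E]

theorem Schedule.assignment_fin (x : Fin J.n) :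
    τ.assignment E x = if E x then (τ.machine x : ℕ) else m := by
  simp [assignment]

/-- Turns a common deadline of the selected jobs of a prefix into a bound on the load of every
machine, which is the form that `Dominates.le_of_le` transports. -/
theorem Schedule.load_assignment_le {i j : ℕ} (hi : i < m) (hj : j ≤ J.n) {X : ℝ} (hX : 0 ≤ X)
    (hC : ∀ x : Fin J.n, (x : ℕ) < j → E x → τ.completion x ≤ X) :
    (load (extend J.p) (τ.assignment E) i j : ℝ) ≤ X := by
  rw [load_eq_sum_filter J.p _ _ hj]
  have key : ∀ x ∈ Finset.univ.filter
      (fun x : Fin J.n => (x : ℕ) < j ∧ τ.assignment E x = i), E x ∧ τ.machine x = ⟨i, hi⟩ := by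
    intro x hx
    have h := (Finset.mem_filter.mp hx).2.2
    rw [τ.assignment_fin] at h
    by_cases hE : E x
    · rw [if_pos hE] at h
      exact ⟨hE, Fin.ext h⟩
    · rw [if_neg hE] at h
      omega
  exact τ.sum_le_of_completion_le _ ⟨i, hi⟩ (fun x hx => (key x hx).2) hX
    fun x hx => hC x (Finset.mem_filter.mp hx).2.1 (key x hx).1

end assignment

theorem Jobs.EfficiencyOrdered.mul_le {J : Jobs} (h : J.EfficiencyOrdered) {i j : Fin J.n}
    (hij : i ≤ j) : (J.w j : ℝ) * J.p i ≤ J.w i * J.p j := by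
  have h1 := h i j hij
  have hi : (0 : ℚ) < J.p i := by exact_mod_cast J.p_pos i
  have hj : (0 : ℚ) < J.p j := by exact_mod_cast J.p_pos j
  rw [div_le_div_iff₀ hj hi] at h1
  exact_mod_cast h1

/-- Smith's rule: processing the jobs of each machine in the given order is optimal. -/
theorem Schedule.list_sumWC_le {m : ℕ} {J : Jobs} (hJ : J.EfficiencyOrdered) (τ : Schedule m J) :
    ∑ x : Fin J.n, (J.w x : ℝ) * ((load (extend J.p) (τ.assignment fun _ => True)
      (τ.assignment (fun _ => True) x) x : ℝ) + J.p x) ≤ sumWC J τ := by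
  classical
  -- The share of `x` in the weighted completion time of `y`: `f` for the order of completion in
  -- `τ`, `g` for the given order. The sums are compared pair by pair, and by efficiency the given
  -- order has the cheaper cross term.
  let f : Fin J.n → Fin J.n → ℝ := fun x y =>
    if τ.machine x = τ.machine y ∧ τ.completion x ≤ τ.completion y then (J.w y : ℝ) * J.p x else 0
  let g : Fin J.n → Fin J.n → ℝ := fun x y =>
    if τ.machine x = τ.machine y ∧ x ≤ y then (J.w y : ℝ) * J.p x else 0
  have hfg : ∀ x y, g x y + g y x ≤ f x y + f y x := by
    intro x y
    have h1 : (0 : ℝ) ≤ (J.w y : ℝ) * J.p x := by positivity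
    have h2 : (0 : ℝ) ≤ (J.w x : ℝ) * J.p y := by positivity
    by_cases hm : τ.machine x = τ.machine y
    · rcases lt_trichotomy x y with h | rfl | h
      · have h3 := hJ.mul_le h.le
        have h4 := not_le.mpr h
        simp only [f, g, hm, h.le, h4, true_and, if_true, if_false]
        rcases le_total (τ.completion x) (τ.completion y) with h5 | h5
        · simp only [h5, if_true]
          split_ifs <;> linarith
        · simp only [h5, if_true]
          split_ifs <;> linarith
      · simp [f, g]
      · have h3 := hJ.mul_le h.le
        have h4 := not_le.mpr h
        simp only [f, g, hm, h.le, h4, true_and, if_true, if_false]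
        rcases le_total (τ.completion x) (τ.completion y) with h5 | h5
        · simp only [h5, if_true]
          split_ifs <;> linarith
        · simp only [h5, if_true]
          split_ifs <;> linarith
    · have hm' : τ.machine y ≠ τ.machine x := fun h => hm h.symm
      simp [f, g, hm, hm']
  have hsum : ∑ y, ∑ x, g x y ≤ ∑ y, ∑ x, f x y := by
    have h1 : ∑ y, ∑ x, (g x y + g y x) ≤ ∑ y, ∑ x, (f x y + f y x) :=
      Finset.sum_le_sum fun y _ => Finset.sum_le_sum fun x _ => hfg x y
    simp only [Finset.sum_add_distrib] at h1
    rw [Finset.sum_comm (f := fun y x => g y x), Finset.sum_comm (f := fun y x => f y x)] at h1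
    linarith
  have hlow : ∑ y, ∑ x, f x y ≤ sumWC J τ := by
    refine Finset.sum_le_sum fun y _ => ?_
    have h1 := τ.sum_le_of_completion_le (Finset.univ.filter fun x =>
      τ.machine x = τ.machine y ∧ τ.completion x ≤ τ.completion y) (τ.machine y)
      (fun x hx => (Finset.mem_filter.mp hx).2.1) (X := τ.completion y)
      (add_nonneg (τ.start_nonneg y) (Nat.cast_nonneg _))
      (fun x hx => (Finset.mem_filter.mp hx).2.2)
    simp only [f]
    rw [← Finset.sum_filter, ← Finset.mul_sum]
    exact mul_le_mul_of_nonneg_left h1 (Nat.cast_nonneg _)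
  refine le_trans (le_of_eq ?_) (hsum.trans hlow)
  refine Finset.sum_congr rfl fun y _ => ?_
  have h1 : load (extend J.p) (τ.assignment fun _ => True) (τ.assignment (fun _ => True) y) y +
      J.p y = load (extend J.p) (τ.assignment fun _ => True)
        (τ.assignment (fun _ => True) y) (y + 1) := by
    rw [load_succ]
    simp
  have h2 := load_eq_sum_filter J.p (τ.assignment fun _ => True)
    (τ.assignment (fun _ => True) y) (j := y + 1) y.2
  rw [← h1] at h2
  push_cast at h2
  rw [h2]
  simp only [g]
  rw [← Finset.sum_filter, ← Finset.mul_sum]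
  congr 2
  ext x
  simp only [Finset.mem_filter, Finset.mem_univ, true_and, τ.assignment_fin, if_true,
    Fin.val_inj, Fin.le_def]
  exact ⟨fun h => ⟨h.2, Nat.le_of_lt_succ h.1⟩, fun h => ⟨Nat.lt_succ_of_le h.2, h.1⟩⟩

/-- The increment equals `2 * p j` times the completion time of `j`, minus `p j ^ 2`. This links
squared loads with completion times. -/
theorem sum_sq_load_succ (p : ℕ → ℤ) {m : ℕ} (a : ℕ → ℕ) {j : ℕ} (h : a j < m) :
    ∑ i ∈ Finset.range m, load p a i (j + 1) ^ 2 =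
      ∑ i ∈ Finset.range m, load p a i j ^ 2 + p j * (2 * load p a (a j) j + p j) := by
  have := Finset.sum_eq_single_of_mem (s := Finset.range m)
    (f := fun i => load p a i (j + 1) ^ 2 - load p a i j ^ 2) (a j) (Finset.mem_range.mpr h)
    (fun i _ hi => by simp [load_succ, hi.symm])
  rw [Finset.sum_sub_distrib] at this
  simp only [load_succ p a (a j) j, if_true] at this
  linarith

/-- For jobs in the order of Smith's rule, a dominating assignment has no larger total weighted
completion time. -/
theorem Dominates.sumWC_le {p w : ℕ → ℤ} {m n : ℕ} {a a' : ℕ → ℕ} (h : Dominates p m n a a')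
    (ha : ∀ t < n, a t < m) (hp : ∀ t < n, 0 < p t) (hw : ∀ t < n, 0 ≤ w t)
    (hord : ∀ s t, s ≤ t → t < n → w t * p s ≤ w s * p t) :
    ∑ t ∈ Finset.range n, w t * (load p a' (a' t) t + p t) ≤
      ∑ t ∈ Finset.range n, w t * (load p a (a t) t + p t) := by
  let Φ : (ℕ → ℕ) → ℕ → ℝ := fun b j => ((∑ i ∈ Finset.range m, load p b i j ^ 2 : ℤ) : ℝ)
  have hΨ : ∀ j ≤ n, 0 ≤ Φ a j - Φ a' j := fun j hj => by
    have := h.sq_le j hj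
    simp only [Φ, sub_nonneg]
    exact_mod_cast this
  have hΦ : ∀ b : ℕ → ℕ, ∀ j, b j < m →
      Φ b (j + 1) = Φ b j + p j * (2 * load p b (b j) j + p j) := fun b j hj => by
    simp only [Φ]
    rw [sum_sq_load_succ p b hj]
    push_cast
    ring
  -- Summation by parts, done as an induction: `q` is a lower bound for the ratios `w t / p t` so
  -- far. Since `Φ a - Φ a'` is non-negative, `q` may be raised to the last ratio, and this is still
  -- a lower bound for the earlier ones. The case `q = 0` is the claim.
  have key : ∀ j ≤ n, ∀ q : ℝ, 0 ≤ q → (∀ t < j, q * p t ≤ w t) →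
      q * (Φ a j - Φ a' j) ≤ 2 * (∑ t ∈ Finset.range j, (w t : ℝ) * (load p a (a t) t + p t) -
        ∑ t ∈ Finset.range j, (w t : ℝ) * (load p a' (a' t) t + p t)) := by
    intro j
    induction j with
    | zero => simp [Φ]
    | succ j ih =>
      intro hj q hq hqt
      have hpj : (0 : ℝ) < p j := by exact_mod_cast hp j hj
      have hwj : (0 : ℝ) ≤ w j := by exact_mod_cast hw j hj
      have hqj : q ≤ (w j : ℝ) / p j := by
        rw [le_div_iff₀ hpj]
        exact hqt j (Nat.lt_succ_self j)
      have e : (w j : ℝ) / p j * p j = w j := div_mul_cancel₀ _ hpj.ne'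
      have h1 := ih (by omega) ((w j : ℝ) / p j) (div_nonneg hwj hpj.le) (fun t ht => by
        have h2 : (w j : ℝ) * p t ≤ w t * p j := by exact_mod_cast hord t j ht.le hj
        rwa [div_mul_eq_mul_div, div_le_iff₀ hpj])
      have h2 := mul_le_mul_of_nonneg_right hqj (hΨ (j + 1) hj)
      have h3 : (w j : ℝ) / p j * (Φ a (j + 1) - Φ a' (j + 1)) =
          (w j : ℝ) / p j * (Φ a j - Φ a' j) +
            2 * (w j * (load p a (a j) j + p j) - w j * (load p a' (a' j) j + p j)) := by
        rw [hΦ a j (ha j hj), hΦ a' j (h.lt_of_lt j (ha j hj))]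
        linear_combination (2 * (load p a (a j) j - load p a' (a' j) j) : ℝ) * e
      rw [Finset.sum_range_succ, Finset.sum_range_succ]
      linarith
  have := key n le_rfl 0 le_rfl (fun t ht => by simpa using hw t ht)
  have h2 : ∑ t ∈ Finset.range n, (w t : ℝ) * (load p a' (a' t) t + p t) ≤
      ∑ t ∈ Finset.range n, (w t : ℝ) * (load p a (a t) t + p t) := by linarith
  exact_mod_cast h2

end Scheduling

namespace Scheduling

/-! ### Mixed radix numbers -/

theorem radix_lt {W : ℤ} {x : ℕ → ℤ} (k : ℕ) (hx : ∀ t < k, 0 ≤ x t ∧ x t < W) (hW : 0 ≤ W) :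
    0 ≤ ∑ t ∈ Finset.range k, x t * W ^ t ∧ ∑ t ∈ Finset.range k, x t * W ^ t < W ^ k := by
  induction k with
  | zero => simp
  | succ k ih =>
    obtain ⟨h1, h2⟩ := ih fun t ht => hx t (by omega)
    obtain ⟨h3, h4⟩ := hx k (Nat.lt_succ_self k)
    have hWk : 0 ≤ W ^ k := pow_nonneg hW k
    rw [Finset.sum_range_succ, pow_succ]
    constructor
    · positivity
    · nlinarith

theorem radix_ediv {W : ℤ} {x : ℕ → ℤ} (k : ℕ) (hx : ∀ t < k, 0 ≤ x t ∧ x t < W) (hW : 0 < W)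
    (y : ℤ) : (∑ t ∈ Finset.range k, x t * W ^ t + y * W ^ k) / W ^ k = y := by
  obtain ⟨h1, h2⟩ := radix_lt k hx hW.le
  rw [Int.add_mul_ediv_right _ _ (pow_pos hW k).ne', Int.ediv_eq_zero_of_lt h1 h2, zero_add]

theorem radix_digit {W : ℤ} {x : ℕ → ℤ} {k : ℕ} (hx : ∀ t < k, 0 ≤ x t ∧ x t < W) (hW : 0 < W)
    (y : ℤ) {t : ℕ} (ht : t < k) :
    (∑ t ∈ Finset.range k, x t * W ^ t + y * W ^ k) / W ^ t % W = x t := by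
  -- All digits above position `t` together contribute a multiple of `W ^ (t + 1)`.
  have split : ∃ z, ∑ t ∈ Finset.range k, x t * W ^ t + y * W ^ k =
      ∑ i ∈ Finset.range t, x i * W ^ i + (x t + W * z) * W ^ t := by
    clear hx
    induction k, ht using Nat.le_induction generalizing y with
    | base =>
      refine ⟨y, ?_⟩
      rw [Nat.succ_eq_add_one, Finset.sum_range_succ]
      ring
    | succ k hk ih =>
      obtain ⟨z, hz⟩ := ih (x k + W * y)
      refine ⟨z, ?_⟩
      rw [← hz, Finset.sum_range_succ]
      ring
  obtain ⟨z, hz⟩ := split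
  rw [hz, radix_ediv t (fun i hi => hx i (by omega)) hW, Int.add_mul_emod_self_left]
  exact Int.emod_eq_of_lt (hx t ht).1 (hx t ht).2

/-! ### The dynamic program -/

inductive Objective where
  | sumWC
  | lMax
  | sumWU

/-- The data of a scheduling problem on `k + 1` machines, extended by zero. -/
structure Problem where
  obj : Objective
  k : ℕ
  n : ℕ
  p : ℕ → ℤ
  w : ℕ → ℤ
  d : ℕ → ℤ
  pmax : ℤ
  n_pos : 0 < n
  p_pos : ∀ t < n, 0 < p t
  p_nonneg : ∀ t, 0 ≤ p t
  p_le : ∀ t, p t ≤ pmax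
  w_nonneg : ∀ t, 0 ≤ w t
  d_nonneg : ∀ t, 0 ≤ d t

namespace Problem

variable (I : Problem)

/-- The second row of the input. -/
def row : ℕ → ℤ :=
  match I.obj with
  | .sumWC => I.w
  | .lMax => I.d
  | .sumWU => I.w

/-- The total length of the first `j` jobs. -/
def before (j : ℕ) : ℤ := ∑ t ∈ Finset.range j, I.p t

def total : ℤ := I.before I.n

def rowSum (j : ℕ) : ℤ := ∑ t ∈ Finset.range j, I.row t

/-- A value that exceeds the objective values of all schedules. -/
def infty : ℤ := (I.total + 1) * (I.rowSum I.n + 1)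

/-- The maximum difference between the loads of two machines. -/
def width : ℤ := 4 * I.pmax ^ 2

/-- The number of integers in `[-width, width]`, the range of a load difference. -/
def base : ℤ := 8 * I.pmax ^ 2 + 1

/-- The number of states per stage. -/
def states : ℤ :=
  match I.obj with
  | .sumWU => I.base ^ I.k * (I.total + 1)
  | _ => I.base ^ I.k

/-- The shift that makes the lateness of a job non-negative. -/
def shift : ℤ :=
  match I.obj with
  | .lMax => I.d (I.n - 1)
  | _ => 0

/-- The number of choices per stage: the machines, and for `sumWU` the option to be late. -/
def choices : ℕ :=
  match I.obj with
  | .sumWU => I.k + 2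
  | _ => I.k + 1

/-- The loads after job `j` is put on machine `c`. -/
def next (j : ℕ) (L : ℕ → ℤ) (c : ℕ) : ℕ → ℤ := fun i => L i + if c = i then I.p j else 0

/-- The cost of a schedule with loads `L` before job `j`, which is treated according to `c`,
if `f` is the cost of the rest. -/
def cand (j : ℕ) (L : ℕ → ℤ) (c : ℕ) (f : ℤ) : ℤ :=
  match I.obj with
  | .sumWC => I.w j * (L c + I.p j) + f
  | .lMax => max (L c + I.p j - I.d j + I.shift) f
  | .sumWU => if c ≤ I.k then if L c + I.p j ≤ I.d j then f else I.infty else f + I.w j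

/-- Only differences to machine `0` are restricted, because these are the digits of a state number.
This is weaker than the pairwise balance of `exists_balanced`. -/
def Balanced (L : ℕ → ℤ) : Prop := ∀ t < I.k, |L (t + 1) - L 0| ≤ I.width

open Classical in
/-- The minimum of the costs over the first `c` choices. -/
noncomputable def best (j : ℕ) (L : ℕ → ℤ) (f : (ℕ → ℤ) → ℤ) : ℕ → ℤ
  | 0 => I.infty
  | c + 1 => if I.Balanced (I.next j L c) ∧ I.cand j L c (f (I.next j L c)) < best j L f c then
      I.cand j L c (f (I.next j L c)) else best j L f c

/-- The minimum cost of the `r` jobs from `j` on, if the loads before them are `L`. -/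
noncomputable def opt : ℕ → ℕ → (ℕ → ℤ) → ℤ
  | 0, _, _ => 0
  | r + 1, j, L => I.best j L (opt r (j + 1)) I.choices

/-- The loads that can occur after `j` jobs. -/
structure Feasible (j : ℕ) (L : ℕ → ℤ) : Prop where
  balanced : I.Balanced L
  nonneg : ∀ i, 0 ≤ L i
  sum_le : ∑ i ∈ Finset.range (I.k + 1), L i ≤ I.before j
  sum_eq : I.obj ≠ .sumWU → ∑ i ∈ Finset.range (I.k + 1), L i = I.before j

/-- The number of a state. -/
def code (L : ℕ → ℤ) : ℤ :=
  ∑ t ∈ Finset.range I.k, (L (t + 1) - L 0 + I.width) * I.base ^ t +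
    (match I.obj with
      | .sumWU => L 0
      | _ => 0) * I.base ^ I.k

theorem pmax_pos : 0 < I.pmax := (I.p_pos 0 I.n_pos).trans_le (I.p_le 0)

theorem base_eq : I.base = 2 * I.width + 1 := by
  simp only [base, width]
  ring

theorem width_pos : 0 < I.width := by
  have := I.pmax_pos
  simp only [width]
  positivity

theorem base_pos : 0 < I.base := by
  have := I.width_pos
  have := I.base_eq
  omega

theorem before_mono : Monotone I.before := by
  refine monotone_nat_of_le_succ fun j => ?_
  simp only [before, Finset.sum_range_succ]
  have := I.p_nonneg j
  omega

theorem before_succ (j : ℕ) : I.before (j + 1) = I.before j + I.p j := by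
  simp [before, Finset.sum_range_succ]

theorem before_nonneg (j : ℕ) : 0 ≤ I.before j := Finset.sum_nonneg fun t _ => I.p_nonneg t

theorem row_nonneg (t : ℕ) : 0 ≤ I.row t := by
  unfold row
  cases I.obj
  · exact I.w_nonneg t
  · exact I.d_nonneg t
  · exact I.w_nonneg t

theorem rowSum_succ (j : ℕ) : I.rowSum (j + 1) = I.rowSum j + I.row j := by
  simp [rowSum, Finset.sum_range_succ]

theorem rowSum_mono : Monotone I.rowSum := by
  refine monotone_nat_of_le_succ fun j => ?_
  rw [rowSum_succ]
  have := I.row_nonneg j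
  omega

theorem rowSum_nonneg (j : ℕ) : 0 ≤ I.rowSum j := Finset.sum_nonneg fun t _ => I.row_nonneg t

theorem row_le (t : ℕ) (ht : t < I.n) : I.row t ≤ I.rowSum I.n :=
  Finset.single_le_sum (f := I.row) (fun t _ => I.row_nonneg t) (Finset.mem_range.mpr ht)

theorem infty_pos : 0 < I.infty := by
  have := I.before_nonneg I.n
  have := I.rowSum_nonneg I.n
  simp only [infty, total]
  positivity

theorem best_le_infty (j : ℕ) (L : ℕ → ℤ) (f : (ℕ → ℤ) → ℤ) (c : ℕ) :
    I.best j L f c ≤ I.infty := by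
  induction c with
  | zero => exact le_rfl
  | succ c ih =>
    rw [best]
    split_ifs with h
    · exact h.2.le.trans ih
    · exact ih

theorem best_le_cand {j : ℕ} {L : ℕ → ℤ} {f : (ℕ → ℤ) → ℤ} {c : ℕ} {C : ℕ} (hc : c < C)
    (hb : I.Balanced (I.next j L c)) : I.best j L f C ≤ I.cand j L c (f (I.next j L c)) := by
  induction C, hc using Nat.le_induction with
  | base =>
    rw [Nat.succ_eq_add_one, best]
    split_ifs with h
    · exact le_rfl
    · exact not_lt.mp fun h' => h ⟨hb, h'⟩
  | succ C hC ih =>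
    rw [best]
    split_ifs with h
    · exact h.2.le.trans ih
    · exact ih

theorem cand_mono (j : ℕ) (L : ℕ → ℤ) (c : ℕ) {f g : ℤ} (h : f ≤ g) :
    I.cand j L c f ≤ I.cand j L c g := by
  unfold cand
  split
  · omega
  · exact max_le_max le_rfl h
  · split_ifs <;> omega

/-- Prepending a job never lowers the cost. Hence the remaining cost stays below `infty` when
optimal choices are followed forward. The bound on `f` matters for a tardy job on a machine, whose
candidate is `infty` itself. -/
theorem le_cand (j : ℕ) {L : ℕ → ℤ} (hL : ∀ i, 0 ≤ L i) (c : ℕ) {f : ℤ}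
    (hf : f ≤ I.infty) : f ≤ I.cand j L c f := by
  have h1 := I.p_nonneg j
  have h2 := I.w_nonneg j
  have h3 := hL c
  unfold cand
  split
  · have := mul_nonneg h2 (add_nonneg h3 h1)
    omega
  · exact le_max_right _ _
  · split_ifs <;> omega

theorem best_nonneg (j : ℕ) {L : ℕ → ℤ} (hL : ∀ i, 0 ≤ L i) {f : (ℕ → ℤ) → ℤ}
    (hf : ∀ c, 0 ≤ f (I.next j L c) ∧ f (I.next j L c) ≤ I.infty) (c : ℕ) :
    0 ≤ I.best j L f c := by
  induction c with
  | zero => exact I.infty_pos.le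
  | succ c ih =>
    rw [best]
    split_ifs with h
    · exact (hf c).1.trans (I.le_cand j hL c (hf c).2)
    · exact ih

theorem next_nonneg (j : ℕ) {L : ℕ → ℤ} (hL : ∀ i, 0 ≤ L i) (c : ℕ) : ∀ i, 0 ≤ I.next j L c i := by
  intro i
  have := hL i
  have := I.p_nonneg j
  simp only [next]
  split_ifs <;> omega

theorem opt_nonneg (r j : ℕ) (hj : r + j = I.n) {L : ℕ → ℤ} (hL : ∀ i, 0 ≤ L i) :
    0 ≤ I.opt r j L ∧ I.opt r j L ≤ I.infty := by
  induction r generalizing j L with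
  | zero => exact ⟨le_rfl, I.infty_pos.le⟩
  | succ r ih =>
    exact ⟨I.best_nonneg j hL (fun c => ih (j + 1) (by omega) (I.next_nonneg j hL c)) _,
      I.best_le_infty j L _ _⟩

/-! #### Codes of states -/

theorem code_digit_bounds {L : ℕ → ℤ} (hL : I.Balanced L) :
    ∀ t < I.k, 0 ≤ L (t + 1) - L 0 + I.width ∧ L (t + 1) - L 0 + I.width < I.base := by
  intro t ht
  have h := abs_le.mp (hL t ht)
  have := I.base_eq
  omega

theorem code_digit {L : ℕ → ℤ} (hL : I.Balanced L) {t : ℕ} (ht : t < I.k) :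
    I.code L / I.base ^ t % I.base = L (t + 1) - L 0 + I.width :=
  radix_digit (x := fun t => L (t + 1) - L 0 + I.width) (I.code_digit_bounds hL) I.base_pos _ ht

theorem code_div {L : ℕ → ℤ} (hL : I.Balanced L) (h : I.obj = .sumWU) :
    I.code L / I.base ^ I.k = L 0 := by
  rw [code, h]
  exact radix_ediv _ (I.code_digit_bounds hL) I.base_pos _

/-- Without late jobs the loads sum to the length of the prefix; subtracting the `k` differences to
machine `0` leaves `k + 1` times its load. -/
theorem Feasible.load_zero_eq {I : Problem} {j : ℕ} {L : ℕ → ℤ} (hL : I.Feasible j L)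
    (h : I.obj ≠ .sumWU) :
    (I.before j - ∑ t ∈ Finset.range I.k, (I.code L / I.base ^ t % I.base - I.width)) / (I.k + 1) =
      L 0 := by
  have h1 : ∑ t ∈ Finset.range I.k, (I.code L / I.base ^ t % I.base - I.width) =
      ∑ t ∈ Finset.range I.k, (L (t + 1) - L 0) :=
    Finset.sum_congr rfl fun t ht => by
      rw [I.code_digit hL.balanced (Finset.mem_range.mp ht)]
      ring
  have h2 := hL.sum_eq h
  rw [Finset.sum_range_succ'] at h2
  rw [h1, Finset.sum_sub_distrib, Finset.sum_const, Finset.card_range, nsmul_eq_mul]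
  have h3 : I.before j - (∑ t ∈ Finset.range I.k, L (t + 1) - I.k * L 0) = L 0 * (I.k + 1) := by
    linear_combination -h2
  rw [h3]
  exact Int.mul_ediv_cancel _ (by positivity)

theorem Feasible.load_zero_le {I : Problem} {j : ℕ} {L : ℕ → ℤ} (hL : I.Feasible j L) {i : ℕ}
    (hi : i ≤ I.k) : L i ≤ I.before j :=
  (Finset.single_le_sum (f := L) (fun i _ => hL.nonneg i)
    (Finset.mem_range.mpr (by omega : i < I.k + 1))).trans hL.sum_le

theorem Feasible.code_bounds {I : Problem} {j : ℕ} (hj : j ≤ I.n) {L : ℕ → ℤ}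
    (hL : I.Feasible j L) : 0 ≤ I.code L ∧ I.code L < I.states := by
  obtain ⟨h1, h2⟩ := radix_lt I.k (I.code_digit_bounds hL.balanced) I.base_pos.le
  have h3 := hL.nonneg 0
  have h4 : L 0 ≤ I.total := (hL.load_zero_le (Nat.zero_le _)).trans (I.before_mono hj)
  have h5 : 0 < I.base ^ I.k := pow_pos I.base_pos _
  unfold code states
  cases h : I.obj with
  | sumWU =>
    simp only
    constructor
    · positivity
    · nlinarith
  | sumWC => simpa using ⟨h1, h2⟩
  | lMax => simpa using ⟨h1, h2⟩

/-- A job on machine `0` lowers every difference by `p j`, and for `sumWU` raises the leading digit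
by as much. So the number changes by a multiple of `p j` with a factor independent of the state. -/
theorem code_next_zero (j : ℕ) (L : ℕ → ℤ) :
    I.code (I.next j L 0) = I.code L + ((match I.obj with
      | .sumWU => I.base ^ I.k
      | _ => 0) - ∑ t ∈ Finset.range I.k, I.base ^ t) * I.p j := by
  have h : ∑ t ∈ Finset.range I.k,
      (I.next j L 0 (t + 1) - I.next j L 0 0 + I.width) * I.base ^ t =
      ∑ t ∈ Finset.range I.k, (L (t + 1) - L 0 + I.width) * I.base ^ t -
        (∑ t ∈ Finset.range I.k, I.base ^ t) * I.p j := by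
    rw [Finset.sum_mul, ← Finset.sum_sub_distrib]
    refine Finset.sum_congr rfl fun t _ => ?_
    simp only [next, if_true]
    rw [if_neg (by omega)]
    ring
  rw [code, h, code]
  cases I.obj <;> simp [next] <;> ring

theorem code_next_succ (j : ℕ) (L : ℕ → ℤ) {i : ℕ} (hi : i < I.k) :
    I.code (I.next j L (i + 1)) = I.code L + I.base ^ i * I.p j := by
  have h : ∑ t ∈ Finset.range I.k,
      (I.next j L (i + 1) (t + 1) - I.next j L (i + 1) 0 + I.width) * I.base ^ t =
      ∑ t ∈ Finset.range I.k, (L (t + 1) - L 0 + I.width) * I.base ^ t + I.base ^ i * I.p j := by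
    rw [← sub_eq_iff_eq_add', ← Finset.sum_sub_distrib,
      Finset.sum_eq_single_of_mem i (Finset.mem_range.mpr hi)]
    · simp only [next, if_true]
      rw [if_neg (by omega)]
      ring
    · intro t _ ht
      simp only [next]
      rw [if_neg (by omega), if_neg (by omega)]
      ring
  have h0 : I.next j L (i + 1) 0 = L 0 := by simp [next]
  rw [code, h, code, h0]
  ring

theorem code_next_late (j : ℕ) (L : ℕ → ℤ) {c : ℕ} (hc : I.k < c) :
    I.code (I.next j L c) = I.code L := by
  have h : ∀ i ≤ I.k, I.next j L c i = L i := fun i hi => by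
    simp only [next]
    rw [if_neg (by omega), add_zero]
  rw [code, code, h 0 (Nat.zero_le _)]
  congr 1
  refine Finset.sum_congr rfl fun t ht => ?_
  rw [h (t + 1) (by have := Finset.mem_range.mp ht; omega)]

/-- All differences decrease, so only their lower bound can be violated; in terms of digits, none
may become negative. -/
theorem balanced_next_zero {j : ℕ} {L : ℕ → ℤ} (hL : I.Balanced L) :
    I.Balanced (I.next j L 0) ↔ ∀ t < I.k, I.p j ≤ L (t + 1) - L 0 + I.width := by
  refine forall₂_congr fun t ht => ?_
  have h := abs_le.mp (hL t ht)
  have hp := I.p_nonneg j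
  simp only [next, if_true]
  rw [if_neg (by omega), abs_le]
  omega

theorem balanced_next_succ {j : ℕ} {L : ℕ → ℤ} (hL : I.Balanced L) {i : ℕ} (hi : i < I.k) :
    I.Balanced (I.next j L (i + 1)) ↔ L (i + 1) - L 0 + I.width + I.p j ≤ I.base - 1 := by
  have hp := I.p_nonneg j
  have hb := I.base_eq
  constructor
  · intro h
    have h := abs_le.mp (h i hi)
    simp only [next, if_true] at h
    rw [if_neg (by omega)] at h
    omega
  · intro h t ht
    have h' := abs_le.mp (hL t ht)
    simp only [next]
    rw [if_neg (by omega : ¬ i + 1 = 0), abs_le]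
    split_ifs with h1
    · obtain rfl : i = t := by omega
      omega
    · omega

theorem balanced_next_late {j : ℕ} {L : ℕ → ℤ} (hL : I.Balanced L) {c : ℕ} (hc : I.k < c) :
    I.Balanced (I.next j L c) := by
  intro t ht
  simp only [next]
  rw [if_neg (by omega), if_neg (by omega)]
  simpa using hL t ht

theorem Feasible.next {I : Problem} {j : ℕ} {L : ℕ → ℤ} (hL : I.Feasible j L) {c : ℕ}
    (hc : c < I.choices) (hb : I.Balanced (I.next j L c)) : I.Feasible (j + 1) (I.next j L c) := by
  have hs : ∑ i ∈ Finset.range (I.k + 1), I.next j L c i =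
      ∑ i ∈ Finset.range (I.k + 1), L i + if c ≤ I.k then I.p j else 0 := by
    simp only [Problem.next]
    rw [Finset.sum_add_distrib, Finset.sum_ite_eq]
    simp only [Finset.mem_range, Nat.lt_succ_iff]
  refine ⟨hb, I.next_nonneg j hL.nonneg c, ?_, fun h => ?_⟩
  · have h1 := hL.sum_le
    have h2 := I.p_nonneg j
    rw [hs, before_succ]
    split_ifs <;> omega
  · rw [hs, hL.sum_eq h, before_succ, if_pos]
    unfold choices at hc
    cases h' : I.obj with
    | sumWU => exact (h h').elim
    | sumWC =>
      rw [h'] at hc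
      simp only at hc
      omega
    | lMax =>
      rw [h'] at hc
      simp only at hc
      omega

theorem feasible_zero : I.Feasible 0 0 := by
  refine ⟨fun t _ => ?_, fun _ => le_rfl, ?_, fun _ => ?_⟩
  · simpa using I.width_pos.le
  · simp [before]
  · simp [before]

/-! #### Values of assignments -/

/-- The cost of the `r` jobs from `j` on in the assignment `a`. -/
def cost (a : ℕ → ℕ) : ℕ → ℕ → ℤ
  | 0, _ => 0
  | r + 1, j => I.cand j (fun i => load I.p a i j) (a j) (cost a r (j + 1))

theorem next_load (a : ℕ → ℕ) (j : ℕ) :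
    I.next j (fun i => load I.p a i j) (a j) = fun i => load I.p a i (j + 1) := by
  funext i
  simp [next, load_succ]

theorem opt_le_cost {a : ℕ → ℕ} (ha : ∀ t < I.n, a t < I.choices)
    (hb : ∀ j ≤ I.n, I.Balanced fun i => load I.p a i j) (r j : ℕ) (hj : r + j = I.n) :
    I.opt r j (fun i => load I.p a i j) ≤ I.cost a r j := by
  induction r generalizing j with
  | zero => exact le_rfl
  | succ r ih =>
    have h := I.best_le_cand (f := I.opt r (j + 1)) (ha j (by omega))
      (by rw [I.next_load a j]; exact hb (j + 1) (by omega))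
    rw [I.next_load a j] at h
    exact h.trans (I.cand_mono _ _ _ (ih (j + 1) (by omega)))

/-- `a` follows optimal choices up to stage `j`. -/
structure Optimal (a : ℕ → ℕ) (j : ℕ) : Prop where
  lt_choices : ∀ t < j, a t < I.choices
  feasible : I.Feasible j fun i => load I.p a i j
  opt_eq : ∀ t < j, I.opt (I.n - t) t (fun i => load I.p a i t) =
    I.cand t (fun i => load I.p a i t) (a t)
      (I.opt (I.n - (t + 1)) (t + 1) fun i => load I.p a i (t + 1))

theorem Optimal.cost_eq {I : Problem} {a : ℕ → ℕ} (h : I.Optimal a I.n) (r j : ℕ)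
    (hj : r + j = I.n) : I.cost a r j = I.opt r j fun i => load I.p a i j := by
  induction r generalizing j with
  | zero => rfl
  | succ r ih =>
    have h1 := h.opt_eq j (by omega)
    rw [show I.n - j = r + 1 by omega, show I.n - (j + 1) = r by omega] at h1
    rw [h1, cost, ih (j + 1) (by omega)]

theorem cost_sumWC (h : I.obj = .sumWC) (a : ℕ → ℕ) :
    I.cost a I.n 0 = ∑ t ∈ Finset.range I.n, I.w t * (load I.p a (a t) t + I.p t) := by
  have key : ∀ r j, I.cost a r j = ∑ t ∈ Finset.range r,
      I.w (j + t) * (load I.p a (a (j + t)) (j + t) + I.p (j + t)) := by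
    intro r
    induction r with
    | zero => simp [cost]
    | succ r ih =>
      intro j
      rw [cost, cand, h, ih, Finset.sum_range_succ']
      simp only [add_zero, show ∀ t, j + 1 + t = j + (t + 1) by intro t; omega]
      ring
  simpa using key I.n 0

/-- The cost is the maximum of the shifted latenesses and of `0`, the cost of no jobs. -/
theorem cost_lMax_le (h : I.obj = .lMax) (a : ℕ → ℕ) (Y : ℤ) :
    I.cost a I.n 0 ≤ Y ↔
      0 ≤ Y ∧ ∀ t < I.n, load I.p a (a t) t + I.p t - I.d t + I.shift ≤ Y := by
  have key : ∀ r j, r + j = I.n → (I.cost a r j ≤ Y ↔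
      0 ≤ Y ∧ ∀ t < I.n, j ≤ t → load I.p a (a t) t + I.p t - I.d t + I.shift ≤ Y) := by
    intro r
    induction r with
    | zero =>
      intro j hj
      simp only [cost]
      exact ⟨fun h => ⟨h, fun t h1 h2 => by omega⟩, fun h => h.1⟩
    | succ r ih =>
      intro j hj
      rw [cost, cand, h]
      simp only
      rw [max_le_iff, ih (j + 1) (by omega)]
      constructor
      · rintro ⟨h1, h2, h3⟩
        refine ⟨h2, fun t ht hjt => ?_⟩
        rcases Nat.lt_or_ge j t with h4 | h4
        · exact h3 t ht h4
        · obtain rfl : j = t := by omega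
          exact h1
      · rintro ⟨h1, h2⟩
        exact ⟨h2 j (by omega) le_rfl, h1, fun t ht hjt => h2 t ht (by omega)⟩
  simpa using key I.n 0 (by omega)

theorem cost_sumWU (h : I.obj = .sumWU) {a : ℕ → ℕ}
    (ha : ∀ t < I.n, a t ≤ I.k → load I.p a (a t) t + I.p t ≤ I.d t) :
    I.cost a I.n 0 = ∑ t ∈ Finset.range I.n, if a t ≤ I.k then 0 else I.w t := by
  have key : ∀ r j, r + j = I.n → I.cost a r j = ∑ t ∈ Finset.range r,
      if a (j + t) ≤ I.k then 0 else I.w (j + t) := by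
    intro r
    induction r with
    | zero => simp [cost]
    | succ r ih =>
      intro j hj
      rw [cost, cand, h, ih (j + 1) (by omega), Finset.sum_range_succ']
      simp only [add_zero, show ∀ t, j + 1 + t = j + (t + 1) by intro t; omega]
      by_cases hc : a j ≤ I.k
      · simp [hc, ha j (by omega) hc]
      · simp [hc]
  simpa using key I.n 0 (by omega)

/-- A tardy job on a machine brings the cost to `infty`, and the jobs before it cannot lower it
again. -/
theorem early_of_cost_lt (h : I.obj = .sumWU) {a : ℕ → ℕ} (hlt : I.cost a I.n 0 < I.infty) :
    ∀ t < I.n, a t ≤ I.k → load I.p a (a t) t + I.p t ≤ I.d t := by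
  have key : ∀ r j, r + j = I.n → I.cost a r j < I.infty →
      ∀ t < I.n, j ≤ t → a t ≤ I.k → load I.p a (a t) t + I.p t ≤ I.d t := by
    intro r
    induction r with
    | zero =>
      intro j hj _ t h1 h2
      omega
    | succ r ih =>
      intro j hj hlt t ht hjt hat
      rw [cost, cand, h] at hlt
      simp only at hlt
      have hw := I.w_nonneg j
      rcases Nat.lt_or_ge j t with h4 | h4
      · refine ih (j + 1) (by omega) ?_ t ht h4 hat
        split_ifs at hlt <;> omega
      · obtain rfl : j = t := by omega
        rw [if_pos hat] at hlt
        by_contra hcon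
        rw [if_neg hcon] at hlt
        omega
  exact fun t ht => key I.n 0 (by omega) hlt t ht (Nat.zero_le t)

end Problem
end Scheduling

/-! ### The program for a single table entry -/

namespace Scheduling

open RAM RAM.Program

namespace Code

/-!
The use of the registers: `0` number of jobs, `1` maximum processing time, `2` base, `3` number of
states, `4` total processing time, `5` stage, `6` state, `7` processing time before the stage,
`8` load of machine `0`, `9` best value, `10` machine, `11` start time and `12` next state of the
best choice, `13` start time, `14` value and `15` next state of the current choice,
`16` processing time of the current job, `17` infinity, `18` shift, `19` optimal value,
`20` sum of the second row. Cell `-1 - (j * states + s)` holds the value of state `s` at stage `j`.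
-/

abbrev R (r : ℕ) : Expr := .reg r
abbrev K (z : ℤ) : Expr := .const z
abbrev cell (a : Expr) : Expr := .load a

def power : ℕ → Expr
  | 0 => K 1
  | t + 1 => power t * R 2

def digit (t : ℕ) : Expr := R 6 / power t % R 2

def geom : ℕ → Expr
  | 0 => K 0
  | t + 1 => geom t + power t

def offset : ℕ → Expr
  | 0 => K 0
  | t + 1 => offset t + (digit t - R 2 / K 2)

/-- This product is positive if and only if every digit is at least the processing time. -/
def room : ℕ → Expr
  | 0 => K 1
  | t + 1 => room t * (digit t / R 16)

def zeroLoad (obj : Objective) (k : ℕ) : Expr :=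
  match obj with
  | .sumWU => R 6 / power k
  | _ => (R 7 - offset k) / K (k + 1)

def machineLoad : ℕ → Expr
  | 0 => R 8
  | i + 1 => R 8 + (digit i - R 2 / K 2)

def increment (obj : Objective) (k : ℕ) : ℕ → Expr
  | 0 => (match obj with
    | .sumWU => power k
    | _ => K 0) - geom k
  | i + 1 => power i

/-- Negative addresses keep the table apart from the input and the output. -/
def table (stage state : Expr) : Expr := K (-1) - (stage * R 3 + state)

/-- Put the current job on a machine with load `R 13`, if `R 14` is the cost of the rest. -/
def candidate (obj : Objective) : Program :=
  match obj with
  | .sumWC => .assign 14 (cell (K 1 + R 0 + R 5) * (R 13 + R 16) + R 14)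
  | .lMax => .branch (R 14) (R 13 + R 16 - cell (K 1 + R 0 + R 5) + R 18)
      (.assign 14 (R 13 + R 16 - cell (K 1 + R 0 + R 5) + R 18)) .skip
  | .sumWU => .branch (R 13 + R 16) (cell (K 1 + R 0 + R 0 + R 5)) .skip (.assign 14 (R 17))

/-- Take the current choice if it is better than the best one so far. -/
def accept (machine : ℕ) : Program :=
  -- All state numbers are processed, also those that belong to no feasible loads. The sign test
  -- discards negative candidates there, so every entry stays between `0` and infinity.
  .branch (K 0) (R 14)
    (.branch (R 14 + K 1) (R 9)
      (block [.assign 9 (R 14), .assign 10 (K machine), .assign 11 (R 13), .assign 12 (R 15)])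
      .skip)
    .skip

/-- Compute the data of the choice of machine `i`. -/
def prepare (obj : Objective) (k i : ℕ) : Program :=
  block [.assign 13 (machineLoad i), .assign 15 (R 6 + increment obj k i * R 16),
    .assign 14 (cell (table (R 5 + K 1) (R 15))), candidate obj]

/-- The balance test is `fitsLeft ≤ fitsRight`. Machine `0` lowers all digits, which `room` checks
at once; any other machine raises a single digit, which must stay below the base. -/
def fitsLeft : ℕ → Expr
  | 0 => K 1
  | i + 1 => digit i + R 16

def fitsRight (k : ℕ) : ℕ → Expr
  | 0 => room k
  | _ + 1 => R 2 - K 1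

def tryMachine (obj : Objective) (k i : ℕ) : Program :=
  .branch (fitsLeft i) (fitsRight k i) (.seq (prepare obj k i) (accept i)) .skip

def tryMachines (obj : Objective) (k : ℕ) : ℕ → Program
  | 0 => .skip
  | i + 1 => .seq (tryMachines obj k i) (tryMachine obj k i)

def prepareLate : Program :=
  block [.assign 13 (R 4 + R 7), .assign 15 (R 6),
    .assign 14 (cell (table (R 5 + K 1) (R 15)) + cell (K 1 + R 0 + R 5))]

def tryLate (obj : Objective) : Program :=
  match obj with
  | .sumWU => .seq prepareLate (accept 0)
  | _ => .skip

/-- Find the best choice for the current stage and state. -/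
def choose (obj : Objective) (k : ℕ) : Program :=
  block [.assign 16 (cell (K 1 + R 5)), .assign 8 (zeroLoad obj k), .assign 9 (R 17),
    tryMachines obj k (k + 1), tryLate obj]

/-- The registers that `choose` uses. -/
def scratch : Set ℕ := {r | 8 ≤ r ∧ r ≤ 16}

/-- After a round the scratch registers are only known to be bounded by a power of `X`. Resetting
them lets the loop invariants state the exact registers and the bound `X`. -/
def clear : Program :=
  block [.assign 8 (K 0), .assign 9 (K 0), .assign 10 (K 0), .assign 11 (K 0), .assign 12 (K 0),
    .assign 13 (K 0), .assign 14 (K 0), .assign 15 (K 0), .assign 16 (K 0)]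

theorem assignsOnly_candidate (obj : Objective) {A : Set ℕ} (hA : 14 ∈ A) :
    (candidate obj).AssignsOnly A := by
  cases obj <;> simp [candidate, AssignsOnly, hA]

theorem assignsOnly_prepare (obj : Objective) (k i : ℕ) :
    (prepare obj k i).AssignsOnly {13, 14, 15} := by
  have := assignsOnly_candidate obj (A := {13, 14, 15}) (by simp)
  simp [prepare, AssignsOnly, block, this]

theorem assignsOnly_prepareLate : prepareLate.AssignsOnly {13, 14, 15} := by
  simp [prepareLate, AssignsOnly, block]

theorem subset_scratch : ({13, 14, 15} : Set ℕ) ⊆ scratch := by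
  intro r hr
  simp only [Set.mem_insert_iff, Set.mem_singleton_iff] at hr
  simp only [scratch, Set.mem_ofPred_eq]
  omega

theorem assignsOnly_accept (c : ℕ) : (accept c).AssignsOnly scratch := by
  simp [accept, AssignsOnly, block, scratch]

theorem assignsOnly_tryMachine (obj : Objective) (k i : ℕ) :
    (tryMachine obj k i).AssignsOnly scratch :=
  ⟨⟨(assignsOnly_prepare obj k i).mono subset_scratch, assignsOnly_accept i⟩, trivial⟩

theorem assignsOnly_tryMachines (obj : Objective) (k i : ℕ) :
    (tryMachines obj k i).AssignsOnly scratch := by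
  induction i with
  | zero => trivial
  | succ i ih => exact ⟨ih, assignsOnly_tryMachine obj k i⟩

theorem assignsOnly_tryLate (obj : Objective) : (tryLate obj).AssignsOnly scratch := by
  cases obj
  · trivial
  · trivial
  · exact ⟨assignsOnly_prepareLate.mono subset_scratch, assignsOnly_accept 0⟩

theorem assignsOnly_choose (obj : Objective) (k : ℕ) : (choose obj k).AssignsOnly scratch := by
  have := assignsOnly_tryMachines obj k (k + 1)
  have := assignsOnly_tryLate obj
  simp only [choose, AssignsOnly, block, and_true, *]
  simp [scratch]

theorem clear_reg (s : State) (r : ℕ) :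
    (clear.run s).reg r = if 8 ≤ r ∧ r ≤ 16 then 0 else s.reg r := by
  simp only [clear, run_block_cons, run_block_nil, run_assign_reg, Expr.eval_const]
  split_ifs <;> first | rfl | omega

theorem clear_mem (s : State) : (clear.run s).mem = s.mem := rfl

theorem clear_loopFree : clear.LoopFree := by simp [clear, LoopFree, block]

/-! ### Semantics -/

theorem eval_power (s : State) (t : ℕ) : (power t).eval s = s.reg 2 ^ t := by
  induction t with
  | zero => simp [power]
  | succ t ih => rw [power, Expr.eval_mul, ih, pow_succ]; rfl

theorem eval_digit (s : State) (t : ℕ) :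
    (digit t).eval s = s.reg 6 / s.reg 2 ^ t % s.reg 2 := by
  simp [digit, eval_power]

theorem eval_geom (s : State) (t : ℕ) :
    (geom t).eval s = ∑ i ∈ Finset.range t, s.reg 2 ^ i := by
  induction t with
  | zero => rfl
  | succ t ih => rw [geom, Expr.eval_add, ih, eval_power, Finset.sum_range_succ]

theorem eval_offset (s : State) (t : ℕ) : (offset t).eval s =
    ∑ i ∈ Finset.range t, (s.reg 6 / s.reg 2 ^ i % s.reg 2 - s.reg 2 / 2) := by
  induction t with
  | zero => rfl
  | succ t ih =>
    rw [offset, Expr.eval_add, ih, Finset.sum_range_succ, Expr.eval_sub, eval_digit]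
    rfl

theorem one_le_eval_room {s : State} (h : 0 < s.reg 16) (t : ℕ)
    (hd : ∀ i < t, 0 ≤ (digit i).eval s) :
    1 ≤ (room t).eval s ↔ ∀ i < t, s.reg 16 ≤ (digit i).eval s := by
  have key : ∀ t, (∀ i < t, 0 ≤ (digit i).eval s) → 0 ≤ (room t).eval s ∧
      (1 ≤ (room t).eval s ↔ ∀ i < t, s.reg 16 ≤ (digit i).eval s) := by
    intro t
    induction t with
    | zero => simp [room]
    | succ t ih =>
      intro hd
      obtain ⟨h1, h2⟩ := ih fun i hi => hd i (by omega)
      have h3 := hd t (by omega)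
      have h4 : 0 ≤ (digit t).eval s / s.reg 16 := Int.ediv_nonneg h3 h.le
      have h5 : 1 ≤ (digit t).eval s / s.reg 16 ↔ s.reg 16 ≤ (digit t).eval s := by
        rw [Int.le_ediv_iff_mul_le h, one_mul]
      have e : (room (t + 1)).eval s = (room t).eval s * ((digit t).eval s / s.reg 16) := rfl
      rw [e]
      refine ⟨mul_nonneg h1 h4, ?_⟩
      have h6 : 1 ≤ (room t).eval s * ((digit t).eval s / s.reg 16) ↔
          1 ≤ (room t).eval s ∧ 1 ≤ (digit t).eval s / s.reg 16 := by
        constructor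
        · intro h
          by_contra hcon
          rw [not_and_or, not_le, not_le] at hcon
          rcases hcon with hcon | hcon
          · rw [show (room t).eval s = 0 by omega, zero_mul] at h
            omega
          · rw [show (digit t).eval s / s.reg 16 = 0 by omega, mul_zero] at h
            omega
        · rintro ⟨h, h'⟩
          exact one_le_mul_of_one_le_of_one_le h h'
      rw [h6, h2, h5]
      constructor
      · rintro ⟨h, h'⟩ i hi
        rcases Nat.lt_or_ge i t with h7 | h7
        · exact h i h7
        · rwa [show i = t by omega]
      · exact fun h => ⟨fun i hi => h i (by omega), h t (by omega)⟩
  exact (key t hd).2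

theorem run_accept_of_lt {s : State} (c : ℕ) (h0 : 0 ≤ s.reg 14) (h : s.reg 14 < s.reg 9) (r : ℕ) :
    ((accept c).run s).reg r = if r = 9 then s.reg 14 else if r = 10 then c else
      if r = 11 then s.reg 13 else if r = 12 then s.reg 15 else s.reg r := by
  have h' : s.reg 14 + 1 ≤ s.reg 9 := h
  simp only [accept, run_branch, Expr.eval_const, Expr.eval_reg, h0, if_true, Expr.eval_add, h',
    run_block_cons, run_block_nil, run_assign_reg]
  split_ifs <;> first | rfl | omega

theorem run_accept_of_le {s : State} (c : ℕ) (h : s.reg 9 ≤ s.reg 14) :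
    (accept c).run s = s := by
  have h' : ¬ s.reg 14 + 1 ≤ s.reg 9 := by omega
  simp only [accept, run_branch, Expr.eval_const, Expr.eval_reg, Expr.eval_add, h', if_false,
    run_skip, ite_self]

theorem run_accept_range {s : State} (c : ℕ) {Y : ℤ} (h0 : 0 ≤ s.reg 9) (h : s.reg 9 ≤ Y) :
    0 ≤ ((accept c).run s).reg 9 ∧ ((accept c).run s).reg 9 ≤ Y := by
  rcases lt_or_ge (s.reg 14) (s.reg 9) with h1 | h1
  · rcases lt_or_ge (s.reg 14) 0 with h2 | h2
    · have : (accept c).run s = s := by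
        simp [accept, run_branch, h2]
      rw [this]
      exact ⟨h0, h⟩
    · rw [run_accept_of_lt c h2 h1]
      exact ⟨h2, by rw [if_pos rfl]; omega⟩
  · rw [run_accept_of_le c h1]
    exact ⟨h0, h⟩

/-- The best value starts at infinity and is only replaced by smaller non-negative ones. No
feasibility is needed, so this also covers the entries of meaningless state numbers. -/
theorem run_choose_range (obj : Objective) (k : ℕ) (s : State) (h : 0 ≤ s.reg 17) :
    0 ≤ ((choose obj k).run s).reg 9 ∧ ((choose obj k).run s).reg 9 ≤ s.reg 17 := by
  have h1 : ∀ i, ∀ s : State, ∀ Y, 0 ≤ s.reg 9 → s.reg 9 ≤ Y →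
      0 ≤ ((tryMachines obj k i).run s).reg 9 ∧ ((tryMachines obj k i).run s).reg 9 ≤ Y := by
    intro i
    induction i with
    | zero => exact fun s Y h h' => ⟨h, h'⟩
    | succ i ih =>
      intro s Y h h'
      obtain ⟨h1, h2⟩ := ih s Y h h'
      rw [tryMachines, run_seq, tryMachine, run_branch]
      split_ifs
      · rw [run_seq]
        apply run_accept_range <;>
          rwa [(assignsOnly_prepare obj k i).run_reg _ (by simp)]
      · exact ⟨h1, h2⟩
  have h2 : ∀ s : State, ∀ Y, 0 ≤ s.reg 9 → s.reg 9 ≤ Y →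
      0 ≤ ((tryLate obj).run s).reg 9 ∧ ((tryLate obj).run s).reg 9 ≤ Y := by
    intro s Y h h'
    cases obj
    · exact ⟨h, h'⟩
    · exact ⟨h, h'⟩
    · rw [tryLate, run_seq]
      apply run_accept_range <;>
        rwa [assignsOnly_prepareLate.run_reg _ (by simp)]
  simp only [choose, run_block_cons, run_block_nil]
  refine (fun h3 => h2 _ _ h3.1 h3.2) (h1 _ _ _ ?_ ?_) <;> simp [h]

/-- The state in which stage `j` and the state with number `x` are to be evaluated. -/
structure Ready (I : Problem) (j : ℕ) (x : ℤ) (s : State) : Prop where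
  reg0 : s.reg 0 = I.n
  reg2 : s.reg 2 = I.base
  reg3 : s.reg 3 = I.states
  reg4 : s.reg 4 = I.total
  reg5 : s.reg 5 = j
  reg6 : s.reg 6 = x
  reg7 : s.reg 7 = I.before j
  reg17 : s.reg 17 = I.infty
  reg18 : s.reg 18 = I.shift
  mem_p : s.mem (1 + j) = I.p j
  mem_row : s.mem (1 + I.n + j) = I.row j
  mem_d : I.obj = .sumWU → s.mem (1 + I.n + I.n + j) = I.d j
  mem_table : ∀ L, I.Feasible (j + 1) L →
    s.mem (-1 - ((j + 1) * I.states + I.code L)) = I.opt (I.n - (j + 1)) (j + 1) L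

theorem Ready.run {I : Problem} {j : ℕ} {x : ℤ} {s : State} (h : Ready I j x s) {p : Program}
    (hp : p.AssignsOnly scratch) : Ready I j x (p.run s) := by
  have hr : ∀ r, r < 8 ∨ 16 < r → (p.run s).reg r = s.reg r := fun r hr =>
    hp.run_reg s (by simp only [scratch, Set.mem_ofPred_eq]; omega)
  have hm := hp.run_mem s
  constructor
  · rw [hr _ (by omega), h.reg0]
  · rw [hr _ (by omega), h.reg2]
  · rw [hr _ (by omega), h.reg3]
  · rw [hr _ (by omega), h.reg4]
  · rw [hr _ (by omega), h.reg5]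
  · rw [hr _ (by omega), h.reg6]
  · rw [hr _ (by omega), h.reg7]
  · rw [hr _ (by omega), h.reg17]
  · rw [hr _ (by omega), h.reg18]
  · rw [hm, h.mem_p]
  · rw [hm, h.mem_row]
  · rw [hm]; exact h.mem_d
  · rw [hm]; exact h.mem_table

end Code

namespace Problem

variable (I : Problem)

/-- The machine of the output for a choice; late jobs are put on machine `0`. -/
def machineOf (c : ℕ) : ℕ := if c ≤ I.k then c else 0

/-- The start time of the output for a choice; late jobs start after all other jobs. -/
def startOf (j : ℕ) (L : ℕ → ℤ) (c : ℕ) : ℤ := if c ≤ I.k then L c else I.total + I.before j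

end Problem

namespace Code

/-- The registers hold the best of the first `c` choices. -/
structure Tried (I : Problem) (j : ℕ) (L : ℕ → ℤ) (c : ℕ) (s : State) : Prop where
  reg8 : s.reg 8 = L 0
  reg16 : s.reg 16 = I.p j
  reg9 : s.reg 9 = I.best j L (I.opt (I.n - (j + 1)) (j + 1)) c
  -- A best value equal to `infty` means that no choice was accepted; then registers `10` to `12`
  -- carry no information.
  exists_choice : s.reg 9 < I.infty → ∃ c' < c, I.Balanced (I.next j L c') ∧
    s.reg 9 = I.cand j L c' (I.opt (I.n - (j + 1)) (j + 1) (I.next j L c')) ∧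
    s.reg 10 = I.machineOf c' ∧ s.reg 11 = I.startOf j L c' ∧ s.reg 12 = I.code (I.next j L c')

section

variable {I : Problem} {j : ℕ} {L : ℕ → ℤ} {s : State}

theorem Tried.skip {c : ℕ} (h : Tried I j L c s) (hb : ¬ I.Balanced (I.next j L c)) :
    Tried I j L (c + 1) s := by
  refine ⟨h.reg8, h.reg16, ?_, fun hlt => ?_⟩
  · rw [h.reg9, Problem.best, if_neg fun h => hb h.1]
  · obtain ⟨c', hc', h'⟩ := h.exists_choice hlt
    exact ⟨c', by omega, h'⟩

theorem Tried.accept {c : ℕ} {s' : State} (h : Tried I j L c s)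
    (hb : I.Balanced (I.next j L c)) (hs : ∀ r, r ∉ ({13, 14, 15} : Set ℕ) → s'.reg r = s.reg r)
    (h13 : s'.reg 13 = I.startOf j L c) (h15 : s'.reg 15 = I.code (I.next j L c))
    (h14 : s'.reg 14 = I.cand j L c (I.opt (I.n - (j + 1)) (j + 1) (I.next j L c)))
    (h0 : 0 ≤ s'.reg 14) : Tried I j L (c + 1) ((accept (I.machineOf c)).run s') := by
  have e8 := hs 8 (by simp)
  have e9 := hs 9 (by simp)
  have e10 := hs 10 (by simp)
  have e11 := hs 11 (by simp)
  have e12 := hs 12 (by simp)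
  have e16 := hs 16 (by simp)
  rcases lt_or_ge (s'.reg 14) (s'.reg 9) with hlt | hle
  · have hr := run_accept_of_lt (I.machineOf c) h0 hlt
    rw [e9, h14, h.reg9] at hlt
    refine ⟨?_, ?_, ?_, fun _ => ⟨c, by omega, hb, ?_, ?_, ?_, ?_⟩⟩
    · simpa [hr] using e8.trans h.reg8
    · simpa [hr] using e16.trans h.reg16
    · simp only [hr, if_true]
      rw [Problem.best, if_pos ⟨hb, hlt⟩, h14]
    · simpa [hr] using h14
    · simp [hr]
    · simpa [hr] using h13
    · simpa [hr] using h15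
  · rw [run_accept_of_le _ hle]
    rw [e9, h14, h.reg9] at hle
    refine ⟨e8.trans h.reg8, e16.trans h.reg16, ?_, fun hlt => ?_⟩
    · rw [e9, h.reg9, Problem.best, if_neg fun h => not_le.mpr h.2 hle]
    · rw [e9] at hlt
      obtain ⟨c', hc', h'⟩ := h.exists_choice hlt
      rw [e9, e10, e11, e12]
      exact ⟨c', by omega, h'⟩

theorem run_candidate (hs : Ready I j (I.code L) s) {c : ℕ} (hc : c ≤ I.k)
    (h13 : s.reg 13 = L c) (h16 : s.reg 16 = I.p j) :
    ((candidate I.obj).run s).reg 14 = I.cand j L c (s.reg 14) := by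
  have hrow := hs.mem_row
  have hd := hs.mem_d
  unfold Problem.row at hrow
  cases h : I.obj with
  | sumWC =>
    rw [h] at hrow
    simp [candidate, Problem.cand, h, hs.reg0, hs.reg5, h13, h16, hrow]
  | lMax =>
    rw [h] at hrow
    simp only [candidate, Problem.cand, h, run_branch, Expr.eval_add, Expr.eval_sub, Expr.eval_reg,
      Expr.eval_load, Expr.eval_const, hs.reg0, hs.reg5, h13, h16, hs.reg18]
    simp only at hrow
    rw [hrow]
    split_ifs with hle
    · simp [hs.reg0, hs.reg5, h13, h16, hs.reg18, hrow, hle]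
    · rw [run_skip]
      exact (max_eq_right (by omega)).symm
  | sumWU =>
    simp only [candidate, Problem.cand, h, run_branch, Expr.eval_add, Expr.eval_reg,
      Expr.eval_load, Expr.eval_const, hs.reg0, hs.reg5, h13, h16, hd h, if_pos hc]
    split_ifs with hle
    · rfl
    · simp [hs.reg17]

theorem Ready.digit_eval (hs : Ready I j (I.code L) s) (hL : I.Feasible j L) {t : ℕ}
    (ht : t < I.k) : (digit t).eval s = L (t + 1) - L 0 + I.width := by
  rw [eval_digit, hs.reg6, hs.reg2, I.code_digit hL.balanced ht]

theorem Ready.half_base (hs : Ready I j (I.code L) s) : s.reg 2 / 2 = I.width := by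
  rw [hs.reg2, I.base_eq]
  omega

theorem Ready.zeroLoad_eval (hs : Ready I j (I.code L) s) (hL : I.Feasible j L) :
    (zeroLoad I.obj I.k).eval s = L 0 := by
  by_cases h : I.obj = .sumWU
  · rw [h]
    simp only [zeroLoad, Expr.eval_div, Expr.eval_reg, eval_power, hs.reg6, hs.reg2]
    exact I.code_div hL.balanced h
  · have e : zeroLoad I.obj I.k = (R 7 - offset I.k) / K (I.k + 1) := by
      cases h' : I.obj with
      | sumWU => exact (h h').elim
      | sumWC => rfl
      | lMax => rfl
    rw [e]
    simp only [Expr.eval_div, Expr.eval_sub, Expr.eval_reg, Expr.eval_const, eval_offset,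
      hs.half_base, hs.reg7]
    rw [hs.reg6, hs.reg2]
    exact hL.load_zero_eq h

theorem Ready.machineLoad_eval (hs : Ready I j (I.code L) s) (hL : I.Feasible j L)
    (h8 : s.reg 8 = L 0) {i : ℕ} (hi : i ≤ I.k) : (machineLoad i).eval s = L i := by
  cases i with
  | zero => exact h8
  | succ i =>
    simp only [machineLoad, Expr.eval_add, Expr.eval_reg, Expr.eval_sub, Expr.eval_div,
      Expr.eval_const, hs.half_base, hs.digit_eval hL hi, h8]
    ring

theorem Ready.increment_eval (hs : Ready I j (I.code L) s) {i : ℕ} (hi : i ≤ I.k) :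
    I.code L + (increment I.obj I.k i).eval s * I.p j = I.code (I.next j L i) := by
  cases i with
  | zero =>
    rw [I.code_next_zero]
    cases h : I.obj <;>
      simp only [increment, Expr.eval_sub, Expr.eval_const, eval_power, eval_geom, hs.reg2]
  | succ i =>
    rw [I.code_next_succ j L hi, increment, eval_power, hs.reg2]

theorem Ready.fits_iff (hs : Ready I j (I.code L) s) (hL : I.Feasible j L) (hj : j < I.n)
    (h16 : s.reg 16 = I.p j) {i : ℕ} (hi : i ≤ I.k) :
    (fitsLeft i).eval s ≤ (fitsRight I.k i).eval s ↔ I.Balanced (I.next j L i) := by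
  cases i with
  | zero =>
    rw [I.balanced_next_zero hL.balanced]
    refine (one_le_eval_room (by rw [h16]; exact I.p_pos j hj) I.k fun t ht => ?_).trans ?_
    · rw [hs.digit_eval hL ht]
      exact (I.code_digit_bounds hL.balanced t ht).1
    · refine forall₂_congr fun t ht => ?_
      rw [hs.digit_eval hL ht, h16]
  | succ i =>
    rw [I.balanced_next_succ hL.balanced hi]
    simp only [fitsLeft, fitsRight, Expr.eval_add, Expr.eval_reg, Expr.eval_sub, Expr.eval_const,
      hs.digit_eval hL hi, hs.reg2, h16]

theorem Ready.cand_nonneg (hL : I.Feasible j L) (hj : j < I.n) (c : ℕ) :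
    0 ≤ I.cand j L c (I.opt (I.n - (j + 1)) (j + 1) (I.next j L c)) := by
  have h := I.opt_nonneg (I.n - (j + 1)) (j + 1) (by omega) (I.next_nonneg j hL.nonneg c)
  exact h.1.trans (I.le_cand j hL.nonneg c h.2)

theorem le_choices (I : Problem) : I.k + 1 ≤ I.choices := by
  unfold Problem.choices
  cases I.obj <;> simp

theorem Tried.tryMachine (hs : Ready I j (I.code L) s) (hL : I.Feasible j L) (hj : j < I.n)
    {i : ℕ} (hi : i ≤ I.k) (h : Tried I j L i s) :
    Tried I j L (i + 1) ((tryMachine I.obj I.k i).run s) := by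
  rw [Code.tryMachine, run_branch]
  split_ifs with hfit
  · rw [hs.fits_iff hL hj h.reg16 hi] at hfit
    have hreg : ((prepare I.obj I.k i).run s).reg 13 = L i ∧
        ((prepare I.obj I.k i).run s).reg 15 = I.code (I.next j L i) ∧
        ((prepare I.obj I.k i).run s).reg 14 =
          I.cand j L i (I.opt (I.n - (j + 1)) (j + 1) (I.next j L i)) := by
      set s₁ := (Program.assign 13 (machineLoad i)).run s with hs₁
      have r₁ : Ready I j (I.code L) s₁ := hs.run (by simp [AssignsOnly, scratch])
      have a₁ : s₁.reg 13 = L i := by simp [hs₁, hs.machineLoad_eval hL h.reg8 hi]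
      have b₁ : s₁.reg 16 = I.p j := by simp [hs₁, h.reg16]
      set s₂ := (Program.assign 15 (R 6 + increment I.obj I.k i * R 16)).run s₁ with hs₂
      have r₂ : Ready I j (I.code L) s₂ := r₁.run (by simp [AssignsOnly, scratch])
      have a₂ : s₂.reg 13 = L i := by simp [hs₂, a₁]
      have b₂ : s₂.reg 16 = I.p j := by simp [hs₂, b₁]
      have c₂ : s₂.reg 15 = I.code (I.next j L i) := by
        simp [hs₂, b₁, r₁.reg6, r₁.increment_eval hi]
      set s₃ := (Program.assign 14 (cell (table (R 5 + K 1) (R 15)))).run s₂ with hs₃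
      have r₃ : Ready I j (I.code L) s₃ := r₂.run (by simp [AssignsOnly, scratch])
      have a₃ : s₃.reg 13 = L i := by simp [hs₃, a₂]
      have b₃ : s₃.reg 16 = I.p j := by simp [hs₃, b₂]
      have c₃ : s₃.reg 15 = I.code (I.next j L i) := by simp [hs₃, c₂]
      have d₃ : s₃.reg 14 = I.opt (I.n - (j + 1)) (j + 1) (I.next j L i) := by
        simp [hs₃, table, r₂.reg5, r₂.reg3, c₂,
          r₂.mem_table _ (hL.next ((Nat.lt_succ_of_le hi).trans_le (le_choices I)) hfit)]
      have e : (prepare I.obj I.k i).run s = (candidate I.obj).run s₃ := rfl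
      have hc : ∀ r ∉ ({14} : Set ℕ), ((candidate I.obj).run s₃).reg r = s₃.reg r := fun r hr =>
        (assignsOnly_candidate I.obj (Set.mem_singleton 14)).run_reg s₃ hr
      rw [e]
      exact ⟨(hc 13 (by simp)).trans a₃, (hc 15 (by simp)).trans c₃,
        (run_candidate r₃ hi a₃ b₃).trans (by rw [d₃])⟩
    have := h.accept hfit (s' := (prepare I.obj I.k i).run s) 
      (fun r hr => (assignsOnly_prepare I.obj I.k i).run_reg s hr)
      (by rw [hreg.1, Problem.startOf, if_pos hi]) hreg.2.1 hreg.2.2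
      (hreg.2.2.ge.trans' (Ready.cand_nonneg hL hj i))
    rwa [Problem.machineOf, if_pos hi] at this
  · rw [hs.fits_iff hL hj h.reg16 hi] at hfit
    exact h.skip hfit

theorem Tried.tryMachines (hs : Ready I j (I.code L) s) (hL : I.Feasible j L) (hj : j < I.n)
    (h : Tried I j L 0 s) {i : ℕ} (hi : i ≤ I.k + 1) :
    Tried I j L i ((tryMachines I.obj I.k i).run s) := by
  induction i with
  | zero => exact h
  | succ i ih =>
    exact (ih (by omega)).tryMachine (hs.run (assignsOnly_tryMachines I.obj I.k i)) hL hj (by omega)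

theorem Tried.tryLate (hs : Ready I j (I.code L) s) (hL : I.Feasible j L) (hj : j < I.n)
    (h : Tried I j L (I.k + 1) s) : Tried I j L I.choices ((tryLate I.obj).run s) := by
  by_cases ho : I.obj = .sumWU
  · have hch : I.choices = I.k + 1 + 1 := by rw [Problem.choices, ho]
    have hk : ¬ I.k + 1 ≤ I.k := by omega
    have hb := I.balanced_next_late (j := j) hL.balanced (Nat.lt_succ_self I.k)
    have hcode := I.code_next_late j L (Nat.lt_succ_self I.k)
    have ht := hs.mem_table _ (hL.next (by omega) hb)
    have hrow := hs.mem_row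
    simp only [Problem.row, ho] at hrow
    rw [hcode] at ht
    have h14 : (prepareLate.run s).reg 14 =
        I.cand j L (I.k + 1) (I.opt (I.n - (j + 1)) (j + 1) (I.next j L (I.k + 1))) := by
      simp [prepareLate, table, hs.reg5, hs.reg3, hs.reg6, hs.reg0, ht, hrow, Problem.cand, ho]
    have := h.accept hb (s' := prepareLate.run s)
      (fun r hr => assignsOnly_prepareLate.run_reg s hr)
      (by simp [prepareLate, Problem.startOf, hs.reg4, hs.reg7])
      (by rw [hcode]; simp [prepareLate, hs.reg6])
      h14 (h14.ge.trans' (Ready.cand_nonneg hL hj _))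
    rw [Problem.machineOf, if_neg hk] at this
    rw [hch, ho]
    exact this
  · have hch : I.choices = I.k + 1 := by
      unfold Problem.choices
      cases h' : I.obj with
      | sumWU => exact (ho h').elim
      | sumWC => rfl
      | lMax => rfl
    have e : Code.tryLate I.obj = .skip := by
      cases h' : I.obj with
      | sumWU => exact (ho h').elim
      | sumWC => rfl
      | lMax => rfl
    rw [e, hch]
    exact h

theorem Tried.choose (hs : Ready I j (I.code L) s) (hL : I.Feasible j L) (hj : j < I.n) :
    Tried I j L I.choices ((choose I.obj I.k).run s) := by
  set s₁ := (Program.assign 16 (cell (K 1 + R 5))).run s with hs₁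
  have r₁ : Ready I j (I.code L) s₁ := hs.run (by simp [AssignsOnly, scratch])
  set s₂ := (Program.assign 8 (zeroLoad I.obj I.k)).run s₁ with hs₂
  have r₂ : Ready I j (I.code L) s₂ := r₁.run (by simp [AssignsOnly, scratch])
  set s₃ := (Program.assign 9 (R 17)).run s₂ with hs₃
  have r₃ : Ready I j (I.code L) s₃ := r₂.run (by simp [AssignsOnly, scratch])
  have t₃ : Tried I j L 0 s₃ := by
    refine ⟨?_, ?_, ?_, fun h => ?_⟩
    · simp [hs₃, hs₂, r₁.zeroLoad_eval hL]
    · simp [hs₃, hs₂, hs₁, hs.reg5, hs.mem_p]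
    · simp [hs₃, r₂.reg17, Problem.best]
    · simp [hs₃, r₂.reg17] at h
  exact (t₃.tryMachines r₃ hL hj le_rfl).tryLate
    (r₃.run (assignsOnly_tryMachines I.obj I.k (I.k + 1))) hL hj

end

end Code

end Scheduling

/-! ### The complete program, its invariants and its running time -/

namespace Scheduling

open RAM RAM.Program

/-- The maximum of the first `j` values and zero. -/
def runningMax (p : ℕ → ℤ) : ℕ → ℤ
  | 0 => 0
  | j + 1 => max (runningMax p j) (p j)

theorem runningMax_nonneg (p : ℕ → ℤ) (j : ℕ) : 0 ≤ runningMax p j := by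
  induction j with
  | zero => exact le_rfl
  | succ j ih => exact ih.trans (le_max_left _ _)

theorem runningMax_mono (p : ℕ → ℤ) : Monotone (runningMax p) :=
  monotone_nat_of_le_succ fun _ => le_max_left _ _

theorem le_runningMax (p : ℕ → ℤ) {t j : ℕ} (h : t < j) : p t ≤ runningMax p j :=
  (le_max_right _ _).trans (runningMax_mono p (Nat.succ_le_of_lt h))

theorem runningMax_le {p : ℕ → ℤ} {M : ℤ} (hM : 0 ≤ M) {j : ℕ} (h : ∀ t < j, p t ≤ M) :
    runningMax p j ≤ M := by
  induction j with
  | zero => exact hM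
  | succ j ih => exact max_le (ih fun t ht => h t (by omega)) (h j (Nat.lt_succ_self j))

namespace Code

/-! ### The program -/

def scanStep : Program :=
  block [.assign 16 (cell (K 1 + R 5)), .assign 4 (R 4 + R 16),
    .assign 20 (R 20 + cell (K 1 + R 0 + R 5)), .branch (R 16) (R 1) .skip (.assign 1 (R 16)),
    .assign 16 (K 0), .assign 5 (R 5 + K 1)]

def scan : Program := .loop (R 5 + K 1) (R 0) scanStep

def statesExpr (obj : Objective) (k : ℕ) : Expr :=
  match obj with
  | .sumWU => power k * (R 4 + K 1)
  | _ => power k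

/-- Cell `2 * n`, which is `1 + n + (n - 1)`, holds the last due date. -/
def shiftExpr (obj : Objective) : Expr :=
  match obj with
  | .lMax => cell (R 0 + R 0)
  | _ => K 0

def setup (obj : Objective) (k : ℕ) : Program :=
  block [.assign 2 (K 8 * (R 1 * R 1) + K 1), .assign 3 (statesExpr obj k),
    .assign 17 ((R 4 + K 1) * (R 20 + K 1)), .assign 18 (shiftExpr obj), .assign 7 (R 4)]

def fillStep (obj : Objective) (k : ℕ) : Program :=
  block [choose obj k, .store (table (R 5) (R 6)) (R 9), clear, .assign 6 (R 6 + K 1)]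

def fillStage (obj : Objective) (k : ℕ) : Program := .loop (R 6 + K 1) (R 3) (fillStep obj k)

def previous : Program := block [.assign 5 (R 5 - K 1), .assign 7 (R 7 - cell (K 1 + R 5))]

def fill (obj : Objective) (k : ℕ) : Program :=
  .loop (K 1) (R 5) (.seq previous (.seq (fillStage obj k) (.assign 6 (K 0))))

/-- For zero loads every digit is the width, that is, half the base rounded down. -/
def restart (k : ℕ) : Program :=
  block [.assign 6 (R 2 / K 2 * geom k), .assign 19 (cell (table (R 5) (R 6)))]

def traceStep (obj : Objective) (k : ℕ) : Program :=
  -- The output of a job overwrites its own input cells, after `choose` has read them; its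
  -- processing time is still in register `16`.
  block [choose obj k, .store (K 1 + R 5) (R 10), .store (K 1 + R 0 + R 5) (R 11),
    .assign 7 (R 7 + R 16), .assign 6 (R 12), clear, .assign 5 (R 5 + K 1)]

def trace (obj : Objective) (k : ℕ) : Program := .loop (R 5 + K 1) (R 0) (traceStep obj k)

def finish : Program := .store (K 0) (R 19 - R 18)

/-- The program that solves the scheduling problem on `k + 1` machines. -/
def solve (obj : Objective) (k : ℕ) : Program :=
  .seq (.assign 0 (cell (K 0))) (.seq scan (.seq (setup obj k) (.seq (fill obj k)
    (.seq (restart k) (.seq (trace obj k) finish)))))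

/-! ### Invariants -/

/-- The values of the registers that do not change after the initialization. -/
def fixedReg (I : Problem) (r : ℕ) : ℤ :=
  if r = 0 then I.n else if r = 1 then I.pmax else if r = 2 then I.base else
  if r = 3 then I.states else if r = 4 then I.total else if r = 17 then I.infty else
  if r = 18 then I.shift else if r = 20 then I.rowSum I.n else 0

/-- The registers between the rounds of the loops. -/
def regs (I : Problem) (j : ℕ) (x b v : ℤ) (r : ℕ) : ℤ :=
  if r = 5 then j else if r = 6 then x else if r = 7 then b else if r = 19 then v else fixedReg I r

theorem regs_scratch (I : Problem) (j : ℕ) (x b v : ℤ) {r : ℕ} (h : 8 ≤ r ∧ r ≤ 16) :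
    regs I j x b v r = 0 := by
  obtain ⟨h1, h2⟩ := h
  interval_cases r <;> rfl

/-- The memory contains the input. -/
structure HasInput (I : Problem) (j : ℕ) (mem : ℤ → ℤ) : Prop where
  mem_p : ∀ t < I.n, j ≤ t → mem (1 + t) = I.p t
  mem_row : ∀ t < I.n, j ≤ t → mem (1 + I.n + t) = I.row t
  mem_d : I.obj = .sumWU → ∀ t < I.n, j ≤ t → mem (1 + I.n + I.n + t) = I.d t

/-- The table is correct from stage `j` on. -/
def HasTable (I : Problem) (j : ℕ) (mem : ℤ → ℤ) : Prop :=
  ∀ t ≤ I.n, j ≤ t → ∀ L, I.Feasible t L →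
    mem (-1 - (t * I.states + I.code L)) = I.opt (I.n - t) t L

/-- All values are bounded by `X`. -/
structure Fits (I : Problem) (X : ℕ) : Prop where
  two_le : 2 ≤ X
  n_le : (I.n : ℤ) ≤ X
  k_le : (I.k : ℤ) ≤ X
  pmax_le : I.pmax ≤ X
  base_le : I.base ≤ X
  states_le : I.states ≤ X
  -- The factor `2` accounts for the start times `total + before j` of late jobs.
  total_le : 2 * I.total ≤ X
  infty_le : I.infty ≤ X
  shift_le : I.shift ≤ X
  rowSum_le : I.rowSum I.n ≤ X

theorem shift_nonneg (I : Problem) : 0 ≤ I.shift := by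
  unfold Problem.shift
  cases I.obj
  · exact le_rfl
  · exact I.d_nonneg _
  · exact le_rfl

theorem states_pos (I : Problem) : 0 < I.states := by
  have h := pow_pos I.base_pos I.k
  have h' := I.before_nonneg I.n
  unfold Problem.states Problem.total
  cases I.obj
  · exact h
  · exact h
  · exact mul_pos h (by omega)

theorem before_le_total (I : Problem) {j : ℕ} (hj : j ≤ I.n) : I.before j ≤ I.total :=
  I.before_mono hj

theorem Fits.regs_bounded {I : Problem} {X : ℕ} (hX : Fits I X) {j : ℕ} (hj : j ≤ I.n) {x b v : ℤ}
    (hx : 0 ≤ x ∧ x ≤ X) (hb : 0 ≤ b ∧ b ≤ I.total) (hv : 0 ≤ v ∧ v ≤ I.infty) (r : ℕ) :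
    (regs I j x b v r).natAbs ≤ X := by
  have key : ∀ y : ℤ, 0 ≤ y → y ≤ X → y.natAbs ≤ X := fun y _ _ => by omega
  have hT : 0 ≤ I.total := I.before_nonneg I.n
  have hTX : I.total ≤ X := by
    have := hX.total_le
    linarith
  have ite : ∀ (c : Prop) [Decidable c] (y z : ℤ), y.natAbs ≤ X → z.natAbs ≤ X →
      (if c then y else z).natAbs ≤ X := fun c _ y z hy hz => by
    split_ifs
    · exact hy
    · exact hz
  refine ite _ _ _ (key _ (by positivity) ((Int.ofNat_le.mpr hj).trans hX.n_le)) ?_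
  refine ite _ _ _ (key _ hx.1 hx.2) ?_
  refine ite _ _ _ (key _ hb.1 (hb.2.trans hTX)) ?_
  refine ite _ _ _ (key _ hv.1 (hv.2.trans hX.infty_le)) ?_
  refine ite _ _ _ (key _ (by positivity) hX.n_le) ?_
  refine ite _ _ _ (key _ I.pmax_pos.le hX.pmax_le) ?_
  refine ite _ _ _ (key _ I.base_pos.le hX.base_le) ?_
  refine ite _ _ _ (key _ (states_pos I).le hX.states_le) ?_
  refine ite _ _ _ (key _ hT hTX) ?_
  refine ite _ _ _ (key _ I.infty_pos.le hX.infty_le) ?_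
  refine ite _ _ _ (key _ (shift_nonneg I) hX.shift_le) ?_
  exact ite _ _ _ (key _ (I.rowSum_nonneg I.n) hX.rowSum_le) (key _ le_rfl (by positivity))

theorem ready_of_regs {I : Problem} {j : ℕ} (hj : j < I.n) {x v : ℤ} {s : State}
    (hs : s.reg = regs I j x (I.before j) v) (hin : HasInput I j s.mem)
    (ht : HasTable I (j + 1) s.mem) : Ready I j x s := by
  constructor
  any_goals rw [hs]; simp [regs, fixedReg]
  · exact hin.mem_p j hj le_rfl
  · exact hin.mem_row j hj le_rfl
  · exact fun h => hin.mem_d h j hj le_rfl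
  · intro L hL
    have := ht (j + 1) hj le_rfl L hL
    push_cast at this
    exact this

theorem choose_reg (obj : Objective) (k : ℕ) (s : State) {r : ℕ} (h : ¬ (8 ≤ r ∧ r ≤ 16)) :
    ((choose obj k).run s).reg r = s.reg r :=
  (assignsOnly_choose obj k).run_reg s h

theorem choose_mem (obj : Objective) (k : ℕ) (s : State) :
    ((choose obj k).run s).mem = s.mem :=
  (assignsOnly_choose obj k).run_mem s

theorem opt_eq_best {I : Problem} {j : ℕ} (hj : j < I.n) (L : ℕ → ℤ) :
    I.opt (I.n - j) j L = I.best j L (I.opt (I.n - (j + 1)) (j + 1)) I.choices := by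
  rw [show I.n - j = (I.n - (j + 1)) + 1 by omega]
  rfl

/-! ### Filling the table -/

theorem fillStep_reg {I : Problem} {j : ℕ} {x b v : ℤ} {s : State}
    (hs : s.reg = regs I j x b v) :
    ((fillStep I.obj I.k).run s).reg = regs I j (x + 1) b v := by
  funext r
  simp only [fillStep, run_block_cons, run_block_nil, run_assign_reg, Expr.eval_add, Expr.eval_reg,
    Expr.eval_const, clear_reg, run_store_reg]
  by_cases h6 : r = 6
  · subst h6
    rw [if_pos rfl, if_neg (by omega), choose_reg _ _ _ (by omega), hs]
    simp [regs]
  · rw [if_neg h6]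
    split_ifs with h
    · rw [regs_scratch _ _ _ _ _ h]
    · rw [choose_reg _ _ _ h, hs]
      simp [regs, h6]

theorem fillStep_mem (I : Problem) (s : State) (a : ℤ) :
    ((fillStep I.obj I.k).run s).mem a = if a = -1 - (s.reg 5 * s.reg 3 + s.reg 6) then
      ((choose I.obj I.k).run s).reg 9 else s.mem a := by
  simp only [fillStep, run_block_cons, run_block_nil, run_assign_mem, clear_mem, run_store_mem,
    choose_mem, table, Expr.eval_sub, Expr.eval_add, Expr.eval_mul, Expr.eval_reg, Expr.eval_const]
  rw [choose_reg _ _ _ (by omega), choose_reg _ _ _ (by omega), choose_reg _ _ _ (by omega)]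

/-- The invariant while stage `j` is filled. -/
structure Filling (I : Problem) (X j : ℕ) (i : ℕ) (s : State) : Prop where
  reg : s.reg = regs I j i (I.before j) 0
  le_states : (i : ℤ) ≤ I.states
  bounded : ∀ a, (s.mem a).natAbs ≤ X
  input : HasInput I 0 s.mem
  zero : ∀ a, a < -(I.n * I.states) → s.mem a = 0
  table : HasTable I (j + 1) s.mem
  row : ∀ L, I.Feasible j L → I.code L < i →
    s.mem (-1 - (j * I.states + I.code L)) = I.opt (I.n - j) j L

theorem HasInput.mono {I : Problem} {i j : ℕ} (hij : i ≤ j) {mem : ℤ → ℤ} (h : HasInput I i mem) :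
    HasInput I j mem :=
  ⟨fun t h1 h2 => h.mem_p t h1 (hij.trans h2), fun t h1 h2 => h.mem_row t h1 (hij.trans h2),
    fun ho t h1 h2 => h.mem_d ho t h1 (hij.trans h2)⟩

theorem HasInput.congr {I : Problem} {j : ℕ} {mem mem' : ℤ → ℤ} (h : HasInput I j mem)
    (hm : ∀ a, 0 ≤ a → mem' a = mem a) : HasInput I j mem' :=
  ⟨fun t h1 h2 => (hm _ (by omega)).trans (h.mem_p t h1 h2),
    fun t h1 h2 => (hm _ (by omega)).trans (h.mem_row t h1 h2),
    fun ho t h1 h2 => (hm _ (by omega)).trans (h.mem_d ho t h1 h2)⟩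

theorem Filling.step {I : Problem} {X j i : ℕ} (hX : Fits I X) (hj : j < I.n)
    (hi : (i : ℤ) < I.states) {s : State} (h : Filling I X j i s) :
    Filling I X j (i + 1) ((fillStep I.obj I.k).run s) := by
  have hready := ready_of_regs hj h.reg (h.input.mono (Nat.zero_le j)) h.table
  have hmem : ∀ a, ((fillStep I.obj I.k).run s).mem a = if a = -1 - (j * I.states + i) then
      ((choose I.obj I.k).run s).reg 9 else s.mem a := by
    intro a
    rw [fillStep_mem, hready.reg5, hready.reg3, hready.reg6]
  have hS := states_pos I
  have hji : 0 ≤ (j : ℤ) * I.states := by positivity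
  have hjn : (j : ℤ) * I.states + I.states ≤ I.n * I.states := by
    have : (j : ℤ) + 1 ≤ I.n := by exact_mod_cast hj
    nlinarith
  refine ⟨?_, by push_cast; omega, fun a => ?_, ?_, fun a ha => ?_, ?_, ?_⟩
  · rw [fillStep_reg h.reg]
    push_cast
    rfl
  · rw [hmem]
    split_ifs
    · have h1 := run_choose_range I.obj I.k s (by rw [hready.reg17]; exact I.infty_pos.le)
      rw [hready.reg17] at h1
      have := hX.infty_le
      omega
    · exact h.bounded a
  · exact h.input.congr fun a ha => by rw [hmem, if_neg (by omega)]
  · rw [hmem, if_neg (by omega)]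
    exact h.zero a ha
  · intro t ht hjt L hL
    have hc := hL.code_bounds ht
    have : (j : ℤ) * I.states + I.states ≤ t * I.states := by
      have : (j : ℤ) + 1 ≤ t := by exact_mod_cast hjt
      nlinarith
    rw [hmem, if_neg (by omega)]
    exact h.table t ht hjt L hL
  · intro L hL hlt
    rw [hmem]
    -- If the entry just written is the one for `L`, then the current number is the code of feasible
    -- loads and `Tried.choose` applies. Nothing is claimed about other numbers.
    split_ifs with heq
    · have hx : (i : ℤ) = I.code L := by omega
      rw [hx] at hready
      rw [(Tried.choose hready hL hj).reg9, opt_eq_best hj]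
    · exact h.row L hL (by push_cast at hlt; omega)

theorem fillStep_loopFree (obj : Objective) (k : ℕ) : (fillStep obj k).LoopFree := by
  have h1 := (assignsOnly_choose obj k).loopFree
  simp [fillStep, LoopFree, block, h1, clear_loopFree]

theorem Filling.state_bounded {I : Problem} {X j i : ℕ} (hX : Fits I X) (hj : j < I.n) {s : State}
    (h : Filling I X j i s) : s.Bounded X := by
  refine ⟨fun r => ?_, h.bounded⟩
  rw [h.reg]
  have := hX.states_le
  have := h.le_states
  exact hX.regs_bounded hj.le (by omega) ⟨I.before_nonneg j, before_le_total I hj.le⟩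
    ⟨le_rfl, I.infty_pos.le⟩ r

theorem runs_fillStage {I : Problem} {X B j : ℕ} (hX : Fits I X) (hj : j < I.n)
    (hB : X ^ (fillStage I.obj I.k).weight ≤ B) {s : State} (h : Filling I X j 0 s) :
    Runs B (fillStage I.obj I.k) s (I.states.toNat * (fillStage I.obj I.k).size +
      (fillStage I.obj I.k).size) (Filling I X j I.states.toNat) := by
  have hS := states_pos I
  refine (Runs.loop (T := (fillStep I.obj I.k).size) (K := I.states.toNat) (Filling I X j)
    hX.two_le hB (fun i s h => h.state_bounded hX hj) (fun i s hi h => ?_) (fun s h => ?_) h).mono ?_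
    fun _ h => h
  · have hi' : (i : ℤ) < I.states := by omega
    have hready := ready_of_regs hj h.reg (h.input.mono (Nat.zero_le j)) h.table
    refine ⟨?_, Runs.of_loopFree (fillStep_loopFree _ _) hX.two_le (h.state_bounded hX hj)
      ((Nat.pow_le_pow_right (by have := hX.two_le; omega) (weight_le_loop _ _ _)).trans hB)
      (h.step hX hj hi')⟩
    simp only [Expr.eval_add, Expr.eval_reg, Expr.eval_const, hready.reg6, hready.reg3]
    omega
  · have hready := ready_of_regs hj h.reg (h.input.mono (Nat.zero_le j)) h.table
    simp only [Expr.eval_add, Expr.eval_reg, Expr.eval_const, hready.reg6, hready.reg3]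
    omega
  · exact Nat.add_le_add le_rfl (Nat.le_add_right _ _)

/-- The invariant of the backward pass when the stages from `j` on are filled. -/
structure Filled (I : Problem) (X j : ℕ) (s : State) : Prop where
  reg : s.reg = regs I j 0 (I.before j) 0
  bounded : ∀ a, (s.mem a).natAbs ≤ X
  input : HasInput I 0 s.mem
  zero : ∀ a, a < -(I.n * I.states) → s.mem a = 0
  table : HasTable I j s.mem

theorem Filled.state_bounded {I : Problem} {X j : ℕ} (hX : Fits I X) (hj : j ≤ I.n) {s : State}
    (h : Filled I X j s) : s.Bounded X := by
  refine ⟨fun r => ?_, h.bounded⟩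
  rw [h.reg]
  exact hX.regs_bounded hj (by omega) ⟨I.before_nonneg j, before_le_total I hj⟩
    ⟨le_rfl, I.infty_pos.le⟩ r

theorem Filled.previous {I : Problem} {X j : ℕ} (hj : j < I.n) {s : State}
    (h : Filled I X (j + 1) s) : Filling I X j 0 (previous.run s) := by
  have e5 : s.reg 5 = (j : ℤ) + 1 := by rw [h.reg]; simp [regs]
  have e7 : s.reg 7 = I.before (j + 1) := by rw [h.reg]; simp [regs]
  refine ⟨?_, (states_pos I).le, h.bounded, h.input, h.zero, h.table, fun L hL hlt => ?_⟩
  · funext r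
    simp only [Code.previous, run_block_cons, run_block_nil, run_assign_reg, run_assign_mem,
      Expr.eval_sub, Expr.eval_add, Expr.eval_reg, Expr.eval_const, Expr.eval_load]
    simp only [if_true, e5, e7, show (7 : ℕ) ≠ 5 by decide, if_false, add_sub_cancel_right,
      h.input.mem_p j hj (Nat.zero_le j), I.before_succ]
    rw [h.reg]
    unfold regs
    split_ifs <;> first | rfl | omega
  · have := (hL.code_bounds hj.le).1
    push_cast at hlt
    omega

theorem Filling.filled {I : Problem} {X j : ℕ} (hj : j < I.n) {s : State}
    (h : Filling I X j I.states.toNat s) :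
    Filled I X j ((Program.assign 6 (K 0)).run s) := by
  refine ⟨?_, h.bounded, h.input, h.zero, fun t ht hjt L hL => ?_⟩
  · funext r
    rw [run_assign_reg, h.reg]
    unfold regs
    simp only [Expr.eval_const]
    split_ifs <;> first | rfl | omega
  · rcases Nat.lt_or_ge j t with h1 | h1
    · exact h.table t ht h1 L hL
    · obtain rfl : j = t := by omega
      have := (hL.code_bounds hj.le).2
      exact h.row L hL (by omega)

theorem runs_fill {I : Problem} {X B : ℕ} (hX : Fits I X)
    (hB : X ^ (fill I.obj I.k).weight ≤ B) {s : State} (h : Filled I X I.n s) :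
    Runs B (fill I.obj I.k) s (5 * (fill I.obj I.k).size * (I.n * I.states.toNat))
      (Filled I X 0) := by
  have hX1 : 1 ≤ X := by
    have := hX.two_le
    omega
  have hS : 1 ≤ I.states.toNat := by
    have := states_pos I
    omega
  have key := Runs.loop (T := previous.size + ((I.states.toNat * (fillStage I.obj I.k).size +
    (fillStage I.obj I.k).size) + (Program.assign 6 (K 0)).size)) (K := I.n)
    (fun i s => i ≤ I.n ∧ Filled I X (I.n - i) s) hX.two_le hB
    (fun i s h => h.2.state_bounded hX (Nat.sub_le _ _)) ?_ ?_ (s := s) ⟨Nat.zero_le _, h⟩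
  · refine key.mono ?_ fun s h => by simpa using h.2
    have h1 : 1 ≤ I.n * I.states.toNat := Nat.mul_le_mul I.n_pos hS
    have h2 : I.n ≤ I.n * I.states.toNat := Nat.le_mul_of_pos_right _ hS
    have e : (fill I.obj I.k).size = 1 + (K 1).cost + (R 5).cost + (previous.size +
      ((fillStage I.obj I.k).size + (Program.assign 6 (K 0)).size)) := rfl
    -- As `n * S` is at least `n` and at least `1`, the time is at most `n * S * (2 * A + P + 2 * F
    -- + Q)`; the constant `5` is generous.
    generalize (1 + (K 1).cost + (R 5).cost) = A at *
    generalize (fillStage I.obj I.k).size = F at *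
    generalize previous.size = P at *
    generalize (Program.assign 6 (K 0)).size = Q at *
    rw [e]
    generalize I.states.toNat = S at *
    have h3 : I.n * (A + (P + (S * F + F + Q))) + A =
      I.n * A + I.n * P + (I.n * S) * F + I.n * F + I.n * Q + A := by ring
    rw [h3]
    generalize I.n * S = N at *
    have := Nat.mul_le_mul_right A h2
    have := Nat.mul_le_mul_right P h2
    have := Nat.mul_le_mul_right F h2
    have := Nat.mul_le_mul_right Q h2
    have := Nat.mul_le_mul_right A h1
    nlinarith
  · rintro i s hi ⟨-, h⟩
    have e5 : s.reg 5 = ((I.n - i : ℕ) : ℤ) := by rw [h.reg]; simp [regs]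
    refine ⟨by simp only [Expr.eval_const, Expr.eval_reg, e5]; omega, ?_⟩
    rw [show I.n - i = (I.n - (i + 1)) + 1 by omega] at h
    have hj : I.n - (i + 1) < I.n := by omega
    have hw : ∀ w ≤ (fill I.obj I.k).weight, X ^ w ≤ B := fun w hw =>
      (Nat.pow_le_pow_right hX1 hw).trans hB
    have w1 : (Program.seq previous (.seq (fillStage I.obj I.k) (.assign 6 (K 0)))).weight ≤
      (fill I.obj I.k).weight := weight_le_loop _ _ _
    have w2 := (weight_le_seq_right previous (.seq (fillStage I.obj I.k) (.assign 6 (K 0)))).trans w1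
    refine (Runs.of_loopFree (Q := Filling I X (I.n - (i + 1)) 0) (by trivial) hX.two_le
      (h.state_bounded hX hj) (hw _ ((weight_le_seq_left _ _).trans w1)) (h.previous hj)).seq ?_
    intro s₁ h₁
    refine (runs_fillStage hX hj (hw _ ((weight_le_seq_left _ _).trans w2)) h₁).seq ?_
    intro s₂ h₂
    exact Runs.of_loopFree (p := .assign 6 (K 0)) trivial hX.two_le (h₂.state_bounded hX hj)
      (hw _ ((weight_le_seq_right _ _).trans w2)) ⟨hi, h₂.filled hj⟩
  · rintro s ⟨-, h⟩
    have e5 : s.reg 5 = 0 := by rw [h.reg]; simp [regs]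
    simp [e5]

end Code
end Scheduling

namespace Scheduling

open RAM RAM.Program

theorem load_congr (p : ℕ → ℤ) {a b : ℕ → ℕ} {j : ℕ} (h : ∀ t < j, a t = b t) (i : ℕ) :
    load p a i j = load p b i j :=
  Finset.sum_congr rfl fun t ht => by rw [h t (Finset.mem_range.mp ht)]

theorem load_update (p : ℕ → ℤ) (a : ℕ → ℕ) (c i : ℕ) {j t : ℕ} (h : t ≤ j) :
    load p (Function.update a j c) i t = load p a i t :=
  load_congr p (fun t' ht' => Function.update_of_ne (by omega) _ _) i

namespace Code

/-! ### Following the optimal choices -/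

/-- The invariant of the forward pass: the first `j` jobs are scheduled according to `a`. -/
structure Tracing (I : Problem) (X : ℕ) (v : ℤ) (a : ℕ → ℕ) (j : ℕ) (s : State) : Prop where
  reg : s.reg = regs I j (I.code fun i => load I.p a i j) (I.before j) v
  optimal : I.Optimal a j
  opt_lt : I.opt (I.n - j) j (fun i => load I.p a i j) < I.infty
  bounded : ∀ x, (s.mem x).natAbs ≤ X
  input : HasInput I j s.mem
  table : HasTable I 0 s.mem
  machine : ∀ t < j, s.mem (1 + t) = I.machineOf (a t)
  start : ∀ t < j, s.mem (1 + I.n + t) = I.startOf t (fun i => load I.p a i t) (a t)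

theorem HasTable.mono {I : Problem} {i j : ℕ} (hij : i ≤ j) {mem : ℤ → ℤ} (h : HasTable I i mem) :
    HasTable I j mem :=
  fun t h1 h2 => h t h1 (hij.trans h2)

theorem HasTable.congr {I : Problem} {j : ℕ} {mem mem' : ℤ → ℤ} (h : HasTable I j mem)
    (hm : ∀ a, a < 0 → mem' a = mem a) : HasTable I j mem' := by
  intro t h1 h2 L hL
  have hS := (states_pos I).le
  have := (hL.code_bounds h1).1
  have : 0 ≤ (t : ℤ) * I.states := by positivity
  rw [hm _ (by omega)]
  exact h t h1 h2 L hL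

theorem Tracing.ready {I : Problem} {X : ℕ} {v : ℤ} {a : ℕ → ℕ} {j : ℕ} (hj : j < I.n) {s : State}
    (h : Tracing I X v a j s) : Ready I j (I.code fun i => load I.p a i j) s :=
  ready_of_regs hj h.reg h.input (h.table.mono (Nat.zero_le _))

theorem traceStep_mem (I : Problem) (s : State) (x : ℤ) :
    ((traceStep I.obj I.k).run s).mem x =
      if x = 1 + s.reg 0 + s.reg 5 then ((choose I.obj I.k).run s).reg 11 else
      if x = 1 + s.reg 5 then ((choose I.obj I.k).run s).reg 10 else s.mem x := by
  simp only [traceStep, run_block_cons, run_block_nil, run_assign_mem, clear_mem, run_store_mem,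
    run_store_reg, choose_mem, Expr.eval_add, Expr.eval_reg, Expr.eval_const]
  rw [choose_reg _ _ _ (by omega), choose_reg _ _ _ (by omega)]

theorem traceStep_reg {I : Problem} {j : ℕ} {x b v : ℤ} {s : State}
    (hs : s.reg = regs I j x b v) :
    ((traceStep I.obj I.k).run s).reg = regs I (j + 1) (((choose I.obj I.k).run s).reg 12)
      (b + ((choose I.obj I.k).run s).reg 16) v := by
  funext r
  simp only [traceStep, run_block_cons, run_block_nil, run_assign_reg, Expr.eval_add, Expr.eval_reg,
    Expr.eval_const, clear_reg, run_store_reg]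
  by_cases h5 : r = 5
  · subst h5
    rw [if_pos rfl, if_neg (by omega), if_neg (by omega), if_neg (by omega),
      choose_reg _ _ _ (by omega), hs]
    simp [regs]
  · rw [if_neg h5]
    by_cases h : 8 ≤ r ∧ r ≤ 16
    · rw [if_pos h, regs_scratch _ _ _ _ _ h]
    · rw [if_neg h]
      by_cases h6 : r = 6
      · subst h6
        simp [regs]
      · rw [if_neg h6]
        by_cases h7 : r = 7
        · subst h7
          rw [if_pos rfl, choose_reg _ _ _ (by omega), hs]
          simp [regs]
        · rw [if_neg h7, choose_reg _ _ _ h, hs]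
          simp [regs, h5, h6, h7]

theorem Tracing.step {I : Problem} {X : ℕ} (hX : Fits I X) {v : ℤ} {a : ℕ → ℕ} {j : ℕ}
    (hj : j < I.n) {s : State} (h : Tracing I X v a j s) :
    ∃ a', Tracing I X v a' (j + 1) ((traceStep I.obj I.k).run s) := by
  have hready := h.ready hj
  have hL := h.optimal.feasible
  obtain ⟨-, t16, t9, tex⟩ := Tried.choose hready hL hj
  -- The optimum is below `infty`, so the registers hold a choice that attains it.
  rw [t9, ← opt_eq_best hj] at tex
  obtain ⟨c, hc, hbal, hopt, t10, t11, t12⟩ := tex h.opt_lt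
  have hload : ∀ t ≤ j, (fun i => load I.p (Function.update a j c) i t) =
      fun i => load I.p a i t := fun t ht => funext fun i => load_update I.p a c i ht
  have hnext : I.next j (fun i => load I.p a i j) c =
      fun i => load I.p (Function.update a j c) i (j + 1) := by
    have := I.next_load (Function.update a j c) j
    rwa [Function.update_self, hload j le_rfl] at this
  have hstart : 0 ≤ I.startOf j (fun i => load I.p a i j) c ∧
      I.startOf j (fun i => load I.p a i j) c ≤ X := by
    have h1 := before_le_total I hj.le
    have h2 := I.before_nonneg j
    have h3 := hX.total_le
    unfold Problem.startOf
    split_ifs with hk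
    · have h4 := hL.load_zero_le hk
      have h5 := hL.nonneg c
      constructor <;> linarith
    · constructor <;> linarith
  have hmach : I.machineOf c ≤ X := by
    have := hX.k_le
    unfold Problem.machineOf
    split_ifs <;> omega
  have hmem : ∀ x, ((traceStep I.obj I.k).run s).mem x =
      if x = 1 + I.n + j then I.startOf j (fun i => load I.p a i j) c else
      if x = 1 + j then I.machineOf c else s.mem x := by
    intro x
    rw [traceStep_mem, hready.reg0, hready.reg5, t10, t11]
  refine ⟨Function.update a j c, ?_, ⟨fun t ht => ?_, ?_, fun t ht => ?_⟩, ?_, fun x => ?_, ?_, ?_,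
    fun t ht => ?_, fun t ht => ?_⟩
  · rw [traceStep_reg h.reg, t12, t16, I.before_succ, hnext]
  · rcases Nat.lt_or_ge t j with h1 | h1
    · rw [Function.update_of_ne (by omega)]
      exact h.optimal.lt_choices t h1
    · obtain rfl : t = j := by omega
      rwa [Function.update_self]
  · rw [← hnext]
    exact hL.next hc hbal
  · rcases Nat.lt_or_ge t j with h1 | h1
    · rw [hload t h1.le, hload (t + 1) h1, Function.update_of_ne (by omega)]
      exact h.optimal.opt_eq t h1
    · obtain rfl : t = j := by omega
      rw [hload t le_rfl, ← hnext, Function.update_self, hopt]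
  · rw [← hnext]
    refine lt_of_le_of_lt ?_ h.opt_lt
    rw [hopt]
    exact I.le_cand j hL.nonneg c
      (I.opt_nonneg _ _ (by omega) (I.next_nonneg j hL.nonneg c)).2
  · rw [hmem]
    split_ifs
    · omega
    · omega
    · exact h.bounded x
  · refine ⟨fun t h1 h2 => ?_, fun t h1 h2 => ?_, fun ho t h1 h2 => ?_⟩
    · rw [hmem, if_neg (by omega), if_neg (by omega)]
      exact h.input.mem_p t h1 (by omega)
    · rw [hmem, if_neg (by omega), if_neg (by omega)]
      exact h.input.mem_row t h1 (by omega)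
    · rw [hmem, if_neg (by omega), if_neg (by omega)]
      exact h.input.mem_d ho t h1 (by omega)
  · exact h.table.congr fun x hx => by rw [hmem, if_neg (by omega), if_neg (by omega)]
  · rcases Nat.lt_or_ge t j with h1 | h1
    · rw [Function.update_of_ne (by omega), hmem, if_neg (by omega), if_neg (by omega)]
      exact h.machine t h1
    · obtain rfl : t = j := by omega
      rw [Function.update_self, hmem, if_neg (by omega), if_pos rfl]
  · rcases Nat.lt_or_ge t j with h1 | h1
    · rw [Function.update_of_ne (by omega), hload t h1.le, hmem, if_neg (by omega),
        if_neg (by omega)]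
      exact h.start t h1
    · obtain rfl : t = j := by omega
      rw [Function.update_self, hload t le_rfl, hmem, if_pos rfl]

theorem Tracing.state_bounded {I : Problem} {X : ℕ} (hX : Fits I X) {v : ℤ}
    (hv : 0 ≤ v ∧ v ≤ I.infty) {a : ℕ → ℕ} {j : ℕ} (hj : j ≤ I.n) {s : State}
    (h : Tracing I X v a j s) : s.Bounded X := by
  refine ⟨fun r => ?_, h.bounded⟩
  rw [h.reg]
  have h1 := h.optimal.feasible.code_bounds hj
  have := hX.states_le
  exact hX.regs_bounded hj (by omega) ⟨I.before_nonneg j, before_le_total I hj⟩ hv r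

theorem traceStep_loopFree (obj : Objective) (k : ℕ) : (traceStep obj k).LoopFree := by
  have h1 := (assignsOnly_choose obj k).loopFree
  simp [traceStep, LoopFree, block, h1, clear_loopFree]

theorem runs_trace {I : Problem} {X B : ℕ} (hX : Fits I X) {v : ℤ} (hv : 0 ≤ v ∧ v ≤ I.infty)
    (hB : X ^ (trace I.obj I.k).weight ≤ B) {s : State} {a : ℕ → ℕ} (h : Tracing I X v a 0 s) :
    Runs B (trace I.obj I.k) s (I.n * (trace I.obj I.k).size + (trace I.obj I.k).size)
      (fun s => ∃ a, Tracing I X v a I.n s) := by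
  refine (Runs.loop (T := (traceStep I.obj I.k).size) (K := I.n)
    (fun j s => j ≤ I.n ∧ ∃ a, Tracing I X v a j s)
    hX.two_le hB (fun j s h => ?_) (fun j s hj h => ?_) (fun s h => ?_) ⟨Nat.zero_le _, a, h⟩).mono
    ?_ fun _ h => h.2
  · obtain ⟨hj, a, h⟩ := h
    exact h.state_bounded hX hv hj
  · obtain ⟨-, a, h⟩ := h
    have hready := h.ready hj
    refine ⟨?_, Runs.of_loopFree (traceStep_loopFree _ _) hX.two_le (h.state_bounded hX hv hj.le)
      ((Nat.pow_le_pow_right (by have := hX.two_le; omega) (weight_le_loop _ _ _)).trans hB)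
      ⟨hj, h.step hX hj⟩⟩
    simp only [Expr.eval_add, Expr.eval_reg, Expr.eval_const, hready.reg0, hready.reg5]
    omega
  · obtain ⟨-, a, h⟩ := h
    simp [h.reg, regs, fixedReg]
  · exact Nat.add_le_add le_rfl (Nat.le_add_right _ _)

/-! ### Initialization -/

/-- The registers after the first `j` rounds of the initial loop. -/
def scanReg (I : Problem) (j : ℕ) (r : ℕ) : ℤ :=
  if r = 0 then I.n else if r = 1 then runningMax I.p j else if r = 4 then I.before j else
  if r = 5 then j else if r = 20 then I.rowSum j else 0

theorem scanStep_reg {I : Problem} {j : ℕ} (hj : j < I.n) {s : State} (hs : s.reg = scanReg I j)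
    (hin : HasInput I 0 s.mem) : (scanStep.run s).reg = scanReg I (j + 1) := by
  have h0 : s.reg 0 = I.n := by rw [hs]; rfl
  have h1 : s.reg 1 = runningMax I.p j := by rw [hs]; rfl
  have h4 : s.reg 4 = I.before j := by rw [hs]; rfl
  have h5 : s.reg 5 = j := by rw [hs]; rfl
  have h20 : s.reg 20 = I.rowSum j := by rw [hs]; rfl
  have hp := hin.mem_p j hj (Nat.zero_le j)
  have hr := hin.mem_row j hj (Nat.zero_le j)
  funext r
  simp only [scanStep, run_block_cons, run_block_nil, run_branch]
  split_ifs with hle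
  · simp [h0, h1, h4, h5, h20, hp, hr] at hle ⊢
    rw [hs]
    unfold scanReg
    rw [runningMax, max_eq_left hle, I.before_succ, I.rowSum_succ]
    split_ifs <;> first | rfl | omega
  · simp [h0, h1, h4, h5, h20, hp, hr] at hle ⊢
    rw [hs]
    unfold scanReg
    rw [runningMax, max_eq_right hle.le, I.before_succ, I.rowSum_succ]
    split_ifs <;> first | rfl | omega

theorem scanStep_mem (s : State) : (scanStep.run s).mem = s.mem := by
  simp only [scanStep, run_block_cons, run_block_nil, run_branch]
  split_ifs <;> rfl

/-- The memory contains the input and nothing else. -/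
structure Fresh (I : Problem) (X : ℕ) (mem : ℤ → ℤ) : Prop where
  bounded : ∀ a, (mem a).natAbs ≤ X
  input : HasInput I 0 mem
  zero : ∀ a < 0, mem a = 0

theorem Fits.scan_bounded {I : Problem} {X : ℕ} (hX : Fits I X)
    (hmax : runningMax I.p I.n = I.pmax) {j : ℕ} (hj : j ≤ I.n) {s : State}
    (hs : s.reg = scanReg I j) (hm : Fresh I X s.mem) : s.Bounded X := by
  refine ⟨fun r => ?_, hm.bounded⟩
  have key : ∀ y : ℤ, 0 ≤ y → y ≤ X → y.natAbs ≤ X := fun y _ _ => by omega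
  have ite : ∀ (c : Prop) [Decidable c] (y z : ℤ), y.natAbs ≤ X → z.natAbs ≤ X →
      (if c then y else z).natAbs ≤ X := fun c _ y z hy hz => by
    split_ifs
    · exact hy
    · exact hz
  have h1 := before_le_total I hj
  have h2 := hX.total_le
  have h3 : 0 ≤ I.before j := I.before_nonneg j
  have hT : 0 ≤ I.total := I.before_nonneg I.n
  rw [hs]
  refine ite _ _ _ (key _ (by positivity) hX.n_le) ?_
  refine ite _ _ _ (key _ (runningMax_nonneg _ _)
    ((runningMax_mono _ hj).trans (hmax.le.trans hX.pmax_le))) ?_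
  refine ite _ _ _ (key _ h3 (by linarith)) ?_
  refine ite _ _ _ (key _ (by positivity) ((Int.ofNat_le.mpr hj).trans hX.n_le)) ?_
  exact ite _ _ _ (key _ (I.rowSum_nonneg j) ((I.rowSum_mono hj).trans hX.rowSum_le))
    (key _ le_rfl (by positivity))

theorem runs_scan {I : Problem} {X B : ℕ} (hX : Fits I X) (hmax : runningMax I.p I.n = I.pmax)
    (hB : X ^ scan.weight ≤ B) {s : State} (hs : s.reg = scanReg I 0) (hm : Fresh I X s.mem) :
    Runs B scan s (I.n * scan.size + scan.size)
      (fun s => s.reg = scanReg I I.n ∧ Fresh I X s.mem) := by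
  refine (Runs.loop (T := scanStep.size) (K := I.n)
    (fun j s => j ≤ I.n ∧ s.reg = scanReg I j ∧ Fresh I X s.mem)
    hX.two_le hB (fun j s h => hX.scan_bounded hmax h.1 h.2.1 h.2.2) (fun j s hj h => ?_)
    (fun s h => ?_) ⟨Nat.zero_le _, hs, hm⟩).mono ?_ fun _ h => h.2
  · obtain ⟨-, hs, hm⟩ := h
    refine ⟨?_, Runs.of_loopFree (by simp [scanStep, LoopFree, block]) hX.two_le
      (hX.scan_bounded hmax hj.le hs hm)
      ((Nat.pow_le_pow_right (by have := hX.two_le; omega) (weight_le_loop _ _ _)).trans hB)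
      ⟨hj, scanStep_reg hj hs hm.input, by rwa [scanStep_mem]⟩⟩
    simp only [Expr.eval_add, Expr.eval_reg, Expr.eval_const, hs]
    simp [scanReg]
    omega
  · obtain ⟨-, hs, hm⟩ := h
    simp [hs, scanReg]
  · exact Nat.add_le_add le_rfl (Nat.le_add_right _ _)

theorem eval_statesExpr {I : Problem} {s : State} (h2 : s.reg 2 = I.base) (h4 : s.reg 4 = I.total) :
    (statesExpr I.obj I.k).eval s = I.states := by
  unfold statesExpr Problem.states
  cases I.obj <;> simp [eval_power, h2, h4]

theorem eval_shiftExpr {I : Problem} {s : State} (h0 : s.reg 0 = I.n) (hin : HasInput I 0 s.mem) :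
    (shiftExpr I.obj).eval s = I.shift := by
  have hn := I.n_pos
  have hrow := hin.mem_row (I.n - 1) (by omega) (Nat.zero_le _)
  have e : (1 : ℤ) + I.n + ((I.n - 1 : ℕ) : ℤ) = I.n + I.n := by omega
  rw [e, Problem.row] at hrow
  unfold shiftExpr Problem.shift
  cases h : I.obj with
  | sumWC => rfl
  | sumWU => rfl
  | lMax =>
    rw [h] at hrow
    simp [h0, hrow]

theorem setup_reg {I : Problem} (hmax : runningMax I.p I.n = I.pmax) {s : State}
    (hs : s.reg = scanReg I I.n) (hin : HasInput I 0 s.mem) :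
    ((setup I.obj I.k).run s).reg = regs I I.n 0 (I.before I.n) 0 := by
  have h0 : s.reg 0 = I.n := by rw [hs]; rfl
  have h1 : s.reg 1 = I.pmax := by rw [hs, ← hmax]; rfl
  have h4 : s.reg 4 = I.total := by rw [hs]; rfl
  have h20 : s.reg 20 = I.rowSum I.n := by rw [hs]; rfl
  set s₁ := (Program.assign 2 (K 8 * (R 1 * R 1) + K 1)).run s with hs₁
  have a₁ : ∀ r, s₁.reg r = if r = 2 then I.base else s.reg r := fun r => by
    simp [hs₁, h1, Problem.base, sq]
  set s₂ := (Program.assign 3 (statesExpr I.obj I.k)).run s₁ with hs₂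
  have a₂ : ∀ r, s₂.reg r = if r = 3 then I.states else s₁.reg r := fun r => by
    rw [hs₂, run_assign_reg, eval_statesExpr (by simp [a₁]) (by simp [a₁, h4])]
  set s₃ := (Program.assign 17 ((R 4 + K 1) * (R 20 + K 1))).run s₂ with hs₃
  have a₃ : ∀ r, s₃.reg r = if r = 17 then I.infty else s₂.reg r := fun r => by
    simp [hs₃, a₂, a₁, h4, h20, Problem.infty]
  set s₄ := (Program.assign 18 (shiftExpr I.obj)).run s₃ with hs₄
  have a₄ : ∀ r, s₄.reg r = if r = 18 then I.shift else s₃.reg r := fun r => by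
    rw [hs₄, run_assign_reg, eval_shiftExpr (s := s₃) (by simp [a₃, a₂, a₁, h0]) hin]
  have e : (setup I.obj I.k).run s = (Program.assign 7 (R 4)).run s₄ := rfl
  funext r
  rw [e, run_assign_reg, Expr.eval_reg, a₄ r, a₃ r, a₂ r, a₁ r, a₄ 4, a₃ 4, a₂ 4, a₁ 4, h4, hs]
  rcases Nat.lt_or_ge 20 r with hr | hr
  · have hne : ∀ i ≤ 20, r ≠ i := fun i hi => by omega
    simp [scanReg, regs, fixedReg, hne]
  · interval_cases r <;> first | rfl | exact hmax

theorem setup_mem (obj : Objective) (k : ℕ) (s : State) : ((setup obj k).run s).mem = s.mem := rfl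

theorem filled_setup {I : Problem} {X : ℕ} (hmax : runningMax I.p I.n = I.pmax) {s : State}
    (hs : s.reg = scanReg I I.n) (hm : Fresh I X s.mem) :
    Filled I X I.n ((setup I.obj I.k).run s) := by
  have hS := states_pos I
  have hnS : 0 ≤ (I.n : ℤ) * I.states := by positivity
  refine ⟨setup_reg hmax hs hm.input, hm.bounded, hm.input, fun a ha => hm.zero a (by omega), ?_⟩
  intro t ht hnt L hL
  obtain rfl : t = I.n := by omega
  have := (hL.code_bounds le_rfl).1
  -- The last stage needs no filling: untouched cells hold `0`, the cost of no remaining jobs.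
  rw [Nat.sub_self, setup_mem, hm.zero _ (by omega)]
  rfl

theorem tracing_restart {I : Problem} {X : ℕ} {s : State} (h : Filled I X 0 s)
    (hopt : I.opt I.n 0 0 < I.infty) :
    Tracing I X (I.opt I.n 0 0) (fun _ => 0) 0 ((restart I.k).run s) := by
  have hL : (fun i => load I.p (fun _ => 0) i 0) = 0 := by
    funext i
    simp
  have h2 : s.reg 2 = I.base := by rw [h.reg]; rfl
  have h3 : s.reg 3 = I.states := by rw [h.reg]; rfl
  have h5 : s.reg 5 = 0 := by rw [h.reg]; rfl
  have hw : I.base / 2 = I.width := by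
    rw [I.base_eq]
    omega
  have hcode : I.width * ∑ t ∈ Finset.range I.k, I.base ^ t = I.code 0 := by
    rw [Problem.code, Finset.mul_sum]
    cases I.obj <;> simp
  have ht := h.table 0 (Nat.zero_le _) le_rfl 0 I.feasible_zero
  simp only [Nat.cast_zero, zero_mul, zero_add, Nat.sub_zero] at ht
  constructor
  · funext r
    simp only [restart, run_block_cons, run_block_nil, run_assign_reg, run_assign_mem, table,
      Expr.eval_mul, Expr.eval_div, Expr.eval_reg, Expr.eval_const, Expr.eval_load, Expr.eval_sub,
      Expr.eval_add, eval_geom]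
    simp only [show (5 : ℕ) ≠ 6 by decide, show (3 : ℕ) ≠ 6 by decide, if_false, if_true, h2, h3,
      h5, hw, hcode, zero_mul, zero_add, ht, hL]
    rw [h.reg]
    unfold regs
    split_ifs <;> first | rfl | omega
  · exact ⟨fun t ht => by omega, by rw [hL]; exact I.feasible_zero, fun t ht => by omega⟩
  · rw [hL]
    exact hopt
  · exact h.bounded
  · exact h.input
  · exact h.table
  · exact fun t ht => by omega
  · exact fun t ht => by omega

/-- The program computes an optimal assignment. -/
theorem runs_solve {I : Problem} {X B : ℕ} (hX : Fits I X) (hmax : runningMax I.p I.n = I.pmax)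
    (hB : X ^ (solve I.obj I.k).weight ≤ B) (hopt : I.opt I.n 0 0 < I.infty) {s : State}
    (hs : s.reg = fun _ => 0) (hm : Fresh I X s.mem) (h0 : s.mem 0 = I.n) :
    Runs B (solve I.obj I.k) s (13 * (solve I.obj I.k).size * (I.n * I.states.toNat)) (fun s =>
      ∃ a, I.Optimal a I.n ∧ s.mem 0 = I.opt I.n 0 0 - I.shift ∧ ∀ t < I.n,
        s.mem (1 + t) = I.machineOf (a t) ∧
        s.mem (1 + I.n + t) = I.startOf t (fun i => load I.p a i t) (a t)) := by
  have hX1 : 1 ≤ X := by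
    have := hX.two_le
    omega
  have hw : ∀ w ≤ (solve I.obj I.k).weight, X ^ w ≤ B := fun w hw =>
    (Nat.pow_le_pow_right hX1 hw).trans hB
  have hv := I.opt_nonneg I.n 0 (by omega) (L := 0) (fun _ => le_rfl)
  have w1 := weight_le_seq_right (.assign 0 (cell (K 0))) (.seq scan (.seq (setup I.obj I.k)
    (.seq (fill I.obj I.k) (.seq (restart I.k) (.seq (trace I.obj I.k) finish)))))
  have w2 := (weight_le_seq_right scan (.seq (setup I.obj I.k)
    (.seq (fill I.obj I.k) (.seq (restart I.k) (.seq (trace I.obj I.k) finish))))).trans w1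
  have w3 := (weight_le_seq_right (setup I.obj I.k)
    (.seq (fill I.obj I.k) (.seq (restart I.k) (.seq (trace I.obj I.k) finish)))).trans w2
  have w4 := (weight_le_seq_right (fill I.obj I.k)
    (.seq (restart I.k) (.seq (trace I.obj I.k) finish))).trans w3
  have w5 := (weight_le_seq_right (restart I.k) (.seq (trace I.obj I.k) finish)).trans w4
  have w6 := (weight_le_seq_right (trace I.obj I.k) finish).trans w5
  have r₀ : Runs B (.assign 0 (cell (K 0))) s (Program.assign 0 (cell (K 0))).size
      (fun s => s.reg = scanReg I 0 ∧ Fresh I X s.mem) := by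
    refine Runs.of_loopFree (p := .assign 0 (cell (K 0))) trivial hX.two_le ⟨fun r => ?_, hm.bounded⟩
      (hw _ (weight_le_seq_left _ _)) ⟨?_, hm⟩
    · rw [hs]
      exact Nat.zero_le _
    · funext r
      rw [run_assign_reg, hs]
      simp [h0, scanReg, Problem.before, Problem.rowSum, runningMax]
  refine (r₀.seq fun s₁ h₁ => (runs_scan hX hmax (hw _ ((weight_le_seq_left _ _).trans w1))
    h₁.1 h₁.2).seq fun s₂ h₂ => (Runs.of_loopFree (by trivial) hX.two_le
    (hX.scan_bounded hmax le_rfl h₂.1 h₂.2) (hw _ ((weight_le_seq_left _ _).trans w2))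
    (filled_setup hmax h₂.1 h₂.2)).seq fun s₃ h₃ => (runs_fill hX
    (hw _ ((weight_le_seq_left _ _).trans w3)) h₃).seq fun s₄ h₄ => (Runs.of_loopFree (by trivial)
    hX.two_le (h₄.state_bounded hX (Nat.zero_le _)) (hw _ ((weight_le_seq_left _ _).trans w4))
    (tracing_restart h₄ hopt)).seq fun s₅ h₅ => (runs_trace hX hv
    (hw _ ((weight_le_seq_left _ _).trans w5)) h₅).seq (T₂ := finish.size) fun s₆ h₆ => ?_).mono ?_
    fun _ h => h
  · obtain ⟨a, h₆⟩ := h₆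
    refine Runs.of_loopFree (p := finish) trivial hX.two_le (h₆.state_bounded hX hv le_rfl)
      (hw _ ((weight_le_seq_right _ _).trans w5)) ⟨a, h₆.optimal, ?_, fun t ht => ⟨?_, ?_⟩⟩
    · simp [finish, h₆.reg, regs, fixedReg]
    · rw [finish, run_store_mem, if_neg (by simp only [Expr.eval_const]; omega)]
      exact h₆.machine t ht
    · rw [finish, run_store_mem, if_neg (by simp only [Expr.eval_const]; omega)]
      exact h₆.start t ht
  -- The seven parts take at most `1, 2, 1, 5, 1, 2, 1` times their size times the number of table
  -- entries; `13` is the sum of these factors.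
  · have hS : 1 ≤ I.states.toNat := by
      have := states_pos I
      omega
    have h1 : 1 ≤ I.n * I.states.toNat := Nat.mul_le_mul I.n_pos hS
    have h2 : I.n ≤ I.n * I.states.toNat := Nat.le_mul_of_pos_right _ hS
    have e : (solve I.obj I.k).size = (Program.assign 0 (cell (K 0))).size + (scan.size +
      ((setup I.obj I.k).size + ((fill I.obj I.k).size + ((restart I.k).size +
        ((trace I.obj I.k).size + finish.size))))) := rfl
    rw [e]
    generalize (Program.assign 0 (cell (K 0))).size = a1
    generalize scan.size = a2
    generalize (setup I.obj I.k).size = a3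
    generalize (fill I.obj I.k).size = a4
    generalize (restart I.k).size = a5
    generalize (trace I.obj I.k).size = a6
    generalize finish.size = a7
    generalize I.n * I.states.toNat = N at *
    have b1 := Nat.mul_le_mul_left a1 h1
    have b2 := Nat.mul_le_mul_left a2 h1
    have b3 := Nat.mul_le_mul_left a3 h1
    have b4 := Nat.mul_le_mul_left a4 h1
    have b5 := Nat.mul_le_mul_left a5 h1
    have b6 := Nat.mul_le_mul_left a6 h1
    have b7 := Nat.mul_le_mul_left a7 h1
    have c2 := Nat.mul_le_mul_right a2 h2
    have c6 := Nat.mul_le_mul_right a6 h2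
    linarith

end Code
end Scheduling

namespace Scheduling

open RAM RAM.Program

/-! ### The input -/

theorem initial_mem_natCast (l : List ℤ) (i : ℕ) : (initial l).mem i = l.getD i 0 := by
  simp [initial]

theorem natAbs_le_foldr_max (l : List ℤ) {z : ℤ} (hz : z ∈ l) :
    z.natAbs ≤ (l.map Int.natAbs).foldr max 0 := by
  induction l with
  | nil => simp at hz
  | cons y l ih =>
    simp only [List.map_cons, List.foldr_cons]
    rcases List.mem_cons.mp hz with rfl | h
    · exact le_max_left _ _
    · exact (ih h).trans (le_max_right _ _)

theorem natAbs_initial_mem_le (l : List ℤ) (a : ℤ) :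
    ((initial l).mem a).natAbs ≤ l.length + (l.map Int.natAbs).foldr max 0 := by
  simp only [initial]
  split_ifs
  · rw [List.getD_eq_getElem?_getD]
    by_cases h : a.toNat < l.length
    · rw [List.getElem?_eq_getElem h, Option.getD_some]
      exact (natAbs_le_foldr_max l (List.getElem_mem h)).trans (Nat.le_add_left _ _)
    · rw [List.getElem?_eq_none (by omega)]
      exact Nat.zero_le _
  · exact Nat.zero_le _

theorem getD_ofFn_append {n : ℕ} (f : Fin n → ℕ) (l : List ℤ) {t : ℕ} (ht : t < n) :
    (List.ofFn (fun j => (f j : ℤ)) ++ l).getD t 0 = extend f t := by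
  rw [List.getD_append _ _ _ _ (by simpa using ht), List.getD_eq_getElem _ _ (by simpa using ht),
    List.getElem_ofFn, extend_of_lt f ht]

theorem getD_ofFn_append_right {n : ℕ} (f : Fin n → ℕ) (l : List ℤ) (t : ℕ) :
    (List.ofFn (fun j => (f j : ℤ)) ++ l).getD (n + t) 0 = l.getD t 0 := by
  rw [List.getD_append_right _ _ _ _ (by simp)]
  simp

theorem getD_cons_add_one (z : ℤ) (l : List ℤ) (t : ℕ) : (z :: l).getD (1 + t) 0 = l.getD t 0 := by
  rw [add_comm, List.getD_cons_succ]

namespace Code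

/-- For `N ≥ 2` the base is at most `16 * N ^ 2 ≤ N ^ 6`. So `base ^ k` accounts for `N ^ (6 * k)`,
and a further `N ^ 6` covers the factor `total + 1` of `sumWU` as well as `infty`. -/
theorem Fits.of_input {I : Problem} {N : ℕ} (hN : 2 ≤ N) (hn : I.n ≤ N) (hpmax : I.pmax ≤ N)
    (hrow : ∀ t < I.n, I.row t ≤ N) (hshift : I.shift ≤ N) : Fits I (N ^ (6 * I.k + 6)) := by
  have hNz : (2 : ℤ) ≤ N := by exact_mod_cast hN
  have hnz : (I.n : ℤ) ≤ N := by exact_mod_cast hn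
  have hpow : ∀ e f : ℕ, e ≤ f → (N : ℤ) ^ e ≤ (N : ℤ) ^ f := fun e f h =>
    pow_le_pow_right₀ (by omega) h
  have h2 : (4 : ℤ) ≤ N ^ 2 := by nlinarith
  have h3 : 2 * (N : ℤ) ^ 2 ≤ N ^ 3 := by nlinarith
  have h4 : (16 : ℤ) ≤ N ^ 4 := by nlinarith
  have h6 : 16 * (N : ℤ) ^ 2 ≤ N ^ 6 := by nlinarith
  have hsum : ∀ f : ℕ → ℤ, (∀ t < I.n, f t ≤ N) → ∑ t ∈ Finset.range I.n, f t ≤ (N : ℤ) ^ 2 := by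
    intro f hf
    have := Finset.sum_le_card_nsmul (Finset.range I.n) f N
      fun t ht => hf t (Finset.mem_range.mp ht)
    rw [Finset.card_range, nsmul_eq_mul] at this
    nlinarith
  have htotal : I.total ≤ (N : ℤ) ^ 2 := hsum _ fun t _ => (I.p_le t).trans hpmax
  have hrowSum : I.rowSum I.n ≤ (N : ℤ) ^ 2 := hsum _ hrow
  have hT : 0 ≤ I.total := I.before_nonneg I.n
  have hR := I.rowSum_nonneg I.n
  have hb0 := I.base_pos
  have hbase : I.base ≤ (N : ℤ) ^ 6 := by
    have := I.pmax_pos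
    have : I.pmax ^ 2 ≤ (N : ℤ) ^ 2 := pow_le_pow_left₀ this.le hpmax 2
    simp only [Problem.base]
    linarith
  have hbk : I.base ^ I.k ≤ (N : ℤ) ^ (6 * I.k) := by
    rw [pow_mul]
    exact pow_le_pow_left₀ hb0.le hbase I.k
  have hN1 : (N : ℤ) ^ 1 ≤ (N : ℤ) ^ (6 * I.k + 6) := hpow _ _ (by omega)
  have hN3 : (N : ℤ) ^ 3 ≤ (N : ℤ) ^ (6 * I.k + 6) := hpow _ _ (by omega)
  have hN6 : (N : ℤ) ^ 6 ≤ (N : ℤ) ^ (6 * I.k + 6) := hpow _ _ (by omega)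
  rw [pow_one] at hN1
  constructor <;> push_cast
  · exact hN.trans (Nat.le_self_pow (by omega) N)
  · omega
  · have h1 : I.k < 2 ^ I.k := Nat.lt_two_pow_self
    have h2 : 2 ^ I.k ≤ N ^ I.k := Nat.pow_le_pow_left hN _
    have h3 := hpow I.k (6 * I.k + 6) (by omega)
    have h4 : (I.k : ℤ) ≤ (N : ℤ) ^ I.k := by exact_mod_cast (h1.le.trans h2)
    exact h4.trans h3
  · omega
  · omega
  · unfold Problem.states
    have h5 : I.base ^ I.k * (I.total + 1) ≤ (N : ℤ) ^ (6 * I.k + 6) := by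
      rw [pow_add]
      have : I.total + 1 ≤ (N : ℤ) ^ 6 := by omega
      exact mul_le_mul hbk this (by omega) (by positivity)
    have h6 := hbk.trans (hpow _ (6 * I.k + 6) (by omega))
    cases I.obj
    · exact h6
    · exact h6
    · exact h5
  · omega
  · have : I.infty ≤ (N : ℤ) ^ 3 * (N : ℤ) ^ 3 :=
      mul_le_mul (by omega) (by omega) (by omega) (by positivity)
    rw [← pow_add] at this
    exact this.trans hN6
  · omega
  · omega

/-- On every input, the program computes an optimal assignment. -/
theorem exists_exec {I : Problem} (hmax : runningMax I.p I.n = I.pmax) {input : List ℤ}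
    (hin : HasInput I 0 (initial input).mem) (h0 : (initial input).mem 0 = I.n)
    (hlen : 2 ≤ input.length) (hopt : I.opt I.n 0 0 < I.infty) :
    ∃ t s, Exec (wordBound ((6 * I.k + 6) * (solve I.obj I.k).weight) input) (solve I.obj I.k)
      (initial input) t s ∧ t ≤ 13 * (solve I.obj I.k).size * (I.n * I.states.toNat) ∧
      ∃ a, I.Optimal a I.n ∧ s.mem 0 = I.opt I.n 0 0 - I.shift ∧ ∀ t < I.n,
        s.mem (1 + t) = I.machineOf (a t) ∧
        s.mem (1 + I.n + t) = I.startOf t (fun i => load I.p a i t) (a t) := by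
  have hmem := natAbs_initial_mem_le input
  unfold wordBound
  set N := input.length + (input.map Int.natAbs).foldr max 0 with hN
  have hN2 : 2 ≤ N := by omega
  have hn : I.n ≤ N := by
    have := hmem 0
    rw [h0] at this
    omega
  have hrow : ∀ t < I.n, I.row t ≤ N := fun t ht => by
    have := hmem (1 + I.n + t)
    rw [hin.mem_row t ht (Nat.zero_le t)] at this
    omega
  have hpmax : I.pmax ≤ N := by
    rw [← hmax]
    refine runningMax_le (by positivity) fun t ht => ?_
    have := hmem (1 + t)
    rw [hin.mem_p t ht (Nat.zero_le t)] at this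
    omega
  have hshift : I.shift ≤ N := by
    have h1 := hrow (I.n - 1) (by have := I.n_pos; omega)
    unfold Problem.row at h1
    unfold Problem.shift
    cases h : I.obj with
    | lMax => rwa [h] at h1
    | sumWC => exact Int.natCast_nonneg N
    | sumWU => exact Int.natCast_nonneg N
  have hX := Fits.of_input hN2 hn hpmax hrow hshift
  rw [pow_mul]
  have := runs_solve hX hmax le_rfl hopt (s := initial input) rfl
    ⟨fun a => (hmem a).trans (Nat.le_self_pow (by omega) N), hin, fun a ha => by
      simp [initial, ha]⟩ h0
  obtain ⟨t, s, h1, h2, h3⟩ := this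
  exact ⟨t, s, h1, h2, h3⟩

end Code

/-! ### From jobs to problems -/

/-- The scheduling problem for the given jobs with weights `w` and due dates `d`. -/
def Jobs.problem (J : Jobs) (obj : Objective) (k : ℕ) (w d : Fin J.n → ℕ) :
    Problem where
  obj := obj
  k := k
  n := J.n
  p := extend J.p
  w := extend w
  d := extend d
  pmax := runningMax (extend J.p) J.n
  n_pos := J.n_pos
  p_pos t ht := by
    rw [extend_of_lt _ ht]
    exact_mod_cast J.p_pos _
  p_nonneg := extend_nonneg _
  p_le t := by
    by_cases h : t < J.n
    · exact le_runningMax _ h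
    · simpa [extend, h] using runningMax_nonneg (extend J.p) J.n
  w_nonneg := extend_nonneg _
  d_nonneg := extend_nonneg _

theorem load_le_before (I : Problem) (a : ℕ → ℕ) (i j : ℕ) : load I.p a i j ≤ I.before j :=
  Finset.sum_le_sum fun t _ => by
    have := I.p_nonneg t
    split_ifs <;> omega

theorem load_succ_self (p : ℕ → ℤ) (a : ℕ → ℕ) (t : ℕ) :
    load p a (a t) t + p t = load p a (a t) (t + 1) := by
  simp [load_succ]

theorem load_add_le_total (I : Problem) (a : ℕ → ℕ) {t : ℕ} (ht : t < I.n) :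
    load I.p a (a t) t + I.p t ≤ I.total := by
  rw [load_succ_self]
  exact (load_le_before I a _ _).trans (I.before_mono ht)

/-- Jobs assigned to a machine occupy consecutive intervals within `[0, total]`. Late jobs are lined
up from `total` on, each leaving room for all jobs before it in the list. -/
theorem startOf_disjoint (I : Problem) (a : ℕ → ℕ) {s t : ℕ} (hst : s < t) (ht : t < I.n)
    (h : I.machineOf (a s) = I.machineOf (a t)) :
    I.startOf s (fun i => load I.p a i s) (a s) + I.p s ≤
        I.startOf t (fun i => load I.p a i t) (a t) ∨
      I.startOf t (fun i => load I.p a i t) (a t) + I.p t ≤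
        I.startOf s (fun i => load I.p a i s) (a s) := by
  have h1 := load_add_le_total I a (hst.trans ht)
  have h2 := load_add_le_total I a ht
  have h3 := I.before_nonneg s
  have h4 := I.before_nonneg t
  simp only [Problem.startOf, Problem.machineOf] at h ⊢
  by_cases hs : a s ≤ I.k <;> by_cases ht : a t ≤ I.k <;>
    simp only [hs, ht, if_true, if_false] at h ⊢
  · left
    have := load_mono I.p_nonneg a (a s) (Nat.succ_le_of_lt hst)
    rw [load_succ_self, ← h]
    exact this
  · left
    linarith
  · right
    linarith
  · left
    have := I.before_mono (Nat.succ_le_of_lt hst)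
    rw [Nat.succ_eq_add_one, I.before_succ] at this
    linarith

theorem startOf_nonneg (I : Problem) (a : ℕ → ℕ) (t : ℕ) :
    0 ≤ I.startOf t (fun i => load I.p a i t) (a t) := by
  have h1 : 0 ≤ I.total := I.before_nonneg I.n
  have h2 := I.before_nonneg t
  have h3 := load_nonneg I.p_nonneg a (a t) t
  unfold Problem.startOf
  split_ifs <;> linarith

section

variable (J : Jobs) (obj : Objective) (k : ℕ) (w d : Fin J.n → ℕ)

/-- The schedule without idle time for an assignment. -/
noncomputable def Jobs.listSchedule (a : ℕ → ℕ) : Schedule (k + 1) J where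
  machine x := ⟨(J.problem obj k w d).machineOf (a x), by
    have : (J.problem obj k w d).k = k := rfl
    unfold Problem.machineOf
    split_ifs <;> omega⟩
  start x := ((J.problem obj k w d).startOf x
    (fun i => load (J.problem obj k w d).p a i x) (a x) : ℤ)
  start_nonneg x := by exact_mod_cast startOf_nonneg (J.problem obj k w d) a x
  disjoint x y hxy h := by
    have h' := Fin.mk.inj h
    have hp : ∀ z : Fin J.n, (J.p z : ℝ) = (((J.problem obj k w d).p z : ℤ) : ℝ) := fun z => by
      simp [problem]
    rw [hp x, hp y]
    rcases lt_or_gt_of_ne hxy with hlt | hlt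
    · have := startOf_disjoint (J.problem obj k w d) a (Fin.lt_def.mp hlt) y.2 h'
      exact_mod_cast this
    · have := startOf_disjoint (J.problem obj k w d) a (Fin.lt_def.mp hlt) x.2 h'.symm
      exact_mod_cast this.symm

theorem Jobs.listSchedule_completion {a : ℕ → ℕ} {x : Fin J.n} (ha : a x ≤ k) :
    (J.listSchedule obj k w d a).completion x =
      ((load (extend J.p) a (a x) x + extend J.p x : ℤ) : ℝ) := by
  have h : (J.problem obj k w d).startOf x
      (fun i => load (J.problem obj k w d).p a i x) (a x) = load (extend J.p) a (a x) x :=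
    if_pos ha
  simp [Schedule.completion, listSchedule, h]

end

theorem Jobs.problem_runningMax_le (J : Jobs) : runningMax (extend J.p) J.n ≤ J.pmax := by
  refine runningMax_le (by positivity) fun t ht => ?_
  rw [extend_of_lt _ ht]
  exact_mod_cast Finset.le_sup (f := J.p) (Finset.mem_univ _)

theorem Jobs.one_le_pmax (J : Jobs) : 1 ≤ J.pmax :=
  (J.p_pos ⟨0, J.n_pos⟩).trans_le (Finset.le_sup (f := J.p) (Finset.mem_univ _))

theorem Jobs.le_P (J : Jobs) : 1 ≤ J.P :=
  (J.p_pos ⟨0, J.n_pos⟩).trans_le (Finset.single_le_sum (f := J.p) (fun _ _ => Nat.zero_le _)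
    (Finset.mem_univ _))

theorem Jobs.total_eq (J : Jobs) : ∑ t ∈ Finset.range J.n, extend J.p t = J.P := by
  rw [Finset.sum_range]
  simp [P]

theorem Jobs.base_pow_le (J : Jobs) (obj : Objective) (k : ℕ) (w d : Fin J.n → ℕ) :
    (J.problem obj k w d).base ^ k ≤ ((9 ^ k * J.pmax ^ (2 * k) : ℕ) : ℤ) := by
  have h1 : (1 : ℤ) ≤ J.pmax := by exact_mod_cast J.one_le_pmax
  have h2 := J.problem_runningMax_le
  have h3 := runningMax_nonneg (extend J.p) J.n
  -- The summand `1` of the base is absorbed because `pmax ≥ 1`.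
  have h4 : (J.problem obj k w d).base ≤ 9 * (J.pmax : ℤ) ^ 2 := by
    have : runningMax (extend J.p) J.n ^ 2 ≤ (J.pmax : ℤ) ^ 2 := pow_le_pow_left₀ h3 h2 2
    have h5 : (J.problem obj k w d).base = 8 * runningMax (extend J.p) J.n ^ 2 + 1 := rfl
    nlinarith
  have h6 := pow_le_pow_left₀ (J.problem obj k w d).base_pos.le h4 k
  rw [mul_pow, ← pow_mul] at h6
  exact_mod_cast h6

/-- The number of states is small enough for the claimed running time. -/
theorem Jobs.states_le (J : Jobs) (obj : Objective) (k : ℕ) (w d : Fin J.n → ℕ) :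
    (J.problem obj k w d).states.toNat ≤ match obj with
      | .sumWU => 9 ^ k * J.pmax ^ (2 * k) * (2 * J.P)
      | _ => 9 ^ k * J.pmax ^ (2 * k) := by
  have h1 := J.base_pow_le obj k w d
  have h2 : (J.problem obj k w d).total = J.P := J.total_eq
  have h3 := J.le_P
  rw [Int.toNat_le]
  cases obj with
  | sumWC => exact h1
  | lMax => exact h1
  | sumWU =>
    have h4 : (J.problem .sumWU k w d).states =
      (J.problem .sumWU k w d).base ^ k * ((J.problem .sumWU k w d).total + 1) := rfl
    rw [h4, h2]
    simp only
    rw [Nat.cast_mul]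
    -- Here `P + 1 ≤ 2 * P`, as `P ≥ 1`.
    exact mul_le_mul h1 (by push_cast; omega) (by omega) (by positivity)

end Scheduling

/-! ### Optimality for the three objectives -/

namespace Scheduling

open RAM RAM.Program Code

/-- A sandwich: `hlow` bounds every schedule from below by the value of the dynamic program, `hup`
bounds the list schedule of the traced assignment from above by it. So this schedule is optimal and
the value is exact. The order of the jobs enters only in `hlow`. -/
theorem solvableInTime_of_problem {obj : Objective} {k : ℕ} {input : Jobs → List ℤ}
    {Ordered : Jobs → Prop} {f : (J : Jobs) → Schedule (k + 1) J → ℝ} {T : Jobs → ℕ}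
    (w d : (J : Jobs) → Fin J.n → ℕ) (C : ℕ)
    (hin : ∀ J : Jobs, HasInput (J.problem obj k (w J) (d J)) 0 (initial (input J)).mem)
    (h0 : ∀ J : Jobs, (initial (input J)).mem 0 = J.n) (hlen : ∀ J : Jobs, 2 ≤ (input J).length)
    (hT : ∀ J : Jobs, J.n * (J.problem obj k (w J) (d J)).states.toNat ≤ C * T J)
    (hopt : ∀ J : Jobs, (J.problem obj k (w J) (d J)).opt J.n 0 0 <
      (J.problem obj k (w J) (d J)).infty)
    (hlow : ∀ (J : Jobs) (_ : Ordered J) (τ : Schedule (k + 1) J), (((J.problem obj k (w J) (d J)).opt J.n 0 0 -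
      (J.problem obj k (w J) (d J)).shift : ℤ) : ℝ) ≤ f J τ)
    (hup : ∀ (J : Jobs) (a : ℕ → ℕ), (J.problem obj k (w J) (d J)).Optimal a J.n →
      f J (J.listSchedule obj k (w J) (d J) a) ≤
        (((J.problem obj k (w J) (d J)).opt J.n 0 0 -
          (J.problem obj k (w J) (d J)).shift : ℤ) : ℝ)) :
    SolvableInTime (k + 1) input Ordered f T := by
  refine ⟨solve obj k, 13 * (solve obj k).size * C, (6 * k + 6) * (solve obj k).weight,
    fun J hJ => ?_⟩
  obtain ⟨t, s, he, ht, a, ha, hval, hout⟩ := exists_exec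
    (I := J.problem obj k (w J) (d J)) rfl (hin J) (h0 J) (hlen J) (hopt J)
  refine ⟨t, s, he, ?_, J.listSchedule obj k (w J) (d J) a, fun τ => ?_, ?_,
    fun x => ⟨(hout x x.2).1, ?_⟩⟩
  · rw [mul_assoc _ C]
    exact ht.trans (Nat.mul_le_mul_left _ (hT J))
  · exact (hup J a ha).trans (hlow J hJ τ)
  · rw [hval]
    exact le_antisymm (hlow J hJ _) (hup J a ha)
  · exact congrArg (Int.cast : ℤ → ℝ) (hout x x.2).2

theorem Problem.balanced_load (I : Problem) {a : ℕ → ℕ} {j : ℕ}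
    (h : ∀ i < I.k + 1, ∀ l < I.k + 1, load I.p a i j - load I.p a l j ≤ 4 * I.pmax ^ 2) :
    I.Balanced fun i => load I.p a i j := by
  intro t ht
  have h1 := h (t + 1) (by omega) 0 (by omega)
  have h2 := h 0 (by omega) (t + 1) (by omega)
  rw [abs_le, Problem.width]
  constructor <;> linarith

theorem Problem.opt_zero_le_cost (I : Problem) {a : ℕ → ℕ} (ha : ∀ t < I.n, a t < I.choices)
    (hb : ∀ j ≤ I.n, ∀ i < I.k + 1, ∀ l < I.k + 1,
      load I.p a i j - load I.p a l j ≤ 4 * I.pmax ^ 2) : I.opt I.n 0 0 ≤ I.cost a I.n 0 := by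
  have h := I.opt_le_cost ha (fun j hj => I.balanced_load (hb j hj)) I.n 0 (by omega)
  have e : (fun i => load I.p a i 0) = 0 := by
    funext i
    simp
  rwa [e] at h

theorem Problem.exists_balanced (I : Problem) (a : ℕ → ℕ) :
    ∃ a', Dominates I.p (I.k + 1) I.n a a' ∧ ∀ j ≤ I.n, ∀ i < I.k + 1, ∀ l < I.k + 1,
      load I.p a' i j - load I.p a' l j ≤ 4 * I.pmax ^ 2 :=
  Scheduling.exists_balanced I.pmax_pos I.p_nonneg I.p_le _ _ _

theorem assignment_lt {k : ℕ} {J : Jobs} (τ : Schedule (k + 1) J) (t : ℕ) (ht : t < J.n) :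
    τ.assignment (fun _ => True) t < k + 1 := by
  simpa [Schedule.assignment, ht] using (τ.machine ⟨t, ht⟩).2

theorem Schedule.completion_nonneg {m : ℕ} {J : Jobs} (τ : Schedule m J) (x : Fin J.n) :
    0 ≤ τ.completion x :=
  add_nonneg (τ.start_nonneg x) (Nat.cast_nonneg _)

/-! ### Total weighted completion time -/

section sumWC

variable (J : Jobs) (k : ℕ) (d : Fin J.n → ℕ)

/-- A balanced assignment exists, and all its jobs complete by `total`; so the optimum is at most
`rowSum * total`. -/
theorem opt_sumWC_lt :
    (J.problem .sumWC k J.w d).opt J.n 0 0 < (J.problem .sumWC k J.w d).infty := by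
  set I := J.problem .sumWC k J.w d with hI
  obtain ⟨a, ha, hb⟩ := I.exists_balanced fun _ => 0
  have h1 := I.opt_zero_le_cost (fun t _ => (ha.lt_of_lt t (Nat.succ_pos _)).trans_le
    (le_choices I)) hb
  rw [I.cost_sumWC rfl] at h1
  have h2 : ∑ t ∈ Finset.range I.n, I.w t * (load I.p a (a t) t + I.p t) ≤
      ∑ t ∈ Finset.range I.n, I.w t * I.total :=
    Finset.sum_le_sum fun t ht => mul_le_mul_of_nonneg_left
      (load_add_le_total I a (Finset.mem_range.mp ht)) (I.w_nonneg t)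
  rw [← Finset.sum_mul] at h2
  have h3 : ∑ t ∈ Finset.range I.n, I.w t = I.rowSum I.n := rfl
  have h4 : 0 ≤ I.total := I.before_nonneg I.n
  have h5 := I.rowSum_nonneg I.n
  rw [h3] at h2
  have h6 : I.infty = I.rowSum I.n * I.total + I.total + I.rowSum I.n + 1 := by
    rw [Problem.infty]
    ring
  exact (h1.trans h2).trans_lt (by omega)

theorem opt_sumWC_le (hJ : J.EfficiencyOrdered) (τ : Schedule (k + 1) J) :
    (((J.problem .sumWC k J.w d).opt J.n 0 0 - (J.problem .sumWC k J.w d).shift : ℤ) : ℝ) ≤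
      sumWC J τ := by
  set I := J.problem .sumWC k J.w d with hI
  have hshift : I.shift = 0 := rfl
  obtain ⟨a, ha, hb⟩ := I.exists_balanced (τ.assignment fun _ => True)
  have h1 := I.opt_zero_le_cost (fun t ht => (ha.lt_of_lt t (assignment_lt τ t ht)).trans_le
    (le_choices I)) hb
  rw [I.cost_sumWC rfl] at h1
  have h2 := h1.trans (ha.sumWC_le (assignment_lt τ) I.p_pos (fun t _ => I.w_nonneg t)
    (fun s t hst ht => by
      have h := hJ.mul_le (i := ⟨s, hst.trans_lt ht⟩) (j := ⟨t, ht⟩) (Fin.mk_le_mk.mpr hst)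
      have e1 : I.w t = J.w ⟨t, ht⟩ := extend_of_lt J.w ht
      have e2 : I.w s = J.w ⟨s, hst.trans_lt ht⟩ := extend_of_lt J.w _
      have e3 : I.p t = J.p ⟨t, ht⟩ := extend_of_lt J.p ht
      have e4 : I.p s = J.p ⟨s, hst.trans_lt ht⟩ := extend_of_lt J.p _
      rw [e1, e2, e3, e4]
      exact_mod_cast h))
  have h3 := τ.list_sumWC_le hJ
  rw [hshift, sub_zero]
  refine le_trans ?_ h3
  have h4 : ((I.opt J.n 0 0 : ℤ) : ℝ) ≤ ((∑ t ∈ Finset.range J.n, I.w t *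
      (load I.p (τ.assignment fun _ => True) (τ.assignment (fun _ => True) t) t + I.p t) : ℤ) : ℝ) :=
    Int.cast_le.mpr h2
  refine h4.trans (le_of_eq ?_)
  rw [Finset.sum_range]
  push_cast
  refine Finset.sum_congr rfl fun x _ => ?_
  simp [hI, Jobs.problem]

theorem sumWC_listSchedule {a : ℕ → ℕ} (ha : (J.problem .sumWC k J.w d).Optimal a J.n) :
    sumWC J (J.listSchedule .sumWC k J.w d a) ≤ (((J.problem .sumWC k J.w d).opt J.n 0 0 -
      (J.problem .sumWC k J.w d).shift : ℤ) : ℝ) := by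
  set I := J.problem .sumWC k J.w d with hI
  have hshift : I.shift = 0 := rfl
  have h1 : I.cost a I.n 0 = I.opt I.n 0 fun i => load I.p a i 0 :=
    Problem.Optimal.cost_eq ha I.n 0 (by omega)
  have e : (fun i => load I.p a i 0) = 0 := by
    funext i
    simp
  rw [I.cost_sumWC rfl, e] at h1
  have h2 : I.opt J.n 0 0 = ∑ t ∈ Finset.range J.n, I.w t * (load I.p a (a t) t + I.p t) := h1.symm
  rw [hshift, sub_zero, h2, Finset.sum_range]
  push_cast
  refine Finset.sum_le_sum fun x _ => ?_
  rw [J.listSchedule_completion .sumWC k J.w d (Nat.lt_succ_iff.mp (ha.lt_choices x x.2))]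
  simp [hI, Jobs.problem]

end sumWC

/-! ### Maximum lateness -/

section lMax

variable (J : Jobs) (k : ℕ) (w : Fin J.n → ℕ)

theorem le_lMax {m : ℕ} {J : Jobs} (σ : Schedule m J) (x : Fin J.n) :
    σ.completion x - J.d x ≤ lMax J σ :=
  Finset.le_sup' (fun j => σ.completion j - (J.d j : ℝ)) (Finset.mem_univ x)

theorem opt_lMax_lt :
    (J.problem .lMax k w J.d).opt J.n 0 0 < (J.problem .lMax k w J.d).infty := by
  set I := J.problem .lMax k w J.d with hI
  obtain ⟨a, ha, hb⟩ := I.exists_balanced fun _ => 0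
  have h1 := I.opt_zero_le_cost (fun t _ => (ha.lt_of_lt t (Nat.succ_pos _)).trans_le
    (le_choices I)) hb
  have h3 : I.shift ≤ I.rowSum I.n :=
    I.row_le (I.n - 1) (by have := I.n_pos; omega)
  have h4 : 0 ≤ I.total := I.before_nonneg I.n
  have h5 := I.rowSum_nonneg I.n
  have h2 : I.cost a I.n 0 ≤ I.total + I.rowSum I.n := by
    rw [I.cost_lMax_le rfl]
    refine ⟨by omega, fun t ht => ?_⟩
    have := load_add_le_total I a ht
    have := I.d_nonneg t
    omega
  have h6 : I.infty = I.rowSum I.n * I.total + I.total + I.rowSum I.n + 1 := by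
    rw [Problem.infty]
    ring
  have h7 := mul_nonneg h5 h4
  exact (h1.trans h2).trans_lt (by omega)

theorem opt_lMax_le (hd : Monotone J.d) (τ : Schedule (k + 1) J) :
    (((J.problem .lMax k w J.d).opt J.n 0 0 - (J.problem .lMax k w J.d).shift : ℤ) : ℝ) ≤
      lMax J τ := by
  set I := J.problem .lMax k w J.d with hI
  obtain ⟨a, ha, hb⟩ := I.exists_balanced (τ.assignment fun _ => True)
  have h1 := I.opt_zero_le_cost (fun t ht => (ha.lt_of_lt t (assignment_lt τ t ht)).trans_le
    (le_choices I)) hb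
  have hIn : I.n = J.n := rfl
  have hdt : ∀ t (ht : t < J.n), I.d t = J.d ⟨t, ht⟩ := fun t ht => extend_of_lt J.d ht
  -- Start times in `τ` are real while costs are integers, hence the floor. The bound is
  -- non-negative since the last job has non-negative completion time and its due date is the shift.
  have h2 : I.cost a I.n 0 ≤ ⌊lMax J τ⌋ + I.shift := by
    rw [I.cost_lMax_le rfl]
    constructor
    · have hn : I.n - 1 < J.n := by
        have := I.n_pos
        omega
      have h3 := le_lMax τ ⟨I.n - 1, hn⟩
      have h4 := τ.completion_nonneg ⟨I.n - 1, hn⟩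
      have h5 : I.shift = J.d ⟨I.n - 1, hn⟩ := hdt _ hn
      have h6 : -I.shift ≤ ⌊lMax J τ⌋ := by
        rw [Int.le_floor, h5]
        push_cast
        linarith
      omega
    · intro t ht
      -- In due date order, the first `t + 1` jobs all complete in `τ` by `lMax + d t`. So this
      -- bounds every load of that prefix, and domination passes the bound on to `a`.
      have h3 : load I.p a (a t) (t + 1) ≤ ⌊lMax J τ⌋ + I.d t := by
        refine ha.le_of_le (t + 1) ht _ (fun i hi => ?_) _ (ha.lt_of_lt t (assignment_lt τ t ht))
        have h4 := τ.load_assignment_le (fun _ => True) hi (j := t + 1) ht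
          (X := lMax J τ + J.d ⟨t, ht⟩) (by
            have h3 := le_lMax τ ⟨t, ht⟩
            have h4 := τ.completion_nonneg ⟨t, ht⟩
            linarith) (fun x hx _ => by
            have h3 := le_lMax τ x
            have h4 : (J.d x : ℝ) ≤ J.d ⟨t, ht⟩ :=
              Nat.cast_le.mpr (hd (Fin.le_def.mpr (Nat.lt_succ_iff.mp hx)))
            linarith)
        rw [← sub_le_iff_le_add, Int.le_floor, hdt t ht]
        push_cast
        exact sub_le_iff_le_add.mpr h4
      rw [load_succ_self]
      omega
  have h3 : I.opt J.n 0 0 - I.shift ≤ ⌊lMax J τ⌋ := sub_le_iff_le_add.mpr (h1.trans h2)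
  exact Int.le_floor.mp h3

theorem lMax_listSchedule {a : ℕ → ℕ} (ha : (J.problem .lMax k w J.d).Optimal a J.n) :
    lMax J (J.listSchedule .lMax k w J.d a) ≤ (((J.problem .lMax k w J.d).opt J.n 0 0 -
      (J.problem .lMax k w J.d).shift : ℤ) : ℝ) := by
  set I := J.problem .lMax k w J.d with hI
  have h1 : I.cost a I.n 0 = I.opt I.n 0 fun i => load I.p a i 0 :=
    Problem.Optimal.cost_eq ha I.n 0 (by omega)
  have e : (fun i => load I.p a i 0) = 0 := by
    funext i
    simp
  rw [e] at h1
  have h2 := ((I.cost_lMax_le rfl a _).mp h1.le).2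
  refine Finset.sup'_le _ _ fun x _ => ?_
  rw [J.listSchedule_completion .lMax k w J.d (Nat.lt_succ_iff.mp (ha.lt_choices x x.2))]
  have h3 := h2 x x.2
  have h4 : I.d x = J.d x := extend_fin J.d x
  have h5 : load (extend J.p) a (a x) x + extend J.p x - J.d x ≤ I.opt J.n 0 0 - I.shift := by
    rw [← h4]
    exact le_sub_iff_add_le.mpr h3
  exact_mod_cast h5

end lMax

/-! ### Weighted number of tardy jobs -/

section sumWU

variable (J : Jobs) (k : ℕ)

/-- Declaring all jobs late is always possible and costs the total weight. -/
theorem opt_sumWU_lt :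
    (J.problem .sumWU k J.w J.d).opt J.n 0 0 < (J.problem .sumWU k J.w J.d).infty := by
  set I := J.problem .sumWU k J.w J.d with hI
  have hk : ¬ I.k + 1 ≤ I.k := by omega
  have hload : ∀ i < I.k + 1, ∀ j, load I.p (fun _ => I.k + 1) i j = 0 := fun i hi j => by
    have : I.k + 1 ≠ i := by omega
    simp [load, this]
  have h1 := I.opt_zero_le_cost (a := fun _ => I.k + 1) (fun t _ => Nat.lt_succ_self _)
    (fun j _ i hi l hl => by
      rw [hload i hi, hload l hl]
      rw [sub_zero]
      exact I.width_pos.le)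
  rw [I.cost_sumWU rfl (fun t _ h => absurd h hk)] at h1
  simp only [hk, if_false] at h1
  have h3 : ∑ t ∈ Finset.range I.n, I.w t = I.rowSum I.n := rfl
  have h4 : 0 ≤ I.total := I.before_nonneg I.n
  have h5 := I.rowSum_nonneg I.n
  have h6 : I.infty = I.rowSum I.n * I.total + I.total + I.rowSum I.n + 1 := by
    rw [Problem.infty]
    ring
  have h7 := mul_nonneg h5 h4
  rw [h3] at h1
  exact h1.trans_lt (by omega)

theorem opt_sumWU_le (hd : Monotone J.d) (τ : Schedule (k + 1) J) :
    (((J.problem .sumWU k J.w J.d).opt J.n 0 0 -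
      (J.problem .sumWU k J.w J.d).shift : ℤ) : ℝ) ≤ sumWU J τ := by
  classical
  set I := J.problem .sumWU k J.w J.d with hI
  have hIk : I.k = k := rfl
  have hshift : I.shift = 0 := rfl
  have hch : I.choices = I.k + 1 + 1 := rfl
  -- Only the on-time jobs of `τ` keep their machines. The others get the value `k + 1`, which is
  -- the choice of being late, and balancing leaves it unchanged.
  let E : Fin J.n → Prop := fun x => τ.completion x ≤ J.d x
  obtain ⟨a, ha, hb⟩ := I.exists_balanced (τ.assignment E)
  have hE : ∀ x : Fin J.n, a x ≤ I.k ↔ E x := by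
    intro x
    have h := τ.assignment_fin E x
    by_cases hx : E x
    · rw [if_pos hx] at h
      have := ha.lt_of_lt x (by rw [h]; exact (τ.machine x).2)
      exact ⟨fun _ => hx, fun _ => by omega⟩
    · rw [if_neg hx] at h
      have := ha.eq_of_ge x h.ge
      exact ⟨fun h' => by omega, fun h' => absurd h' hx⟩
  have hlt : ∀ t < I.n, a t < I.choices := by
    intro t ht
    by_cases h : a t ≤ I.k
    · omega
    · have h1 : ¬ E ⟨t, ht⟩ := fun h' => h ((hE ⟨t, ht⟩).mpr h')
      have h2 := τ.assignment_fin E ⟨t, ht⟩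
      rw [if_neg h1] at h2
      have := ha.eq_of_ge t h2.ge
      simp only at h2
      omega
  have h1 := I.opt_zero_le_cost hlt hb
  have hdt : ∀ t (ht : t < J.n), I.d t = J.d ⟨t, ht⟩ := fun t ht => extend_of_lt J.d ht
  have hearly : ∀ t < I.n, a t ≤ I.k → load I.p a (a t) t + I.p t ≤ I.d t := by
    intro t ht hat
    rw [load_succ_self]
    refine ha.le_of_le (t + 1) ht _ (fun i hi => ?_) _ (Nat.lt_succ_of_le hat)
    have h4 := τ.load_assignment_le E hi (j := t + 1) ht (X := J.d ⟨t, ht⟩) (Nat.cast_nonneg _)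
      (fun x hx hEx => hEx.trans
        (Nat.cast_le.mpr (hd (Fin.le_def.mpr (Nat.lt_succ_iff.mp hx)))))
    rw [hdt t ht]
    exact_mod_cast h4
  rw [I.cost_sumWU rfl hearly] at h1
  rw [hshift, sub_zero]
  have h4 : ((I.opt J.n 0 0 : ℤ) : ℝ) ≤
      ((∑ t ∈ Finset.range J.n, if a t ≤ I.k then 0 else I.w t : ℤ) : ℝ) := Int.cast_le.mpr h1
  refine h4.trans (le_of_eq ?_)
  rw [Finset.sum_range]
  push_cast
  refine Finset.sum_congr rfl fun x _ => ?_
  have hw : I.w x = J.w x := extend_fin J.w x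
  by_cases hx : E x
  · rw [if_pos ((hE x).mpr hx), if_neg (not_lt.mpr hx)]
  · rw [if_neg (fun h => hx ((hE x).mp h)), if_pos (not_le.mp hx), hw]
    simp

theorem sumWU_listSchedule {a : ℕ → ℕ} (ha : (J.problem .sumWU k J.w J.d).Optimal a J.n) :
    sumWU J (J.listSchedule .sumWU k J.w J.d a) ≤ (((J.problem .sumWU k J.w J.d).opt J.n 0 0 -
      (J.problem .sumWU k J.w J.d).shift : ℤ) : ℝ) := by
  have hlt := opt_sumWU_lt J k
  set I := J.problem .sumWU k J.w J.d with hI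
  have hshift : I.shift = 0 := rfl
  have h1 : I.cost a I.n 0 = I.opt I.n 0 fun i => load I.p a i 0 :=
    Problem.Optimal.cost_eq ha I.n 0 (by omega)
  have e : (fun i => load I.p a i 0) = 0 := by
    funext i
    simp
  rw [e] at h1
  have hearly := I.early_of_cost_lt rfl (h1.trans_lt hlt)
  rw [I.cost_sumWU rfl hearly] at h1
  have h2 : I.opt J.n 0 0 = ∑ t ∈ Finset.range J.n, if a t ≤ I.k then 0 else I.w t := h1.symm
  rw [hshift, sub_zero, h2, Finset.sum_range]
  push_cast
  refine Finset.sum_le_sum fun x _ => ?_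
  have hw : I.w x = J.w x := extend_fin J.w x
  by_cases hx : a x ≤ I.k
  · have h3 := hearly x x.2 hx
    have h4 : I.d x = J.d x := extend_fin J.d x
    rw [h4] at h3
    rw [J.listSchedule_completion .sumWU k J.w J.d hx, if_pos hx, if_neg]
    rw [not_lt]
    exact_mod_cast h3
  -- A job declared late may still meet its due date at the end of the schedule, so only an
  -- inequality holds.
  · rw [if_neg hx, hw]
    split_ifs
    · simp
    · simp

end sumWU

/-! ### The input -/

theorem hasInput_of_rows {I : Problem} {J : Jobs} {l : List ℤ} (r : Fin J.n → ℕ) (hn : I.n = J.n)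
    (hp : I.p = extend J.p) (hr : I.row = extend r) (ho : I.obj ≠ .sumWU) :
    HasInput I 0 (initial ((J.n : ℤ) :: (List.ofFn (fun j => (J.p j : ℤ)) ++
      (List.ofFn (fun j => (r j : ℤ)) ++ l)))).mem := by
  refine ⟨fun t ht _ => ?_, fun t ht _ => ?_, fun h => absurd h ho⟩
  · have e : (1 : ℤ) + t = ((1 + t : ℕ) : ℤ) := by push_cast; ring
    rw [e, initial_mem_natCast, getD_cons_add_one, getD_ofFn_append _ _ (hn ▸ ht), hp]
  · have e : (1 : ℤ) + I.n + t = ((1 + (J.n + t) : ℕ) : ℤ) := by rw [hn]; push_cast; ring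
    rw [e, initial_mem_natCast, getD_cons_add_one, getD_ofFn_append_right,
      getD_ofFn_append _ _ (hn ▸ ht), hr]

theorem hasInput_inputPWD {I : Problem} {J : Jobs} (hn : I.n = J.n) (hp : I.p = extend J.p)
    (hr : I.row = extend J.w) (hd : I.d = extend J.d) :
    HasInput I 0 (initial J.inputPWD).mem := by
  have e' : J.inputPWD = (J.n : ℤ) :: (List.ofFn (fun j => (J.p j : ℤ)) ++
      (List.ofFn (fun j => (J.w j : ℤ)) ++ (List.ofFn (fun j => (J.d j : ℤ)) ++ []))) := by
    simp [Jobs.inputPWD]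
  rw [e']
  refine ⟨fun t ht _ => ?_, fun t ht _ => ?_, fun h t ht _ => ?_⟩
  · have e : (1 : ℤ) + t = ((1 + t : ℕ) : ℤ) := by push_cast; ring
    rw [e, initial_mem_natCast, getD_cons_add_one, getD_ofFn_append _ _ (hn ▸ ht), hp]
  · have e : (1 : ℤ) + I.n + t = ((1 + (J.n + t) : ℕ) : ℤ) := by rw [hn]; push_cast; ring
    rw [e, initial_mem_natCast, getD_cons_add_one, getD_ofFn_append_right,
      getD_ofFn_append _ _ (hn ▸ ht), hr]
  · have e : (1 : ℤ) + I.n + I.n + t = ((1 + (J.n + (J.n + t)) : ℕ) : ℤ) := by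
      rw [hn]; push_cast; ring
    rw [e, initial_mem_natCast, getD_cons_add_one, getD_ofFn_append_right,
      getD_ofFn_append_right, getD_ofFn_append _ _ (hn ▸ ht), hd]

theorem Jobs.P_le (J : Jobs) : J.P ≤ J.n * J.pmax := by
  have := Finset.sum_le_card_nsmul Finset.univ J.p J.pmax
    fun x _ => Finset.le_sup (f := J.p) (Finset.mem_univ x)
  simpa [P] using this

theorem Jobs.two_le (J : Jobs) : 2 ≤ J.n + 1 := Nat.succ_le_succ J.n_pos

theorem solvableInTime_sumWC (k : ℕ) :
    SolvableInTime (k + 1) Jobs.inputPW Jobs.EfficiencyOrdered (fun J => sumWC J)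
      (fun J => J.pmax ^ (2 * k) * J.n) := by
  refine solvableInTime_of_problem (obj := .sumWC) (fun J => J.w) (fun _ _ => 0)
    (9 ^ k) (fun J => ?_) (fun J => ?_) (fun J => ?_)
    (fun J => ?_) (fun J => opt_sumWC_lt J k _) (fun J hJ τ => opt_sumWC_le J k _ hJ τ)
    (fun J a ha => sumWC_listSchedule J k _ ha)
  · have h := hasInput_of_rows (I := J.problem .sumWC k J.w (fun _ => 0)) (l := [])
      J.w rfl rfl rfl (fun h => nomatch h)
    rwa [List.append_nil] at h
  · simp [initial, Jobs.inputPW]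
  · have := J.two_le
    simp only [Jobs.inputPW, List.length_cons, List.length_append, List.length_ofFn]
    omega
  · have h := J.states_le .sumWC k J.w (fun _ => 0)
    refine (Nat.mul_le_mul_left J.n h).trans (le_of_eq ?_)
    ring

theorem solvableInTime_lMax (k : ℕ) :
    SolvableInTime (k + 1) Jobs.inputPD Jobs.DueDateOrdered (fun J => lMax J)
      (fun J => J.pmax ^ (2 * k) * J.n) := by
  have hd : ∀ J : Jobs, J.DueDateOrdered → Monotone J.d := fun J hJ i j hij => hJ i j hij
  refine solvableInTime_of_problem (obj := .lMax) (fun _ _ => 0) (fun J => J.d) (9 ^ k) (fun J => ?_) (fun J => ?_) (fun J => ?_)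
    (fun J => ?_) (fun J => opt_lMax_lt J k _) (fun J hJ τ => opt_lMax_le J k _ (hd J hJ) τ)
    (fun J a ha => lMax_listSchedule J k _ ha)
  · have h := hasInput_of_rows (I := J.problem .lMax k (fun _ => 0) J.d) (l := [])
      J.d rfl rfl rfl (fun h => nomatch h)
    rwa [List.append_nil] at h
  · simp [initial, Jobs.inputPD]
  · have := J.two_le
    simp only [Jobs.inputPD, List.length_cons, List.length_append, List.length_ofFn]
    omega
  · have h := J.states_le .lMax k (fun _ => 0) J.d
    refine (Nat.mul_le_mul_left J.n h).trans (le_of_eq ?_)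
    ring

theorem solvableInTime_sumWU (k : ℕ) :
    SolvableInTime (k + 1) Jobs.inputPWD Jobs.DueDateOrdered (fun J => sumWU J)
      (fun J => J.pmax ^ (2 * k) * J.P * J.n) := by
  have hd : ∀ J : Jobs, J.DueDateOrdered → Monotone J.d := fun J hJ i j hij => hJ i j hij
  refine solvableInTime_of_problem (obj := .sumWU) (fun J => J.w) (fun J => J.d) (9 ^ k * 2) (fun J => hasInput_inputPWD rfl rfl rfl rfl) (fun J => ?_) (fun J => ?_)
    (fun J => ?_) (fun J => opt_sumWU_lt J k) (fun J hJ τ => opt_sumWU_le J k (hd J hJ) τ)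
    (fun J a ha => sumWU_listSchedule J k ha)
  · simp [initial, Jobs.inputPWD]
  · have := J.two_le
    simp only [Jobs.inputPWD, List.length_cons, List.length_append, List.length_ofFn]
    omega
  · have h := J.states_le .sumWU k J.w J.d
    refine (Nat.mul_le_mul_left J.n h).trans (le_of_eq ?_)
    ring

end Scheduling

theorem theorem3 (m : ℕ) (hm : 1 ≤ m) :
    Scheduling.SolvableInTime m Scheduling.Jobs.inputPW Scheduling.Jobs.EfficiencyOrdered
      (fun J => Scheduling.sumWC J) (fun J => J.pmax ^ (2 * m - 2) * J.n) ∧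
    Scheduling.SolvableInTime m Scheduling.Jobs.inputPD Scheduling.Jobs.DueDateOrdered
      (fun J => Scheduling.lMax J) (fun J => J.pmax ^ (2 * m - 2) * J.n) ∧
    Scheduling.SolvableInTime m Scheduling.Jobs.inputPWD Scheduling.Jobs.DueDateOrdered
      (fun J => Scheduling.sumWU J) (fun J => J.pmax ^ (2 * m - 2) * J.P * J.n) ∧
    ∀ J : Scheduling.Jobs,
      J.pmax ^ (2 * m - 2) * J.P * J.n ≤ J.pmax ^ (2 * m - 1) * J.n ^ 2 := by
  obtain ⟨k, rfl⟩ : ∃ k, m = k + 1 := ⟨m - 1, by omega⟩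
  rw [show 2 * (k + 1) - 2 = 2 * k by omega, show 2 * (k + 1) - 1 = 2 * k + 1 by omega]
  refine ⟨Scheduling.solvableInTime_sumWC k, Scheduling.solvableInTime_lMax k,
    Scheduling.solvableInTime_sumWU k, fun J => ?_⟩
  calc J.pmax ^ (2 * k) * J.P * J.n ≤ J.pmax ^ (2 * k) * (J.n * J.pmax) * J.n :=
        Nat.mul_le_mul_right _ (Nat.mul_le_mul_left _ J.P_le)
    _ = J.pmax ^ (2 * k + 1) * J.n ^ 2 := by ring
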